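/- Let $k$ be a field, let $Q$ be a finite quiver with vertices $1,\dots,n$, and let $I\subseteq kQ$ be an admissible monomial ideal, i.e. an ideal generated by paths of length at least two and containing all sufficiently long paths. Paths are composed like maps: $pq$ means first $q$, then $p$. Let $A=kQ/I$, let $e_i\in A$ be the class of the trivial path at $i$, and call the elements $p+I$ with $p\notin I$ a path of $Q$ the paths of $A$. Let $P_i=Ae_i$, let $L_i=P_i/\operatorname{rad}P_i$, and let $\Delta_i$ be the largest quotient of $P_i$ having no composition factor $L_j$ with $j>i$. Assume that $A$ is quasi-hereditary with respect to $1<\dots<n$, i.e. the left module $A$ has a finite filtration with subquotients of the form $\Delta_i$, and $\operatorname{End}_A(\Delta_i)\cong k$ for all $i$. A path $x\in e_jAe_i$ of $A$ is direction-preserving if $i<j$. Let $B_{\max}$ be the subalgebra of $A$ generated by all $e_i$ and all direction-preserving paths. A path $x$ of $A$ is called right-minimal direction-preserving if $x\in B_{\max}$ and $x\notin\operatorname{rad}(A)\operatorname{rad}(B_{\max})$ (in this convention the trivial paths $e_i$ are included). Let $B_{\min}$ be the subalgebra of $A$ generated by all right-minimal direction-preserving paths. Let $1\le i_0\le n$ and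 $e=e_{i_0}+\dots+e_n$. In $eAe$, use the idempotents $e_{i_0},\dots,e_n$ with their order, and call the paths of $A$ which lie in $eAe$ the paths of $eAe$; define simple and standard modules, quasi-heredity and right-minimal direction-preserving paths for $eAe$ as above, with $\operatorname{rad}(eAe)$ and the algebra $B_{\max}$ of $eAe$. Then $eAe$ is quasi-hereditary with respect to $i_0<\dots<n$; the subset $eB_{\min}e$ is equal to the subalgebra of $eAe$ generated by the right-minimal direction-preserving paths of $eAe$; and it is an exact Borel subalgebra of $eAe$. Here a subalgebra $B$ of an algebra $R$ which is quasi-hereditary with simple modules $L_i$ and standard modules $\Delta_i$ ($i$ in a totally ordered index set) is called an exact Borel subalgebra if $R\otimes_B-$ is exact on finite-dimensional left $B$-modules, and there is a complete irredundant list $(L_i^B)_i$ of the simple $B$-modules, with the same index set, such that $R\otimes_BL_i^B\cong\Delta_i$ and $\operatorname{End}_B(L_i^B)\cong\operatorname{End}_R(L_i)$ for all $i$, and $\operatorname{Ext}^1_B(L_i^B,L_j^B)\ne0$ implies $i\le j$. -/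

import Mathlib

open scoped TensorProduct

universe u v w z

noncomputable section

namespace MonomialBorel

/-! ## Path algebras of quivers -/

section PathAlgebra

/-- All paths of a quiver: a source, a target and a path from the source to the target. -/
abbrev AnyPath (V : Type v) [Quiver.{w} V] := Σ i : V, Σ j : V, Quiver.Path i j

variable {V : Type v} [Quiver.{w} V]

namespace AnyPath

/-- The starting vertex `s(p)`. -/
def source (p : AnyPath V) : V := p.1

/-- The terminal vertex `t(p)`. -/
def target (p : AnyPath V) : V := p.2.1

/-- The number of arrows of a path. -/
def length (p : AnyPath V) : ℕ := p.2.2.length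

/-- The trivial path at a vertex. -/
def trivial (i : V) : AnyPath V := ⟨i, i, Quiver.Path.nil⟩

open Classical in
/-- The product `p q` of two paths, "first `q`, then `p`"; it is `none` unless `t(q) = s(p)`. -/
def mul? (p q : AnyPath V) : Option (AnyPath V) :=
  if h : q.2.1 = p.1 then some ⟨q.1, p.2.1, q.2.2.comp (p.2.2.cast h.symm rfl)⟩ else none

theorem mul?_mk {i j l : V} (p : Quiver.Path j l) (q : Quiver.Path i j) :
    mul? (⟨j, l, p⟩ : AnyPath V) ⟨i, j, q⟩ = some ⟨i, l, q.comp p⟩ := by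
  simp [mul?]

theorem mul?_of_ne {p q : AnyPath V} (h : q.2.1 ≠ p.1) : mul? p q = none := by
  simp [mul?, h]

theorem mul?_assoc (p q r : AnyPath V) :
    (mul? p q).bind (fun x => mul? x r) = (mul? q r).bind (fun y => mul? p y) := by
  obtain ⟨a, b, p⟩ := p
  obtain ⟨c, d, q⟩ := q
  obtain ⟨f, g, r⟩ := r
  by_cases h1 : d = a
  · subst h1
    by_cases h2 : g = c
    · subst h2
      simp [mul?_mk]
    · rw [mul?_mk, mul?_of_ne (p := ⟨c, d, q⟩) (by exact h2)]
      simp [mul?_of_ne (p := ⟨c, b, q.comp p⟩) (q := ⟨f, g, r⟩) h2]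
  · rw [mul?_of_ne (p := ⟨a, b, p⟩) (by exact h1)]
    by_cases h2 : g = c
    · subst h2
      rw [mul?_mk]
      simp [mul?_of_ne (p := ⟨a, b, p⟩) (q := ⟨f, d, r.comp q⟩) h1]
    · rw [mul?_of_ne (p := ⟨c, d, q⟩) (by exact h2)]
      simp

end AnyPath

/-- The path algebra `k Q`: the vector space with basis the paths of `Q`. -/
def PathAlgebra (k : Type u) [Field k] (V : Type v) [Quiver.{w} V] := AnyPath V →₀ k

namespace PathAlgebra

variable {k : Type u} [Field k]

instance : AddCommGroup (PathAlgebra k V) := inferInstanceAs (AddCommGroup (AnyPath V →₀ k))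

instance : Module k (PathAlgebra k V) := inferInstanceAs (Module k (AnyPath V →₀ k))

variable (k) in
/-- The basis element of `k Q` given by a path. -/
def ofPath (p : AnyPath V) : PathAlgebra k V := Finsupp.single p 1

variable (k) in
/-- A path, or `none`, as an element of `k Q`, where `none` gives `0`. -/
def ofOption (p : Option (AnyPath V)) : PathAlgebra k V := p.elim 0 (ofPath k)

variable (k V) in
/-- The bilinear multiplication of `k Q`, given on paths by `AnyPath.mul?`. -/
def mulLin : PathAlgebra k V →ₗ[k] PathAlgebra k V →ₗ[k] PathAlgebra k V :=
  Finsupp.linearCombination k fun p : AnyPath V =>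
    (Finsupp.linearCombination k fun q : AnyPath V => ofOption k (AnyPath.mul? p q) :
      (AnyPath V →₀ k) →ₗ[k] PathAlgebra k V)

instance : Mul (PathAlgebra k V) := ⟨fun x y => mulLin V k x y⟩

theorem mul_def (x y : PathAlgebra k V) : x * y = mulLin V k x y := rfl

theorem ofPath_mul (p q : AnyPath V) :
    ofPath k p * ofPath k q = ofOption k (AnyPath.mul? p q) := by
  rw [mul_def]
  refine (LinearMap.congr_fun
    ((Finsupp.linearCombination_single k 1 p).trans (one_smul _ _)) _).trans ?_
  exact (Finsupp.linearCombination_single k 1 q).trans (one_smul _ _)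

theorem add_mul' (x y t : PathAlgebra k V) : (x + y) * t = x * t + y * t := by
  simp [mul_def]

theorem mul_add' (x y t : PathAlgebra k V) : x * (y + t) = x * y + x * t := by
  simp [mul_def]

theorem smul_mul' (c : k) (x y : PathAlgebra k V) : (c • x) * y = c • (x * y) := by
  simp [mul_def]

theorem mul_smul' (c : k) (x y : PathAlgebra k V) : x * (c • y) = c • (x * y) := by
  simp [mul_def]

theorem zero_mul' (x : PathAlgebra k V) : 0 * x = 0 := by simp [mul_def]

theorem mul_zero' (x : PathAlgebra k V) : x * 0 = 0 := by simp [mul_def]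

/-- Every element of `k Q` is a linear combination of paths. -/
theorem induction_on {C : PathAlgebra k V → Prop} (x : PathAlgebra k V) (h0 : C 0)
    (hadd : ∀ x y, C x → C y → C (x + y)) (hsmul : ∀ (c : k) x, C x → C (c • x))
    (hp : ∀ p, C (ofPath k p)) : C x := by
  refine Finsupp.induction_linear (motive := C) x h0 hadd fun p c => ?_
  have h : (Finsupp.single p c : AnyPath V →₀ k) = c • (Finsupp.single p 1) := by simp
  rw [h]
  exact hsmul c _ (hp p)

theorem ofOption_mul (x : Option (AnyPath V)) (r : AnyPath V) :
    ofOption k x * ofPath k r = ofOption k (x.bind fun y => AnyPath.mul? y r) := by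
  cases x with
  | none => exact zero_mul' _
  | some p => exact ofPath_mul p r

theorem mul_ofOption (p : AnyPath V) (x : Option (AnyPath V)) :
    ofPath k p * ofOption k x = ofOption k (x.bind fun y => AnyPath.mul? p y) := by
  cases x with
  | none => exact mul_zero' _
  | some q => exact ofPath_mul p q

theorem mul_assoc' (x y t : PathAlgebra k V) : x * y * t = x * (y * t) := by
  induction x using induction_on with
  | h0 => simp only [zero_mul']
  | hadd a b ha hb => simp only [add_mul', ha, hb]
  | hsmul c a ha => simp only [smul_mul', ha]
  | hp p =>
    induction y using induction_on with
    | h0 => simp only [zero_mul', mul_zero']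
    | hadd a b ha hb => simp only [add_mul', mul_add', ha, hb]
    | hsmul c a ha => simp only [smul_mul', mul_smul', ha]
    | hp q =>
      induction t using induction_on with
      | h0 => simp only [mul_zero']
      | hadd a b ha hb => simp only [mul_add', ha, hb]
      | hsmul c a ha => simp only [mul_smul', ha]
      | hp r => rw [ofPath_mul, ofPath_mul, ofOption_mul, mul_ofOption, AnyPath.mul?_assoc]

variable (k) in
/-- The trivial path `e_i` in `k Q`. -/
def vertex (i : V) : PathAlgebra k V := ofPath k (AnyPath.trivial i)

theorem vertex_mul_ofPath (i : V) (p : AnyPath V) :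
    vertex k p.2.1 * ofPath k p = ofPath k p ∧
      (i ≠ p.2.1 → vertex k i * ofPath k p = 0) := by
  obtain ⟨a, b, p⟩ := p
  refine ⟨?_, fun h => ?_⟩
  · rw [vertex, ofPath_mul, AnyPath.trivial, AnyPath.mul?_mk]
    rfl
  · rw [vertex, ofPath_mul, AnyPath.mul?_of_ne (by exact h.symm)]
    rfl

theorem ofPath_mul_vertex (i : V) (p : AnyPath V) :
    ofPath k p * vertex k p.1 = ofPath k p ∧
      (i ≠ p.1 → ofPath k p * vertex k i = 0) := by
  obtain ⟨a, b, p⟩ := p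
  refine ⟨?_, fun h => ?_⟩
  · rw [vertex, ofPath_mul, AnyPath.trivial, AnyPath.mul?_mk, Quiver.Path.nil_comp]
    rfl
  · rw [vertex, ofPath_mul, AnyPath.mul?_of_ne (by exact h)]
    rfl

theorem sum_mul' {ι : Type*} (s : Finset ι) (f : ι → PathAlgebra k V) (y : PathAlgebra k V) :
    (∑ i ∈ s, f i) * y = ∑ i ∈ s, f i * y := by
  simp [mul_def]

theorem mul_sum' {ι : Type*} (s : Finset ι) (f : ι → PathAlgebra k V) (y : PathAlgebra k V) :
    y * (∑ i ∈ s, f i) = ∑ i ∈ s, y * f i := by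
  simp [mul_def]

variable [Fintype V]

/-- The unit of `k Q` is the sum of all trivial paths. -/
instance : One (PathAlgebra k V) := ⟨∑ i : V, vertex k i⟩

theorem one_def : (1 : PathAlgebra k V) = ∑ i : V, vertex k i := rfl

theorem one_mul' (x : PathAlgebra k V) : 1 * x = x := by
  induction x using induction_on with
  | h0 => exact mul_zero' _
  | hadd a b ha hb => rw [mul_add', ha, hb]
  | hsmul c a ha => rw [mul_smul', ha]
  | hp p =>
    rw [one_def, sum_mul', Finset.sum_eq_single p.2.1
      (fun i _ h => (vertex_mul_ofPath i p).2 h) (fun h => absurd (Finset.mem_univ _) h)]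
    exact (vertex_mul_ofPath p.2.1 p).1

theorem mul_one' (x : PathAlgebra k V) : x * 1 = x := by
  induction x using induction_on with
  | h0 => exact zero_mul' _
  | hadd a b ha hb => rw [add_mul', ha, hb]
  | hsmul c a ha => rw [smul_mul', ha]
  | hp p =>
    rw [one_def, mul_sum', Finset.sum_eq_single p.1
      (fun i _ h => (ofPath_mul_vertex i p).2 h) (fun h => absurd (Finset.mem_univ _) h)]
    exact (ofPath_mul_vertex p.1 p).1

instance : Ring (PathAlgebra k V) where
  __ := (inferInstance : AddCommGroup (PathAlgebra k V))
  left_distrib x y t := mul_add' x y t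
  right_distrib x y t := add_mul' x y t
  zero_mul := zero_mul'
  mul_zero := mul_zero'
  mul_assoc := mul_assoc'
  one_mul := one_mul'
  mul_one := mul_one'

instance : Algebra k (PathAlgebra k V) := Algebra.ofModule smul_mul' mul_smul'

theorem orthogonalIdempotents_vertex : OrthogonalIdempotents (vertex k : V → PathAlgebra k V) where
  idem i := (vertex_mul_ofPath i (AnyPath.trivial i)).1
  ortho _ j h := (vertex_mul_ofPath _ (AnyPath.trivial j)).2 h

end PathAlgebra
end PathAlgebra

/-! ## Monomial algebras -/

section Monomial

variable (k : Type u) [Field k] {V : Type v} [Quiver.{w} V] [Fintype V]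

/-- The two-sided ideal of `k Q` generated by a set of paths. -/
def pathIdeal (S : Set (AnyPath V)) : Ideal (PathAlgebra k V) :=
  (TwoSidedIdeal.span (PathAlgebra.ofPath k '' S)).asIdeal

instance (S : Set (AnyPath V)) : (pathIdeal k S).IsTwoSided := by
  unfold pathIdeal; infer_instance

/-- The ideal generated by `S` is an admissible monomial ideal: it is generated by paths of length
at least two, and it contains all paths of sufficiently large length. -/
structure IsAdmissible (S : Set (AnyPath V)) : Prop where
  two_le_length : ∀ p ∈ S, 2 ≤ p.length
  exists_long_mem : ∃ N : ℕ, ∀ p : AnyPath V, N ≤ p.length → PathAlgebra.ofPath k p ∈ pathIdeal k S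

/-- The monomial algebra `A = k Q / I`, where `I` is generated by the set of paths `S`. -/
abbrev MonomialAlgebra (S : Set (AnyPath V)) : Type max u v w :=
  PathAlgebra k V ⧸ pathIdeal k S

variable (S : Set (AnyPath V))

/-- The idempotent `e_i^A = e_i + I`. -/
def MonomialAlgebra.idem (i : V) : MonomialAlgebra k S :=
  Ideal.Quotient.mk (pathIdeal k S) (PathAlgebra.vertex k i)

/-- The paths in `A`: the elements `p + I` with `p` a path of `Q` not in `I`. -/
def MonomialAlgebra.paths : Set (MonomialAlgebra k S) :=
  {x | ∃ p : AnyPath V, PathAlgebra.ofPath k p ∉ pathIdeal k S ∧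
    x = Ideal.Quotient.mk (pathIdeal k S) (PathAlgebra.ofPath k p)}

theorem MonomialAlgebra.orthogonalIdempotents_idem :
    OrthogonalIdempotents (MonomialAlgebra.idem k S) :=
  (PathAlgebra.orthogonalIdempotents_vertex (k := k) (V := V)).map
    (Ideal.Quotient.mk (pathIdeal k S))

/-- The idempotents of `A`, indexed through a numbering `ν` of the vertices. -/
def MonomialAlgebra.numberedIdem {n : ℕ} (ν : Fin n ≃ V) (i : Fin n) : MonomialAlgebra k S :=
  MonomialAlgebra.idem k S (ν i)

theorem MonomialAlgebra.orthogonalIdempotents_numberedIdem {n : ℕ} (ν : Fin n ≃ V) :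
    OrthogonalIdempotents (MonomialAlgebra.numberedIdem k S ν) :=
  (MonomialAlgebra.orthogonalIdempotents_idem k S).embedding ν.toEmbedding

end Monomial

/-! ## Idempotent subalgebras `e A e` -/

section Corner

variable {k : Type u} [Field k] {R : Type w} [Ring R] [Algebra k R] {e : R}

instance (he : IsIdempotentElem e) : SMul k he.Corner where
  smul c x := ⟨c • x.1, (Subsemigroup.mem_corner_iff he).2
    ⟨by rw [mul_smul_comm, ((Subsemigroup.mem_corner_iff he).1 x.2).1],
      by rw [smul_mul_assoc, ((Subsemigroup.mem_corner_iff he).1 x.2).2]⟩⟩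

instance (he : IsIdempotentElem e) : Module k he.Corner where
  one_smul x := Subtype.ext (one_smul k x.1)
  mul_smul c d x := Subtype.ext (mul_smul c d x.1)
  smul_zero c := Subtype.ext (smul_zero (A := R) c)
  smul_add c x y := Subtype.ext (smul_add c x.1 y.1)
  add_smul c d x := Subtype.ext (add_smul c d x.1)
  zero_smul x := Subtype.ext (zero_smul k x.1)

instance (he : IsIdempotentElem e) : Algebra k he.Corner :=
  Algebra.ofModule (fun c x y => Subtype.ext (smul_mul_assoc c x.1 y.1))
    (fun c x y => Subtype.ext (mul_smul_comm c x.1 y.1))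

variable {ι : Type z} [LinearOrder ι] [LocallyFiniteOrderTop ι] {f : ι → R}

/-- The idempotent `∑_{i ≥ i₀} f i` of a family `f`. -/
def upperSum (f : ι → R) (i₀ : ι) : R := ∑ i ∈ Finset.Ici i₀, f i

theorem isIdempotentElem_upperSum (hf : OrthogonalIdempotents f) (i₀ : ι) :
    IsIdempotentElem (upperSum f i₀) :=
  hf.isIdempotentElem_sum

/-- The idempotents `f i`, `i ≥ i₀`, as elements of `e R e`, where `e = ∑_{i ≥ i₀} f i`. -/
def cornerIdem (hf : OrthogonalIdempotents f) (i₀ : ι) (i : Set.Ici i₀) :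
    (isIdempotentElem_upperSum hf i₀).Corner :=
  ⟨f i, (Subsemigroup.mem_corner_iff (isIdempotentElem_upperSum hf i₀)).2
    ⟨by
      rw [upperSum, Finset.sum_mul, Finset.sum_eq_single i.1
        (fun j _ h => hf.ortho h) (fun h => absurd (Finset.mem_Ici.2 i.2) h)]
      exact hf.idem i.1, hf.mul_sum_of_mem (Finset.mem_Ici.2 i.2)⟩⟩

/-- The elements of `e R e` which lie in a given set `P` of elements of `R`. If `P` is the set of
paths of a monomial algebra `R` and `e` a sum of trivial paths, these are the paths of `e R e`. -/
def cornerPaths (he : IsIdempotentElem e) (P : Set R) : Set he.Corner := {x | x.1 ∈ P}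

/-- The subset `e B e` of `e R e`, for a subset `B` of `R`. -/
def cornerSet (he : IsIdempotentElem e) (B : Set R) : Set he.Corner :=
  {x | ∃ b ∈ B, x.1 = e * b * e}

end Corner

/-! ## Quasi-hereditary algebras -/

section QuasiHereditary

/-- The projective left module `R x`, for `x` an idempotent. -/
abbrev Proj {R : Type w} [Ring R] (x : R) : Submodule R R := Submodule.span R {x}

/-- The top `R x / rad (R x)` of `R x`; for a primitive idempotent `x` it is the simple module
belonging to `x`. -/
abbrev Top {R : Type w} [Ring R] (x : R) : Type w := Proj x ⧸ Module.jacobson R (Proj x)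

/-- `L` is isomorphic to a subquotient of `M`; for `L` simple and `M` of finite length this says
that `L` is a composition factor of `M`, that is, `[M : L] ≠ 0`. -/
def IsCompositionFactor (R : Type w) [Ring R] (L M : Type*) [AddCommGroup L] [Module R L]
    [AddCommGroup M] [Module R M] : Prop :=
  ∃ N N' : Submodule R M, N ≤ N' ∧ Nonempty (L ≃ₗ[R] N' ⧸ N.submoduleOf N')

variable {ι : Type z} [LinearOrder ι] {R : Type w} [Ring R]

/-- The kernel of `P_i → Δ_i`: the smallest submodule `N` of `P_i = R e_i` such that `P_i / N` has
no composition factor `L_j` with `j > i`. -/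
def standardKernel (e : ι → R) (i : ι) : Submodule R (Proj (e i)) :=
  sInf {N | ∀ j, i < j → ¬ IsCompositionFactor R (Top (e j)) (Proj (e i) ⧸ N)}

/-- The standard module `Δ_i`: the largest quotient of `P_i` without composition factors `L_j`,
`j > i`. -/
abbrev Standard (e : ι → R) (i : ι) : Type w := Proj (e i) ⧸ standardKernel e i

/-- `M` has a finite filtration whose subquotients are standard modules. -/
def HasStandardFiltration (e : ι → R) (M : Type*) [AddCommGroup M] [Module R M] : Prop :=
  ∃ (m : ℕ) (F : ℕ → Submodule R M), F 0 = ⊥ ∧ F m = ⊤ ∧ ∀ t < m, F t ≤ F (t + 1) ∧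
    ∃ i, Nonempty ((F (t + 1) ⧸ (F t).submoduleOf (F (t + 1))) ≃ₗ[R] Standard e i)

/-- `R` is quasi-hereditary with respect to the order of `ι`, where the simple modules of the
finite-dimensional algebra `R` are indexed by `ι` through the primitive idempotents `e i`. -/
structure IsQuasiHereditary (k : Type u) [Field k] [Algebra k R] (e : ι → R) : Prop where
  filtration : HasStandardFiltration e R
  endomorphisms : ∀ i, Nonempty (Module.End R (Standard e i) ≃ₐ[k] k)

end QuasiHereditary

/-! ## Induction along a subalgebra and exact Borel subalgebras -/

section Borel

variable {k : Type u} [Field k] {R : Type w} [Ring R] [Algebra k R] (B : Subalgebra k R)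

/-- The relations `a b ⊗ m = a ⊗ b m`, `b ∈ B`, in `R ⊗_ℤ M`. -/
def balancedRel (M : Type z) [AddCommGroup M] [Module B M] : Submodule R (R ⊗[ℤ] M) :=
  Submodule.span R {x | ∃ (a : R) (b : B) (m : M), x = (a * (b : R)) ⊗ₜ[ℤ] m - a ⊗ₜ[ℤ] (b • m)}

/-- The induced left `R`-module `R ⊗_B M` of a left `B`-module `M`. -/
abbrev Induced (M : Type z) [AddCommGroup M] [Module B M] : Type max w z :=
  (R ⊗[ℤ] M) ⧸ balancedRel B M

variable {B} in
/-- The map `R ⊗_B f : R ⊗_B M → R ⊗_B N` induced by a `B`-linear map `f : M → N`. -/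
def inducedMap {M N : Type z} [AddCommGroup M] [Module B M] [AddCommGroup N] [Module B N]
    (f : M →ₗ[B] N) : Induced B M →ₗ[R] Induced B N :=
  (balancedRel B M).mapQ (balancedRel B N)
    (TensorProduct.AlgebraTensorModule.lTensor R R f.toAddMonoidHom.toIntLinearMap) (by
      rw [balancedRel, Submodule.span_le]
      rintro _ ⟨a, b, m, rfl⟩
      refine Submodule.subset_span ⟨a, b, f m, ?_⟩
      simp)

variable {ι : Type z} [LinearOrder ι]

/-- `B` is an exact Borel subalgebra of the quasi-hereditary algebra `R`, whose simple modules are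
indexed by `ι` through the primitive idempotents `e i`. The bijection from the simple modules of
`B` to those of `R` is encoded in the indexing by `ι` of a complete list `L` of pairwise
non-isomorphic simple `B`-modules. -/
structure IsExactBorel (e : ι → R) : Prop where
  /-- Induction from finitely generated `B`-modules to `R`-modules is exact. -/
  exact : ∀ (M N K : Type w) [AddCommGroup M] [AddCommGroup N] [AddCommGroup K]
    [Module B M] [Module B N] [Module B K]
    [Module.Finite B M] [Module.Finite B N] [Module.Finite B K]
    (f : M →ₗ[B] N) (g : N →ₗ[B] K), Function.Exact f g →
      Function.Exact (inducedMap f) (inducedMap g)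
  simples : ∃ (L : ι → Type w) (_ : ∀ i, AddCommGroup (L i)) (_ : ∀ i, Module k (L i))
    (_ : ∀ i, Module B (L i)) (_ : ∀ i, IsScalarTower k B (L i)),
    (∀ i, IsSimpleModule B (L i)) ∧
    (∀ i j, Nonempty (L i ≃ₗ[B] L j) → i = j) ∧
    (∀ (M : Type w) [AddCommGroup M] [Module B M] [IsSimpleModule B M],
      ∃ i, Nonempty (M ≃ₗ[B] L i)) ∧
    (∀ i, Nonempty (Induced B (L i) ≃ₗ[R] Standard e i)) ∧
    (∀ i, Nonempty (Module.End B (L i) ≃ₐ[k] Module.End R (Top (e i)))) ∧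
    (∀ i j, Nontrivial (CategoryTheory.Abelian.Ext.{w} (ModuleCat.of B (L i))
      (ModuleCat.of B (L j)) 1) → i ≤ j)

end Borel

/-! ## Right-minimal direction-preserving paths

Here `R` is a monomial algebra, `e i` are its idempotents given by the vertices, and `P` is its set
of paths. -/

section RightMinimal

variable (k : Type u) [Field k] {R : Type w} [Ring R] [Algebra k R]
variable {ι : Type z} [LinearOrder ι] (e : ι → R) (P : Set R)

/-- The direction-preserving paths: those in `e_j R e_i` for some `i < j`. -/
def directionPreserving : Set R :=
  {x | x ∈ P ∧ ∃ i j, i < j ∧ e j * x * e i = x}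

/-- The subalgebra `B_max` generated by the `e i` and all direction-preserving paths. -/
def bMax : Subalgebra k R := Algebra.adjoin k (Set.range e ∪ directionPreserving e P)

/-- The subspace `rad(R) rad(B_max)` of `R`, where `rad` is the Jacobson radical. -/
def radMulRad : Submodule k R :=
  Submodule.span k {x | ∃ a ∈ Ring.jacobson R, ∃ b ∈ Ring.jacobson (bMax k e P), x = a * (b : R)}

/-- The right-minimal direction-preserving paths: those which lie in `B_max`, but not in
`rad(R) rad(B_max)`. Besides the direction-preserving ones among these, the trivial paths satisfy
this condition too, so that `B_min` contains all `e i`. -/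
def rightMinimalPaths : Set R :=
  {x | x ∈ P ∧ x ∈ bMax k e P ∧ x ∉ radMulRad k e P}

/-- The subalgebra `B_min` generated by the right-minimal direction-preserving paths. -/
def bMin : Subalgebra k R := Algebra.adjoin k (rightMinimalPaths k e P)

end RightMinimal

/-! ## The subalgebras in question for a monomial algebra `A` and for `e A e` -/

namespace MonomialAlgebra

variable (k : Type u) [Field k] {V : Type v} [Fintype V] [Quiver.{w} V] (S : Set (AnyPath V))
variable {n : ℕ} (ν : Fin n ≃ V) (i₀ : Fin n)

/-- The subalgebra `B_min` of `A`. -/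
def minSubalgebra : Subalgebra k (MonomialAlgebra k S) :=
  bMin k (numberedIdem k S ν) (paths k S)

/-- The element `e = ∑_{i ≥ i₀} e_i` of `A` is idempotent. -/
theorem isIdempotentElem_e : IsIdempotentElem (upperSum (numberedIdem k S ν) i₀) :=
  isIdempotentElem_upperSum (orthogonalIdempotents_numberedIdem k S ν) i₀

/-- The algebra `e A e` for `e = ∑_{i ≥ i₀} e_i`. -/
abbrev UpperCorner : Type max u v w := (isIdempotentElem_e k S ν i₀).Corner

/-- The idempotents `e_i`, `i ≥ i₀`, of `e A e`. -/
def upperCornerIdem : Set.Ici i₀ → UpperCorner k S ν i₀ :=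
  cornerIdem (orthogonalIdempotents_numberedIdem k S ν) i₀

/-- The paths of `e A e`: the paths of `A` which lie in `e A e`. -/
def upperCornerPaths : Set (UpperCorner k S ν i₀) :=
  cornerPaths (isIdempotentElem_e k S ν i₀) (paths k S)

/-- The subalgebra of `e A e` generated by the right-minimal direction-preserving paths of
`e A e`. -/
def upperCornerMinSubalgebra : Subalgebra k (UpperCorner k S ν i₀) :=
  bMin k (upperCornerIdem k S ν i₀) (upperCornerPaths k S ν i₀)

end MonomialAlgebra

end MonomialBorel

end

open MonomialBorel

set_option linter.unusedSectionVars false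

/-! Call a nonzero path low for `j` if all its vertices, endpoints included, are at most `j`.
Composition factors are detected by idempotents, so the kernel of `P_i → Δ_i` is spanned by the
paths from `i` that meet a vertex above `i`, and `Δ_i` has as basis the low paths from `i`.

Quasi-heredity then becomes a condition on paths (`IsQuasiHereditaryBasis`): a low loop at `j` is
trivial, and `q r ≠ 0` whenever `q` starts at `j`, `r` ends at `j` and both are low for `j`.
Necessity (`isQuasiHereditaryBasis`) is a count. Cutting each path at its largest vertex embeds the
paths into the set of such pairs `(q, r)`, while a standard filtration bounds the number of pairs by
the dimension of the algebra; so each pair comes from a path. For sufficiency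
(`hasStandardFiltration`), the left ideals generated by the paths low for their target, added in
order of decreasing target, form a standard filtration.

The algebra `B_min` is spanned by the paths low for their target (`mem_bMin`). The decomposition `p
= q r` at the largest vertex is unique and has `r` in `B_min`. It yields a dual basis of the algebra
as a right `B_min`-module, so induction is exact (`exists_dualBasis`, `exact_inducedMap`), and it
identifies the module induced from a simple one with a standard module. Nontrivial paths of `B_min`
strictly increase the vertex, which gives the list of simples and the direction of `Ext¹`.

All this uses only a basis of path type with compatible factorizations (`PathBasis`, `IsMonomial`),
not a presentation by arrows. The corner `e A e` inherits such a basis, namely the paths with both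
endpoints at least `i₀`. Since the retained vertices form an upper set, lowness for a retained
vertex is the same in `A` and in `e A e`. Hence the path condition and the paths spanning `B_min`
restrict to the corner, where the general results apply (`corner_of_isQuasiHereditaryBasis`). -/

/-- A basis of an algebra that behaves like the nonzero paths of a monomial algebra: every basis
element has a source, a target and a length, and the product of two basis elements is zero or
again a basis element. -/
structure PathBasis (k : Type*) [Field k] {R : Type*} [Ring R] [Algebra k R] {ι : Type*} [Fintype ι]
    (e : ι → R) (β : Type*) where
  basis : Module.Basis β k R
  src : β → ι
  tgt : β → ι
  len : β → ℕ
  triv : ι → β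
  basis_triv : ∀ i, basis (triv i) = e i
  src_triv : ∀ i, src (triv i) = i
  tgt_triv : ∀ i, tgt (triv i) = i
  eq_triv : ∀ p, len p = 0 → ∃ i, p = triv i
  mul_idem_src : ∀ p, basis p * e (src p) = basis p
  idem_tgt_mul : ∀ p, e (tgt p) * basis p = basis p
  mul_idem_of_ne : ∀ p i, i ≠ src p → basis p * e i = 0
  idem_mul_of_ne : ∀ p i, i ≠ tgt p → e i * basis p = 0
  sum_idem : ∑ i, e i = 1
  mul_mem : ∀ p q, basis p * basis q = 0 ∨
    ∃ r, basis p * basis q = basis r ∧ len r = len p + len q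

namespace PathBasis

variable {k : Type*} [Field k] {R : Type*} [Ring R] [Algebra k R] {ι : Type*} [Fintype ι]
  {e : ι → R} {β : Type*} (D : PathBasis k e β)

include D

/-! ### Calculus of path bases: factorizations and coefficients -/

section Basic

theorem basis_ne_zero (p : β) : D.basis p ≠ 0 := D.basis.ne_zero p

theorem basis_injective : Function.Injective D.basis := D.basis.injective

theorem idem_mul_idem (i : ι) : e i * e i = e i := by
  simpa [D.basis_triv, D.src_triv] using D.mul_idem_src (D.triv i)

theorem src_eq_of_mul_eq {p q r : β} (h : D.basis p * D.basis q = D.basis r) :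
    D.src r = D.src q := by
  by_contra hne
  apply D.basis_ne_zero r
  rw [← D.mul_idem_src r, ← h, mul_assoc, D.mul_idem_of_ne q _ hne, mul_zero]

theorem tgt_eq_of_mul_eq {p q r : β} (h : D.basis p * D.basis q = D.basis r) :
    D.tgt r = D.tgt p := by
  by_contra hne
  apply D.basis_ne_zero r
  rw [← D.idem_tgt_mul r, ← h, ← mul_assoc, D.idem_mul_of_ne p _ hne, zero_mul]

theorem tgt_eq_src_of_mul_ne_zero {p q : β} (h : D.basis p * D.basis q ≠ 0) :
    D.tgt q = D.src p := by
  by_contra hne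
  apply h
  rw [← D.idem_tgt_mul q, ← mul_assoc, D.mul_idem_of_ne p _ hne, zero_mul]

theorem tgt_eq_src_of_mul_eq {p q r : β} (h : D.basis p * D.basis q = D.basis r) :
    D.tgt q = D.src p :=
  D.tgt_eq_src_of_mul_ne_zero (h ▸ D.basis_ne_zero r)

theorem exists_mul_eq {p q : β} (h : D.basis p * D.basis q ≠ 0) :
    ∃ r, D.basis p * D.basis q = D.basis r := by
  obtain h0 | ⟨r, hr, -⟩ := D.mul_mem p q
  · exact absurd h0 h
  · exact ⟨r, hr⟩

theorem len_eq_of_mul_eq {p q r : β} (h : D.basis p * D.basis q = D.basis r) :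
    D.len r = D.len p + D.len q := by
  obtain h0 | ⟨s, hs, hl⟩ := D.mul_mem p q
  · exact absurd (h ▸ h0) (D.basis_ne_zero r)
  · rwa [D.basis_injective (h.symm.trans hs)]

theorem mul_triv (p : β) : D.basis p * D.basis (D.triv (D.src p)) = D.basis p := by
  rw [D.basis_triv, D.mul_idem_src]

theorem triv_mul (p : β) : D.basis (D.triv (D.tgt p)) * D.basis p = D.basis p := by
  rw [D.basis_triv, D.idem_tgt_mul]

theorem len_triv (i : ι) : D.len (D.triv i) = 0 := by
  have h := D.len_eq_of_mul_eq (p := D.triv i) (q := D.triv i) (r := D.triv i)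
    (by rw [D.basis_triv, D.idem_mul_idem])
  omega

theorem eq_triv_src {p : β} (h : D.len p = 0) : p = D.triv (D.src p) := by
  obtain ⟨i, rfl⟩ := D.eq_triv p h
  rw [D.src_triv]

theorem eq_triv_tgt {p : β} (h : D.len p = 0) : p = D.triv (D.tgt p) := by
  obtain ⟨i, rfl⟩ := D.eq_triv p h
  rw [D.tgt_triv]

theorem triv_injective : Function.Injective D.triv := fun i j h => by
  rw [← D.src_triv i, h, D.src_triv]

theorem eq_of_len_eq_zero_of_mul_eq {p q r : β} (h : D.basis p * D.basis q = D.basis r)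
    (hp : D.len p = 0) : q = r := by
  have h1 := D.tgt_eq_src_of_mul_eq h
  rw [D.eq_triv_src hp, ← h1, D.triv_mul] at h
  exact D.basis_injective h

theorem mul_idem_eq_sub [DecidableEq ι] (x : R) (i : ι) : x * e i = x - ∑ j ∈ Finset.univ.erase i, x * e j := by
  classical
  rw [← Finset.mul_sum, eq_sub_iff_add_eq, ← mul_add,
    Finset.add_sum_erase _ _ (Finset.mem_univ i), D.sum_idem, mul_one]

variable [Fintype β]

theorem sum_repr (x : R) : ∑ p, D.basis.repr x p • D.basis p = x := D.basis.sum_repr x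

theorem mem_of_repr {N : Submodule k R} {x : R}
    (h : ∀ p, D.basis.repr x p ≠ 0 → D.basis p ∈ N) : x ∈ N := by
  rw [← D.sum_repr x]
  refine N.sum_mem fun p _ => ?_
  by_cases hp : D.basis.repr x p = 0
  · rw [hp, zero_smul]; exact N.zero_mem
  · exact N.smul_mem _ (h p hp)

theorem mem_of_repr' {N : Submodule R R} {x : R}
    (h : ∀ p, D.basis.repr x p ≠ 0 → D.basis p ∈ N) : x ∈ N :=
  D.mem_of_repr (N := N.restrictScalars k) h

/-- Expanding both factors gives multiples of products of two paths, each of which is zero or a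
single path. This turns every later question about supports into one about factorizations of paths.
-/
theorem exists_of_repr_mul_ne_zero {x y : R} {p : β} (h : D.basis.repr (x * y) p ≠ 0) :
    ∃ s t, D.basis.repr x s ≠ 0 ∧ D.basis.repr y t ≠ 0 ∧
      D.basis s * D.basis t = D.basis p := by
  classical
  have hexp : x * y = ∑ s, ∑ t, (D.basis.repr x s * D.basis.repr y t) •
      (D.basis s * D.basis t) := by
    conv_lhs => rw [← D.sum_repr x, ← D.sum_repr y]
    simp only [Finset.sum_mul, Finset.mul_sum, smul_mul_smul_comm]
    exact Finset.sum_comm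
  rw [hexp] at h
  simp only [map_sum, map_smul, Finsupp.coe_finsetSum, Finset.sum_apply, Finsupp.smul_apply,
    smul_eq_mul] at h
  obtain ⟨s, -, hs⟩ := Finset.exists_ne_zero_of_sum_ne_zero h
  obtain ⟨t, -, ht⟩ := Finset.exists_ne_zero_of_sum_ne_zero hs
  refine ⟨s, t, left_ne_zero_of_mul (left_ne_zero_of_mul ht),
    right_ne_zero_of_mul (left_ne_zero_of_mul ht), ?_⟩
  have h3 := right_ne_zero_of_mul ht
  obtain ⟨r, hr⟩ := D.exists_mul_eq (p := s) (q := t) (fun h0 => h3 (by simp [h0]))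
  rw [hr] at h3 ⊢
  rw [D.basis.repr_self, Finsupp.single_apply] at h3
  rw [of_not_not fun hne => h3 (if_neg hne)]

theorem repr_mul_idem (x : R) (p : β) :
    D.basis.repr (x * e (D.src p)) p = D.basis.repr x p := by
  classical
  have h : ∀ j ∈ Finset.univ.erase (D.src p), D.basis.repr (x * e j) p = 0 := by
    intro j hj
    by_contra hne
    obtain ⟨s, t, -, ht, hst⟩ := D.exists_of_repr_mul_ne_zero hne
    rw [← D.basis_triv, D.basis.repr_self, Finsupp.single_apply] at ht
    have : D.triv j = t := of_not_not fun h' => ht (if_neg h')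
    have h2 := D.src_eq_of_mul_eq hst
    rw [← this, D.src_triv] at h2
    exact Finset.ne_of_mem_erase hj h2.symm
  rw [D.mul_idem_eq_sub, map_sub, map_sum, Finsupp.sub_apply, Finsupp.coe_finsetSum,
    Finset.sum_apply, Finset.sum_eq_zero h, sub_zero]

theorem src_of_repr_mul_idem {x : R} {i : ι} {p : β} (h : D.basis.repr (x * e i) p ≠ 0) :
    D.src p = i ∧ D.basis.repr x p ≠ 0 := by
  classical
  obtain ⟨s, t, -, ht, hst⟩ := D.exists_of_repr_mul_ne_zero h
  rw [← D.basis_triv, D.basis.repr_self, Finsupp.single_apply] at ht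
  have : D.triv i = t := of_not_not fun h' => ht (if_neg h')
  have h2 := D.src_eq_of_mul_eq hst
  rw [← this, D.src_triv] at h2
  refine ⟨h2, ?_⟩
  rwa [← D.repr_mul_idem, h2]

theorem tgt_of_repr_idem_mul {x : R} {i : ι} {p : β} (h : D.basis.repr (e i * x) p ≠ 0) :
    D.tgt p = i ∧ D.basis.repr x p ≠ 0 := by
  classical
  obtain ⟨s, t, hs, ht, hst⟩ := D.exists_of_repr_mul_ne_zero h
  rw [← D.basis_triv, D.basis.repr_self, Finsupp.single_apply] at hs
  have h0 : D.triv i = s := of_not_not fun h' => hs (if_neg h')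
  have h2 := D.tgt_eq_of_mul_eq hst
  rw [← h0, D.tgt_triv] at h2
  refine ⟨h2, ?_⟩
  rwa [← D.eq_of_len_eq_zero_of_mul_eq hst (h0 ▸ D.len_triv i)]

theorem repr_idem_mul (x : R) (p : β) :
    D.basis.repr (e (D.tgt p) * x) p = D.basis.repr x p := by
  classical
  have h : ∀ j ≠ D.tgt p, D.basis.repr (e j * x) p = 0 := fun j hj => by
    by_contra hne
    exact hj (D.tgt_of_repr_idem_mul hne).1.symm
  conv_rhs => rw [← one_mul x, ← D.sum_idem, Finset.sum_mul, map_sum, Finsupp.coe_finsetSum,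
    Finset.sum_apply]
  rw [Finset.sum_eq_single (D.tgt p) (fun j _ hj => h j hj)
    (fun h => absurd (Finset.mem_univ _) h)]

/-- A trivial path factors only into trivial paths at the same vertex. The coefficient of `e i` is
thus a character of the algebra, the one behind the simple module at `i`. -/
theorem repr_mul_triv (x y : R) (i : ι) : D.basis.repr (x * y) (D.triv i) =
    D.basis.repr x (D.triv i) * D.basis.repr y (D.triv i) := by
  have key : ∀ x y : R, D.basis.repr x (D.triv i) = 0 ∨ D.basis.repr y (D.triv i) = 0 →
      D.basis.repr (x * y) (D.triv i) = 0 := by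
    intro x y hxy
    by_contra hne
    obtain ⟨s, t, hs, ht, hst⟩ := D.exists_of_repr_mul_ne_zero hne
    have hl := D.len_eq_of_mul_eq hst
    rw [D.len_triv] at hl
    have h1 := D.tgt_eq_of_mul_eq hst
    have h2 := D.src_eq_of_mul_eq hst
    rw [D.tgt_triv] at h1
    rw [D.src_triv] at h2
    rw [D.eq_triv_tgt (p := s) (by omega), ← h1] at hs
    rw [D.eq_triv_src (p := t) (by omega), ← h2] at ht
    exact hxy.elim hs ht
  have self : D.basis.repr (e i) (D.triv i) = 1 := by simp [← D.basis_triv]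
  -- Split off the `e i`-component of each factor; `key` kills the two remainder terms.
  have hx : x * y = D.basis.repr x (D.triv i) • (D.basis.repr y (D.triv i) • (e i * e i)) +
      D.basis.repr x (D.triv i) • (e i * (y - D.basis.repr y (D.triv i) • e i)) +
      (x - D.basis.repr x (D.triv i) • e i) * y := by
    simp only [mul_sub, sub_mul, mul_smul_comm, smul_mul_assoc, smul_sub]
    abel
  rw [D.idem_mul_idem] at hx
  rw [hx, map_add, map_add, Finsupp.add_apply, Finsupp.add_apply, key _ y (Or.inl (by simp [self])),
    map_smul, map_smul, map_smul, Finsupp.smul_apply, Finsupp.smul_apply, Finsupp.smul_apply,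
    key (e i) _ (Or.inr (by simp [self])), self]
  simp

theorem repr_one_triv (i : ι) : D.basis.repr 1 (D.triv i) = 1 := by
  classical
  rw [← D.sum_idem, map_sum, Finsupp.coe_finsetSum, Finset.sum_apply,
    Finset.sum_eq_single i]
  · simp [← D.basis_triv]
  · intro j _ hj
    rw [← D.basis_triv, D.basis.repr_self, Finsupp.single_apply, if_neg]
    exact fun h => hj (D.triv_injective h)
  · exact fun h => absurd (Finset.mem_univ _) h

theorem repr_idem_triv_of_ne {i j : ι} (h : j ≠ i) : D.basis.repr (e j) (D.triv i) = 0 := by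
  classical
  rw [← D.basis_triv, D.basis.repr_self, Finsupp.single_apply, if_neg]
  exact fun h' => h (D.triv_injective h')

theorem repr_idem_triv (i : ι) : D.basis.repr (e i) (D.triv i) = 1 := by
  simp [← D.basis_triv]

end Basic

/-! ### Jacobson radical, tops of projectives and composition factors -/

section Radical

variable [Fintype β]

theorem le_len_of_repr_pow_ne_zero {x : R} (hx : ∀ i, D.basis.repr x (D.triv i) = 0) (m : ℕ) :
    ∀ p, D.basis.repr (x ^ m) p ≠ 0 → m ≤ D.len p := by
  induction m with
  | zero => simp
  | succ m ih =>
    intro p hp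
    rw [pow_succ] at hp
    obtain ⟨s, t, hs, ht, hst⟩ := D.exists_of_repr_mul_ne_zero hp
    have h1 := ih s hs
    have h2 : D.len t ≠ 0 := fun h0 => ht (by rw [D.eq_triv_src h0]; exact hx _)
    have h3 := D.len_eq_of_mul_eq hst
    omega

theorem isNilpotent {x : R} (hx : ∀ i, D.basis.repr x (D.triv i) = 0) : IsNilpotent x := by
  -- The exponent exceeds the length of every path, while all paths occurring in `x ^ m` have length
  -- at least `m`.
  refine ⟨(∑ p, D.len p) + 1, D.basis.ext_elem fun p => ?_⟩
  by_contra hne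
  rw [map_zero, Finsupp.zero_apply] at hne
  have h1 := D.le_len_of_repr_pow_ne_zero hx _ p hne
  have h2 := Finset.single_le_sum (f := D.len) (fun _ _ => Nat.zero_le _) (Finset.mem_univ p)
  omega

/-- The maximal left ideal of all elements in which the trivial path at `i` does not occur. -/
def trivIdeal (i : ι) : Submodule R R where
  carrier := {x | D.basis.repr x (D.triv i) = 0}
  add_mem' {x y} hx hy := by
    simp only [Set.mem_ofPred_eq] at hx hy ⊢
    rw [map_add, Finsupp.add_apply, hx, hy, add_zero]
  zero_mem' := by simp
  smul_mem' c x hx := by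
    simp only [Set.mem_ofPred_eq, smul_eq_mul] at hx ⊢
    rw [D.repr_mul_triv, hx, mul_zero]

theorem mem_trivIdeal {i : ι} {x : R} :
    x ∈ D.trivIdeal i ↔ D.basis.repr x (D.triv i) = 0 := Iff.rfl

theorem isCoatom_trivIdeal (i : ι) : IsCoatom (D.trivIdeal i) := by
  refine ⟨fun h => ?_, fun N hN => ?_⟩
  · have : (1 : R) ∈ D.trivIdeal i := h ▸ Submodule.mem_top
    rw [mem_trivIdeal, D.repr_one_triv] at this
    exact one_ne_zero this
  · obtain ⟨hle, y, hy, hy'⟩ := SetLike.lt_iff_le_and_exists.1 hN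
    rw [mem_trivIdeal] at hy'
    rw [Submodule.eq_top_iff']
    suffices h : (1 : R) ∈ N from fun x => by simpa using N.smul_mem x h
    have h1 : (1 : R) - (D.basis.repr y (D.triv i))⁻¹ • y ∈ N := hle (by
      rw [mem_trivIdeal, map_sub, map_smul, Finsupp.sub_apply, Finsupp.smul_apply,
        D.repr_one_triv, smul_eq_mul, inv_mul_cancel₀ hy', sub_self])
    have h2 : (D.basis.repr y (D.triv i))⁻¹ • y ∈ N := by
      rw [Algebra.smul_def]; exact N.smul_mem _ hy
    simpa using N.add_mem h1 h2

/-- The ideals `trivIdeal i` are maximal, which gives one direction. Conversely, if no trivial path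
occurs in `x`, then none occurs in `a * x`, so `a * x` is nilpotent and `1 - a * x` is a unit, which
no proper left ideal contains. -/
theorem mem_jacobson {x : R} :
    x ∈ Ring.jacobson R ↔ ∀ i, D.basis.repr x (D.triv i) = 0 := by
  constructor
  · intro hx i
    exact (sInf_le (D.isCoatom_trivIdeal i) : Ring.jacobson R ≤ D.trivIdeal i) hx
  · intro hx
    rw [Ring.jacobson, Module.jacobson, Submodule.mem_sInf]
    intro N hN
    by_contra hxN
    have hsup : N ⊔ Submodule.span R {x} = ⊤ := hN.2 _ (by
      refine lt_of_le_of_ne le_sup_left fun h => hxN ?_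
      rw [h]
      exact Submodule.mem_sup_right (Submodule.mem_span_singleton_self x))
    obtain ⟨m, hm, y, hy, hmy⟩ := Submodule.mem_sup.1 (hsup ▸ Submodule.mem_top : (1 : R) ∈ _)
    obtain ⟨a, rfl⟩ := Submodule.mem_span_singleton.1 hy
    have hnil : IsNilpotent (a • x) := D.isNilpotent fun i => by
      rw [smul_eq_mul, D.repr_mul_triv, hx, mul_zero]
    have hu : IsUnit m := by
      rw [eq_sub_of_add_eq hmy]
      exact hnil.isUnit_one_sub
    apply hN.1
    rw [Submodule.eq_top_iff']
    intro y
    obtain ⟨u, hu⟩ := hu.exists_left_inv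
    have := N.smul_mem (y * u) hm
    rwa [smul_eq_mul, mul_assoc, hu, mul_one] at this

theorem mem_proj {i : ι} {x : R} : x ∈ Proj (e i) ↔ x * e i = x := by
  rw [Submodule.mem_span_singleton]
  constructor
  · rintro ⟨a, rfl⟩
    rw [smul_eq_mul, mul_assoc, D.idem_mul_idem]
  · exact fun h => ⟨x, h⟩

theorem mem_proj_iff {i : ι} {x : R} :
    x ∈ Proj (e i) ↔ ∀ p, D.basis.repr x p ≠ 0 → D.src p = i := by
  constructor
  · intro h p hp
    rw [D.mem_proj] at h
    rw [← h] at hp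
    exact (D.src_of_repr_mul_idem hp).1
  · intro h
    refine D.mem_of_repr' fun p hp => ?_
    rw [D.mem_proj, ← h p hp, D.mul_idem_src]

theorem idem_mem_proj (i : ι) : e i ∈ Proj (e i) := Submodule.mem_span_singleton_self _

/-- After rescaling, `x` differs from `e i` by an element without trivial paths. That element is
nilpotent, so `x` can be inverted up to `e i`. -/
theorem idem_mem_span {i : ι} {x : R} (hx : x ∈ Proj (e i))
    (h : D.basis.repr x (D.triv i) ≠ 0) : ∃ a : R, a * x = e i := by
  set c := D.basis.repr x (D.triv i) with hc
  have hxe := D.mem_proj.1 hx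
  have hnil : IsNilpotent (e i - c⁻¹ • x) := D.isNilpotent fun j => by
    by_cases hj : j = i
    · subst hj
      rw [map_sub, Finsupp.sub_apply, D.repr_idem_triv, map_smul, Finsupp.smul_apply, ← hc,
        smul_eq_mul, inv_mul_cancel₀ h, sub_self]
    · by_contra hne
      have : e i - c⁻¹ • x = (e i - c⁻¹ • x) * e i := by
        rw [sub_mul, smul_mul_assoc, hxe, D.idem_mul_idem]
      rw [this] at hne
      have := (D.src_of_repr_mul_idem hne).1
      rw [D.src_triv] at this
      exact hj this
  obtain ⟨u, hu⟩ := hnil.isUnit_one_sub.exists_left_inv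
  refine ⟨c⁻¹ • u, ?_⟩
  have h1 : (1 - (e i - c⁻¹ • x)) * e i = c⁻¹ • x := by
    rw [sub_mul, sub_mul, one_mul, D.idem_mul_idem, smul_mul_assoc, hxe]; abel
  rw [smul_mul_assoc, ← mul_smul_comm, ← h1, ← mul_assoc, hu, one_mul]

/-- By `idem_mem_span`, a submodule containing an element with nonzero coefficient at `e i` contains
`e i` and is everything. Hence `R e_i` has a unique maximal submodule. -/
theorem mem_jacobson_proj {i : ι} {x : Proj (e i)} :
    x ∈ Module.jacobson R (Proj (e i)) ↔ D.basis.repr (x : R) (D.triv i) = 0 := by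
  have key : ∀ N : Submodule R (Proj (e i)), N ≠ ⊤ →
      N ≤ (D.trivIdeal i).comap (Proj (e i)).subtype := by
    intro N hN y hy
    by_contra hne
    rw [Submodule.mem_comap, Submodule.subtype_apply, mem_trivIdeal] at hne
    obtain ⟨a, ha⟩ := D.idem_mem_span y.2 hne
    apply hN
    rw [Submodule.eq_top_iff']
    intro z
    have h1 := N.smul_mem ((z : R) * a) hy
    have h2 : ((z : R) * a) • y = z := Subtype.ext (by
      rw [Submodule.coe_smul, smul_eq_mul, mul_assoc, ha, D.mem_proj.1 z.2])
    rwa [h2] at h1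
  have hne : (D.trivIdeal i).comap (Proj (e i)).subtype ≠ ⊤ := fun h => by
    have : (⟨e i, D.idem_mem_proj i⟩ : Proj (e i)) ∈ (D.trivIdeal i).comap (Proj (e i)).subtype :=
      h ▸ Submodule.mem_top
    rw [Submodule.mem_comap, Submodule.subtype_apply, mem_trivIdeal, D.repr_idem_triv] at this
    exact one_ne_zero this
  have hco : IsCoatom ((D.trivIdeal i).comap (Proj (e i)).subtype) :=
    ⟨hne, fun N hN => by
      by_contra hN'
      exact absurd (key N hN') (not_le_of_gt hN)⟩
  have hjac : Module.jacobson R (Proj (e i)) = (D.trivIdeal i).comap (Proj (e i)).subtype :=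
    le_antisymm (sInf_le hco) (le_sInf fun N hN => by
      by_contra hle
      have hsup := hN.2 (N ⊔ (D.trivIdeal i).comap (Proj (e i)).subtype)
        (lt_of_le_of_ne le_sup_left fun h => hle (by rw [h]; exact le_sup_right))
      rw [sup_eq_right.2 (key N hN.1)] at hsup
      exact hne hsup)
  rw [hjac]; rfl

/-- If `e i • m ≠ 0`, the kernel of `R e_i → M`, `x ↦ x • m`, lies in the radical, so the top is the
image modulo the image of the radical. In the other direction `e i` fixes the generator of the top,
which lifts to `M`. No finiteness of `M` is needed. -/
theorem isCompositionFactor_top_iff {i : ι} {M : Type*} [AddCommGroup M] [Module R M] :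
    IsCompositionFactor R (Top (e i)) M ↔ ∃ m : M, e i • m ≠ 0 := by
  constructor
  · rintro ⟨N, N', hN, ⟨θ⟩⟩
    set v : Top (e i) := Submodule.Quotient.mk ⟨e i, D.idem_mem_proj i⟩ with hv
    have hv0 : v ≠ 0 := fun h => by
      rw [hv, Submodule.Quotient.mk_eq_zero, D.mem_jacobson_proj, D.repr_idem_triv] at h
      exact one_ne_zero h
    have hev : e i • v = v := by
      rw [hv, ← Submodule.Quotient.mk_smul]
      congr 1
      exact Subtype.ext (D.idem_mul_idem i)
    obtain ⟨m, hm⟩ := Submodule.Quotient.mk_surjective _ (θ v)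
    refine ⟨m, fun h0 => hv0 ?_⟩
    rw [← θ.map_eq_zero_iff, ← hev, map_smul, ← hm, ← Submodule.Quotient.mk_smul]
    have : e i • m = 0 := Subtype.ext (by simpa using h0)
    rw [this, Submodule.Quotient.mk_zero]
  · rintro ⟨m, hm⟩
    let φ : Proj (e i) →ₗ[R] M := (LinearMap.toSpanSingleton R M m).comp (Proj (e i)).subtype
    have hφ : ∀ x, φ x = (x : R) • m := fun x => rfl
    have hker : ∀ x, φ x = 0 → x ∈ Module.jacobson R (Proj (e i)) := by
      intro x hx
      rw [D.mem_jacobson_proj]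
      by_contra hne
      obtain ⟨a, ha⟩ := D.idem_mem_span x.2 hne
      apply hm
      rw [← ha, mul_smul, ← hφ, hx, smul_zero]
    refine ⟨(Module.jacobson R (Proj (e i))).map φ, LinearMap.range φ, LinearMap.map_le_range, ?_⟩
    let ψ := (((Module.jacobson R (Proj (e i))).map φ).submoduleOf (LinearMap.range φ)).mkQ.comp
      φ.rangeRestrict
    have hψ : Function.Surjective ψ :=
      (Submodule.mkQ_surjective _).comp φ.surjective_rangeRestrict
    have hkerψ : LinearMap.ker ψ = Module.jacobson R (Proj (e i)) := by
      ext x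
      rw [LinearMap.mem_ker, LinearMap.comp_apply, Submodule.mkQ_apply,
        Submodule.Quotient.mk_eq_zero, Submodule.submoduleOf, Submodule.mem_comap]
      constructor
      · rintro ⟨y, hy, hxy⟩
        have : x - y ∈ Module.jacobson R (Proj (e i)) := hker _ (by
          rw [map_sub, hxy]; exact sub_self _)
        simpa using Submodule.add_mem _ this hy
      · exact fun hx => ⟨x, hx, rfl⟩
    exact ⟨(Submodule.quotEquivOfEq _ _ hkerψ.symm).trans (ψ.quotKerEquivOfSurjective hψ)⟩

end Radical

end PathBasis

/-! ### Vertices of paths, low paths and the standard modules -/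

namespace PathBasis

variable {k : Type*} [Field k] {R : Type*} [Ring R] [Algebra k R] {ι : Type*} [Fintype ι]
  {e : ι → R} {β : Type*} (D : PathBasis k e β)

include D

/-- Two factorizations of the same nonzero path have a common refinement. -/
def IsMonomial : Prop :=
  ∀ p q p' q', D.basis p * D.basis q = D.basis p' * D.basis q' → D.basis p * D.basis q ≠ 0 →
    D.len q ≤ D.len q' →
    ∃ c, D.basis c * D.basis q = D.basis q' ∧ D.basis p' * D.basis c = D.basis p

/-- The path `p` passes through the vertex `l`, possibly as its source or target. -/
def Visits (p : β) (l : ι) : Prop :=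
  ∃ a b, D.basis a * D.basis b = D.basis p ∧ D.tgt b = l

theorem visits_src (p : β) : D.Visits p (D.src p) :=
  ⟨p, D.triv (D.src p), D.mul_triv p, D.tgt_triv _⟩

theorem visits_tgt (p : β) : D.Visits p (D.tgt p) :=
  ⟨D.triv (D.tgt p), p, D.triv_mul p, rfl⟩

variable {D}

theorem Visits.of_left {a b p : β} {l : ι} (h : D.Visits a l)
    (hp : D.basis a * D.basis b = D.basis p) : D.Visits p l := by
  obtain ⟨c, d, hcd, hd⟩ := h
  rw [← hcd, mul_assoc] at hp
  obtain ⟨r, hr⟩ := D.exists_mul_eq (p := d) (q := b) (fun h0 => D.basis_ne_zero p (by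
    rw [← hp, h0, mul_zero]))
  exact ⟨c, r, by rw [← hr, hp], (D.tgt_eq_of_mul_eq hr).trans hd⟩

theorem Visits.of_right {a b p : β} {l : ι} (h : D.Visits b l)
    (hp : D.basis a * D.basis b = D.basis p) : D.Visits p l := by
  obtain ⟨c, d, hcd, hd⟩ := h
  rw [← hcd, ← mul_assoc] at hp
  obtain ⟨r, hr⟩ := D.exists_mul_eq (p := a) (q := c) (fun h0 => D.basis_ne_zero p (by
    rw [← hp, h0, zero_mul]))
  exact ⟨r, d, by rw [← hr, hp], hd⟩

/-- Compare the cut of `p` at `l` with the cut between `a` and `b`: the common refinement puts the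
vertex `l` on one side or the other, according to length. -/
theorem IsMonomial.visits_mul (hD : D.IsMonomial) {a b p : β} {l : ι} (h : D.Visits p l)
    (hp : D.basis a * D.basis b = D.basis p) : D.Visits a l ∨ D.Visits b l := by
  obtain ⟨c, d, hcd, hd⟩ := h
  rcases le_total (D.len d) (D.len b) with hl | hl
  · obtain ⟨c', h1, -⟩ := hD c d a b (hcd.trans hp.symm) (hcd ▸ D.basis_ne_zero p) hl
    exact Or.inr ⟨c', d, h1, hd⟩
  · obtain ⟨c', h1, h2⟩ := hD a b c d (hp.trans hcd.symm) (hp ▸ D.basis_ne_zero p) hl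
    exact Or.inl ⟨c, c', h2, (D.tgt_eq_of_mul_eq h1).symm.trans hd⟩

variable (D)

theorem basis_mem_proj {p : β} {i : ι} (h : D.src p = i) : D.basis p ∈ Proj (e i) :=
  Submodule.mem_span_singleton.2 ⟨D.basis p, by rw [← h, smul_eq_mul, D.mul_idem_src]⟩

variable [LinearOrder ι]

/-- All vertices on the path `p` are at most `j`. -/
def Low (p : β) (j : ι) : Prop := ∀ l, D.Visits p l → l ≤ j

variable {D}

theorem Low.of_mul_left {a b p : β} {j : ι} (h : D.Low p j)
    (hp : D.basis a * D.basis b = D.basis p) : D.Low a j := fun l hl => h l (hl.of_left hp)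

theorem Low.of_mul_right {a b p : β} {j : ι} (h : D.Low p j)
    (hp : D.basis a * D.basis b = D.basis p) : D.Low b j := fun l hl => h l (hl.of_right hp)

theorem Low.src_le {p : β} {j : ι} (h : D.Low p j) : D.src p ≤ j := h _ (D.visits_src p)

theorem Low.tgt_le {p : β} {j : ι} (h : D.Low p j) : D.tgt p ≤ j := h _ (D.visits_tgt p)

theorem IsMonomial.low_mul (hD : D.IsMonomial) {a b p : β} {j : ι} (ha : D.Low a j)
    (hb : D.Low b j) (hp : D.basis a * D.basis b = D.basis p) : D.Low p j := fun l hl =>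
  (hD.visits_mul hl hp).elim (ha l) (hb l)

variable (D)

theorem low_triv (i : ι) : D.Low (D.triv i) i := by
  rintro l ⟨a, b, hab, rfl⟩
  have h := D.len_eq_of_mul_eq hab
  rw [D.len_triv] at h
  have h2 := D.src_eq_of_mul_eq hab
  rw [D.src_triv] at h2
  rw [D.eq_triv_src (p := b) (by omega), D.tgt_triv, h2]

/-- Every path can be cut at its largest vertex. -/
theorem exists_decomposition (p : β) : ∃ q r, D.basis q * D.basis r = D.basis p ∧
    D.Low q (D.src q) ∧ D.Low r (D.src q) ∧ D.Visits p (D.src q) := by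
  classical
  obtain ⟨l, hl, hmax⟩ := Finset.exists_max_image (Finset.univ.filter (D.Visits p)) id
    ⟨_, Finset.mem_filter.2 ⟨Finset.mem_univ _, D.visits_src p⟩⟩
  obtain ⟨q, r, hqr, hr⟩ := (Finset.mem_filter.1 hl).2
  have hsrc := D.tgt_eq_src_of_mul_eq hqr
  have hp : D.Low p (D.src q) := fun l' hl' => by
    rw [← hsrc, hr]
    exact hmax l' (Finset.mem_filter.2 ⟨Finset.mem_univ _, hl'⟩)
  exact ⟨q, r, hqr, hp.of_mul_left hqr, hp.of_mul_right hqr, hsrc ▸ hr ▸ (Finset.mem_filter.1 hl).2⟩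

variable [Fintype β]

/-- The ideal spanned by all paths through some vertex greater than `j`. -/
def highIdeal (j : ι) : Submodule R R where
  carrier := {x | ∀ p, D.Low p j → D.basis.repr x p = 0}
  add_mem' {x y} hx hy p hp := by
    rw [map_add, Finsupp.add_apply, hx p hp, hy p hp, add_zero]
  zero_mem' p _ := by simp
  smul_mem' c x hx p hp := by
    by_contra hne
    obtain ⟨s, t, -, ht, hst⟩ := D.exists_of_repr_mul_ne_zero hne
    exact ht (hx t (hp.of_mul_right hst))

theorem mul_mem_highIdeal {j : ι} {x : R} (hx : x ∈ D.highIdeal j) (y : R) :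
    x * y ∈ D.highIdeal j := by
  intro p hp
  by_contra hne
  obtain ⟨s, t, hs, -, hst⟩ := D.exists_of_repr_mul_ne_zero hne
  exact hs (hx s (hp.of_mul_left hst))

theorem smul_mem_of_tower {M : Type*} [AddCommGroup M] [Module R M] [Module k M]
    [IsScalarTower k R M] (N : Submodule R M) (c : k) {x : M} (hx : x ∈ N) : c • x ∈ N := by
  rw [← one_smul R x, ← smul_assoc]
  exact N.smul_mem _ hx

/-- By `isCompositionFactor_top_iff`, a quotient of `R e_i` is admissible exactly when `e j`
annihilates it for all `j > i`. A path through some `j > i` is a left multiple of a path ending at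
`j`, so it must die; conversely, paths ending above `i` are not low for `i`. -/
theorem standardKernel_eq (i : ι) :
    standardKernel e i = (D.highIdeal i).comap (Proj (e i)).subtype := by
  apply le_antisymm
  · refine sInf_le fun j hj hcf => ?_
    obtain ⟨m, hm⟩ := D.isCompositionFactor_top_iff.1 hcf
    obtain ⟨x, rfl⟩ := Submodule.Quotient.mk_surjective _ m
    apply hm
    rw [← Submodule.Quotient.mk_smul, Submodule.Quotient.mk_eq_zero]
    change e j * (x : R) ∈ D.highIdeal i
    intro p hp
    by_contra hne
    exact absurd ((D.tgt_of_repr_idem_mul hne).1 ▸ hp.tgt_le) (not_le_of_gt hj)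
  · refine le_sInf fun N hN x hx => ?_
    have hsub : (N.map (Proj (e i)).subtype) ≤ Proj (e i) := Submodule.map_subtype_le _ _
    have hxN : (x : R) ∈ N.map (Proj (e i)).subtype := by
      refine D.mem_of_repr' fun p hp => ?_
      have hsrc := D.mem_proj_iff.1 x.2 p hp
      have hlow : ¬ D.Low p i := fun h => hp (hx p h)
      simp only [Low, not_forall, not_le] at hlow
      obtain ⟨l, ⟨a, b, hab, rfl⟩, hl⟩ := hlow
      have hb : D.basis b ∈ Proj (e i) := by
        rw [D.mem_proj, ← hsrc, D.src_eq_of_mul_eq hab, D.mul_idem_src]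
      have hbN : (⟨D.basis b, hb⟩ : Proj (e i)) ∈ N := by
        rw [← Submodule.Quotient.mk_eq_zero N]
        by_contra hne
        refine hN _ hl (D.isCompositionFactor_top_iff.2
          ⟨Submodule.Quotient.mk ⟨D.basis b, hb⟩, ?_⟩)
        have hfix : e (D.tgt b) • (⟨D.basis b, hb⟩ : Proj (e i)) = ⟨D.basis b, hb⟩ :=
          Subtype.ext (D.idem_tgt_mul b)
        rwa [← Submodule.Quotient.mk_smul, hfix]
      exact ⟨_, N.smul_mem (D.basis a) hbN, hab⟩
    obtain ⟨y, hy, hyx⟩ := hxN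
    rwa [← Subtype.ext (a1 := y) (a2 := x) hyx]

theorem mem_standardKernel {i : ι} {x : Proj (e i)} :
    x ∈ standardKernel e i ↔ (x : R) ∈ D.highIdeal i := by
  rw [D.standardKernel_eq]; rfl

/-- The generator of the standard module at `i`. -/
def standardGen (i : ι) : Standard e i := Submodule.Quotient.mk ⟨e i, D.idem_mem_proj i⟩

theorem smul_standardGen {i : ι} (x : R) (hx : x ∈ Proj (e i)) :
    x • D.standardGen i = Submodule.Quotient.mk ⟨x, hx⟩ := by
  rw [standardGen, ← Submodule.Quotient.mk_smul]
  congr 1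
  exact Subtype.ext (D.mem_proj.1 hx)

theorem smul_standardGen_eq_zero_iff {i : ι} {x : R} (hx : x ∈ Proj (e i)) :
    x • D.standardGen i = 0 ↔ x ∈ D.highIdeal i := by
  rw [D.smul_standardGen x hx, Submodule.Quotient.mk_eq_zero, D.mem_standardKernel]

theorem idem_smul_standardGen (i : ι) : e i • D.standardGen i = D.standardGen i :=
  D.smul_standardGen (e i) (D.idem_mem_proj i)

theorem exists_smul_standardGen {i : ι} (m : Standard e i) :
    ∃ x ∈ Proj (e i), x • D.standardGen i = m := by
  obtain ⟨x, rfl⟩ := Submodule.Quotient.mk_surjective _ m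
  exact ⟨x, x.2, D.smul_standardGen x x.2⟩

theorem standardGen_ne_zero (i : ι) : D.standardGen i ≠ 0 := by
  rw [← D.idem_smul_standardGen, Ne, D.smul_standardGen_eq_zero_iff (D.idem_mem_proj i)]
  intro h
  have := h (D.triv i) (D.low_triv i)
  rw [D.repr_idem_triv] at this
  exact one_ne_zero this

/-- The combinatorial form of quasi-heredity. -/
structure IsQuasiHereditaryBasis : Prop where
  len_eq_zero : ∀ p, D.src p = D.tgt p → D.Low p (D.src p) → D.len p = 0
  mul_ne_zero : ∀ q r, D.tgt r = D.src q → D.Low q (D.src q) → D.Low r (D.src q) →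
    D.basis q * D.basis r ≠ 0

omit D [LinearOrder ι] [Fintype ι] [Fintype β] in
theorem nonempty_end_algEquiv {M : Type*} [AddCommGroup M] [Module R M] [Module k M]
    [IsScalarTower k R M] (v : M) (hv : v ≠ 0) (hspan : ∀ m : M, ∃ a : R, a • v = m)
    (h : ∀ f : Module.End R M, ∃ c : k, f v = c • v) :
    Nonempty (Module.End R M ≃ₐ[k] k) := by
  refine ⟨(AlgEquiv.ofBijective (Algebra.ofId k (Module.End R M)) ⟨fun c d hcd => ?_,
    fun f => ?_⟩).symm⟩
  · have := LinearMap.congr_fun hcd v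
    simp only [Algebra.ofId_apply, Module.algebraMap_end_apply] at this
    rw [← sub_eq_zero, ← sub_smul] at this
    exact sub_eq_zero.1 ((smul_eq_zero.1 this).resolve_right hv)
  · obtain ⟨c, hc⟩ := h f
    refine ⟨c, LinearMap.ext fun m => ?_⟩
    obtain ⟨a, rfl⟩ := hspan m
    rw [Algebra.ofId_apply, Module.algebraMap_end_apply, map_smul, hc, smul_comm]

/-- Right multiplication by `p` induces an endomorphism of `Δ_i`. As this is a scalar `c`, the
element `p - c e_i` has no low path in its support, which is impossible unless `p` is trivial. -/
theorem len_eq_zero_of_end {i : ι} (h : Nonempty (Module.End R (Standard e i) ≃ₐ[k] k)) {p : β}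
    (hs : D.src p = i) (ht : D.tgt p = i) (hp : D.Low p i) : D.len p = 0 := by
  classical
  obtain ⟨φ⟩ := h
  have hpe : D.basis p ∈ Proj (e i) := by rw [D.mem_proj, ← hs, D.mul_idem_src]
  let g : Proj (e i) →ₗ[R] Standard e i :=
    (LinearMap.toSpanSingleton R _ (D.basis p • D.standardGen i)).comp (Proj (e i)).subtype
  have hg : ∀ x, g x = ((x : R) * D.basis p) • D.standardGen i := fun x =>
    (mul_smul (x : R) (D.basis p) (D.standardGen i)).symm
  let f : Module.End R (Standard e i) := (standardKernel e i).liftQ g fun x hx => by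
    rw [LinearMap.mem_ker, hg, D.smul_standardGen_eq_zero_iff]
    · exact D.mul_mem_highIdeal (D.mem_standardKernel.1 hx) _
    · exact Submodule.smul_mem _ (x : R) hpe
  have hf : f (D.standardGen i) = D.basis p • D.standardGen i := by
    change g ⟨e i, _⟩ = _
    rw [hg, ← ht, D.idem_tgt_mul]
  obtain ⟨c, hc⟩ : ∃ c : k, algebraMap k (Module.End R (Standard e i)) c = f :=
    ⟨φ f, by rw [← φ.symm.commutes]; exact φ.symm_apply_apply f⟩
  rw [← hc, Module.algebraMap_end_apply] at hf
  have h0 : (D.basis p - c • e i) • D.standardGen i = 0 := by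
    rw [sub_smul, ← hf, smul_assoc, D.idem_smul_standardGen, sub_self]
  rw [D.smul_standardGen_eq_zero_iff (Submodule.sub_mem _ hpe
    (D.smul_mem_of_tower _ _ (D.idem_mem_proj i)))] at h0
  have h1 := h0 p hp
  by_contra hne
  rw [map_sub, map_smul, Finsupp.sub_apply, Finsupp.smul_apply, D.basis.repr_self,
    Finsupp.single_eq_same, ← D.basis_triv, D.basis.repr_self, Finsupp.single_apply, if_neg,
    smul_zero, sub_zero] at h1
  · exact one_ne_zero h1
  · rintro rfl
    exact hne (D.len_triv i)

/-- If low loops at `i` are trivial, `e i Δ_i` is spanned by the generator: every other path from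
`i` to `i` meets a vertex above `i`. -/
theorem exists_sub_smul_idem_mem {i : ι}
    (hloop : ∀ p, D.src p = i → D.tgt p = i → D.Low p i → D.len p = 0) {x : R}
    (hx : x ∈ Proj (e i)) :
    ∃ c : k, e i * x - c • e i ∈ Proj (e i) ∧ e i * x - c • e i ∈ D.highIdeal i := by
  classical
  have hw : e i * x ∈ Proj (e i) := Submodule.smul_mem _ _ hx
  refine ⟨D.basis.repr (e i * x) (D.triv i), Submodule.sub_mem _ hw
    (D.smul_mem_of_tower _ _ (D.idem_mem_proj i)), fun p hp => ?_⟩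
  by_contra hne
  rw [map_sub, map_smul, Finsupp.sub_apply, Finsupp.smul_apply] at hne
  by_cases hpt : p = D.triv i
  · subst hpt
    rw [D.repr_idem_triv, smul_eq_mul, mul_one, sub_self] at hne
    exact hne rfl
  · have h0 : D.basis.repr (e i) p = 0 := by
      rw [← D.basis_triv, D.basis.repr_self, Finsupp.single_apply, if_neg (Ne.symm hpt)]
    rw [h0, smul_zero, sub_zero] at hne
    have hs := D.mem_proj_iff.1 hw p hne
    exact hpt (by rw [D.eq_triv_src (hloop p hs (D.tgt_of_repr_idem_mul hne).1 hp), hs])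

/-! ### Counting: quasi-heredity forces the path condition -/

section Counting

/-- The paths which form a basis of the standard module at `j`. -/
abbrev StdPath (j : ι) : Type _ := {q : β // D.src q = j ∧ D.Low q j}

/-- The paths ending at `j` with all vertices at most `j`. -/
abbrev CostdPath (j : ι) : Type _ := {r : β // D.tgt r = j ∧ D.Low r j}

theorem finite : Module.Finite k R := Module.Finite.of_basis D.basis

theorem finrank_standard_ge (j : ι) :
    Nat.card (D.StdPath j) ≤ Module.finrank k (Standard e j) := by
  classical
  have := D.finite
  have hfin : Module.Finite k (Standard e j) :=
    Module.Finite.of_surjective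
      ((LinearMap.toSpanSingleton R (Standard e j) (D.standardGen j)).restrictScalars k)
      (fun m => by
        obtain ⟨x, -, hx⟩ := D.exists_smul_standardGen m
        exact ⟨x, hx⟩)
  rw [Nat.card_eq_fintype_card]
  apply LinearIndependent.fintype_card_le_finrank
    (b := fun q : D.StdPath j => D.basis q.1 • D.standardGen j)
  rw [Fintype.linearIndependent_iff]
  intro g hg q
  simp only [← smul_assoc] at hg
  rw [← Finset.sum_smul, D.smul_standardGen_eq_zero_iff] at hg
  · have := hg q.1 q.2.2
    rw [map_sum, Finsupp.coe_finsetSum, Finset.sum_apply, Finset.sum_eq_single q] at this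
    · simpa using this
    · intro q' _ hne
      rw [map_smul, Finsupp.smul_apply, D.basis.repr_self, Finsupp.single_apply, if_neg, smul_zero]
      exact fun h => hne (Subtype.ext h)
    · exact fun h => absurd (Finset.mem_univ _) h
  · refine Submodule.sum_mem _ fun q' _ => D.smul_mem_of_tower _ _ ?_
    exact D.basis_mem_proj q'.2.1

/-- The coordinates of an element along the paths ending at `j` with all vertices at most `j`. -/
noncomputable def costdCoord (j : ι) : R →ₗ[k] (D.CostdPath j → k) :=
  LinearMap.pi fun r => D.basis.coord r.1

theorem costdCoord_apply {j : ι} (x : R) (r : D.CostdPath j) :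
    D.costdCoord j x r = D.basis.repr x r.1 := rfl

theorem costdCoord_surjective (j : ι) : Function.Surjective (D.costdCoord j) := by
  classical
  intro g
  refine ⟨∑ r : D.CostdPath j, g r • D.basis r.1, funext fun r => ?_⟩
  rw [costdCoord_apply, map_sum, Finsupp.coe_finsetSum, Finset.sum_apply, Finset.sum_eq_single r]
  · simp
  · intro q' _ hne
    rw [map_smul, Finsupp.smul_apply, D.basis.repr_self, Finsupp.single_apply, if_neg, smul_zero]
    exact fun h => hne (Subtype.ext h)
  · exact fun h => absurd (Finset.mem_univ _) h

theorem costdCoord_idem_mul (j : ι) (x : R) : D.costdCoord j (e j * x) = D.costdCoord j x := by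
  funext r
  rw [costdCoord_apply, costdCoord_apply]
  have h := D.repr_idem_mul x r.1
  rwa [r.2.1] at h

theorem costdCoord_eq_zero {j : ι} {x : R} (hx : x ∈ D.highIdeal j) : D.costdCoord j x = 0 :=
  funext fun r => hx r.1 r.2.2

-- A filtration step of type `Δ_i` enlarges the image in the space of low paths ending at `j` by at
-- most one dimension, and by none unless `i = j`. Summed over a filtration, this bounds the
-- multiplicity of `Δ_j` from below by the number of such paths.
open Classical in
theorem map_costdCoord_le {F F' : Submodule R R} {i : ι}
    (θ : (F' ⧸ F.submoduleOf F') ≃ₗ[R] Standard e i) (j : ι)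
    (hloop : ∀ p, D.src p = j → D.tgt p = j → D.Low p j → D.len p = 0) :
    ∃ v, (F'.restrictScalars k).map (D.costdCoord j) ≤
      (F.restrictScalars k).map (D.costdCoord j) ⊔ (if i = j then Submodule.span k {v} else ⊥) := by
  obtain ⟨y, hy⟩ := Submodule.Quotient.mk_surjective _ (θ.symm (D.standardGen i))
  have hθy : θ (Submodule.Quotient.mk y) = D.standardGen i := by rw [hy, θ.apply_symm_apply]
  have key : ∀ w ∈ Proj (e i), w ∈ D.highIdeal i → w * (y : R) ∈ F := by
    intro w hw hw'
    have : θ (Submodule.Quotient.mk (w • y)) = 0 := by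
      rw [Submodule.Quotient.mk_smul, map_smul, hθy, D.smul_standardGen_eq_zero_iff hw]
      exact hw'
    rw [θ.map_eq_zero_iff, Submodule.Quotient.mk_eq_zero] at this
    exact this
  refine ⟨D.costdCoord j y, ?_⟩
  rintro _ ⟨z, hz, rfl⟩
  obtain ⟨x, hx, hxz⟩ := D.exists_smul_standardGen (θ (Submodule.Quotient.mk ⟨z, hz⟩))
  have hzx : z - x * y ∈ F := by
    rw [← hθy, ← map_smul, θ.injective.eq_iff, ← Submodule.Quotient.mk_smul] at hxz
    rw [eq_comm, Submodule.Quotient.eq] at hxz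
    exact hxz
  have hz' : D.costdCoord j z = D.costdCoord j (z - x * y) + D.costdCoord j (e j * x * y) := by
    rw [mul_assoc, D.costdCoord_idem_mul, ← map_add, sub_add_cancel]
  rw [hz']
  have hw : e j * x ∈ Proj (e i) := Submodule.smul_mem _ _ hx
  have hsupp : ∀ p, D.basis.repr (e j * x) p ≠ 0 → D.src p = i ∧ D.tgt p = j := fun p hp =>
    ⟨D.mem_proj_iff.1 hw p hp, (D.tgt_of_repr_idem_mul hp).1⟩
  refine Submodule.add_mem _ (Submodule.mem_sup_left ⟨_, hzx, rfl⟩) ?_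
  -- For `i < j`, paths from `i` to `j` vanish in `Δ_i`, so the contribution already lies in `F`.
  -- For `i = j`, only a multiple of the generator survives. For `j < i`, the product passes through
  -- `i` and has zero coordinates.
  rcases lt_trichotomy i j with hij | rfl | hij
  · refine Submodule.mem_sup_left ⟨_, key _ hw fun p hp => ?_, rfl⟩
    by_contra hne
    exact absurd ((hsupp p hne).2 ▸ hp.tgt_le) (not_le_of_gt hij)
  · rw [if_pos rfl]
    obtain ⟨c, h1, h2⟩ := D.exists_sub_smul_idem_mem hloop hx
    have h3 : e i * x * (y : R) = (e i * x - c • e i) * y + c • (e i * (y : R)) := by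
      rw [sub_mul, smul_mul_assoc, sub_add_cancel]
    rw [h3, map_add, map_smul, D.costdCoord_idem_mul]
    exact Submodule.add_mem _ (Submodule.mem_sup_left ⟨_, key _ h1 h2, rfl⟩)
      (Submodule.mem_sup_right (Submodule.smul_mem _ _ (Submodule.mem_span_singleton_self _)))
  · have hhigh : e j * x * y ∈ D.highIdeal j := by
      intro p hp
      by_contra hne
      obtain ⟨s, t, hs, -, hst⟩ := D.exists_of_repr_mul_ne_zero hne
      exact absurd ((hsupp s hs).1 ▸ (hp.of_mul_left hst).src_le) (not_le_of_gt hij)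
    rw [D.costdCoord_eq_zero hhigh]
    exact Submodule.zero_mem _

omit D [Fintype ι] [LinearOrder ι] [Fintype β] in
theorem finrank_eq_add_of_quotient_equiv [Module.Finite k R] {F F' : Submodule R R} (hle : F ≤ F')
    {M : Type*} [AddCommGroup M] [Module R M] [Module k M] [IsScalarTower k R M]
    (θ : (F' ⧸ F.submoduleOf F') ≃ₗ[R] M) :
    Module.finrank k F' = Module.finrank k F + Module.finrank k M := by
  have : Module.Finite k F' := Module.Finite.of_injective (F'.subtype.restrictScalars k)
    F'.subtype_injective
  have h1 := Submodule.finrank_quotient_add_finrank ((F.submoduleOf F').restrictScalars k)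
  have h2 : Module.finrank k ((F.submoduleOf F').restrictScalars k) = Module.finrank k F :=
    LinearEquiv.finrank_eq ((Submodule.submoduleOfEquivOfLe hle).restrictScalars k)
  have h3 : Module.finrank k (F' ⧸ (F.submoduleOf F').restrictScalars k) = Module.finrank k M :=
    LinearEquiv.finrank_eq ((Submodule.Quotient.restrictScalarsEquiv k (F.submoduleOf F')).trans
      (θ.restrictScalars k))
  omega

/-- The dimension of the algebra is the sum of the dimensions of the filtration factors. The factor
`Δ_j` occurs at least as often as there are low paths ending at `j`, and has dimension at least the
number of low paths starting at `j`. -/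
theorem sum_card_le_card (hloop : ∀ p, D.src p = D.tgt p → D.Low p (D.src p) → D.len p = 0)
    (h : HasStandardFiltration e R) :
    ∑ j, Nat.card (D.CostdPath j) * Nat.card (D.StdPath j) ≤ Nat.card β := by
  classical
  have := D.finite
  obtain ⟨m, F, hF0, hFm, hF⟩ := h
  choose hle idx hidx using fun t : Fin m => hF t t.2
  have hsum : ∀ t (ht : t ≤ m), ∑ s : Fin m with s.1 < t, Module.finrank k (Standard e (idx s)) ≤
      Module.finrank k (F t) := by
    intro t
    induction t with
    | zero => simp
    | succ t ih =>
      intro ht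
      have h1 : (Finset.univ.filter fun s : Fin m => s.1 < t + 1) =
          insert ⟨t, ht⟩ (Finset.univ.filter fun s : Fin m => s.1 < t) := by
        ext s
        simp only [Finset.mem_filter, Finset.mem_univ, true_and, Finset.mem_insert, Fin.ext_iff]
        omega
      obtain ⟨θ⟩ := hidx ⟨t, ht⟩
      rw [h1, Finset.sum_insert (by simp),
        finrank_eq_add_of_quotient_equiv (k := k) (hle ⟨t, ht⟩) θ, add_comm]
      exact Nat.add_le_add_right (ih (by omega)) _
  have hcount : ∀ j, ∀ t (ht : t ≤ m),
      Module.finrank k (((F t).restrictScalars k).map (D.costdCoord j)) ≤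
        (Finset.univ.filter fun s : Fin m => s.1 < t ∧ idx s = j).card := by
    intro j t
    induction t with
    | zero =>
      intro _
      have : ((F 0).restrictScalars k).map (D.costdCoord j) = ⊥ := by
        rw [hF0, Submodule.restrictScalars_bot, Submodule.map_bot]
      rw [this, finrank_bot]
      exact Nat.zero_le _
    | succ t ih =>
      intro ht
      obtain ⟨θ⟩ := hidx ⟨t, ht⟩
      obtain ⟨v, hv⟩ := D.map_costdCoord_le θ j
        (fun p h1 h2 h3 => hloop p (h1.trans h2.symm) (h1 ▸ h3))
      refine (Submodule.finrank_mono hv).trans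
        ((Submodule.finrank_add_le_finrank_add_finrank _ _).trans ?_)
      have ih' := ih (by omega)
      by_cases hj : idx ⟨t, ht⟩ = j
      · rw [if_pos hj]
        have h1 : (Finset.univ.filter fun s : Fin m => s.1 < t + 1 ∧ idx s = j) =
            insert ⟨t, ht⟩ (Finset.univ.filter fun s : Fin m => s.1 < t ∧ idx s = j) := by
          ext s
          simp only [Finset.mem_filter, Finset.mem_univ, true_and, Finset.mem_insert]
          constructor
          · rintro ⟨h1, h2⟩
            rcases Nat.lt_succ_iff_lt_or_eq.1 h1 with h | h
            · exact Or.inr ⟨h, h2⟩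
            · exact Or.inl (Fin.ext h)
          · rintro (rfl | ⟨h1, h2⟩)
            · exact ⟨Nat.lt_succ_self _, hj⟩
            · exact ⟨h1.trans (Nat.lt_succ_self _), h2⟩
        rw [h1, Finset.card_insert_of_notMem (by simp)]
        refine Nat.add_le_add ih' ?_
        simpa using finrank_span_le_card (R := k) ({v} : Set (D.CostdPath j → k))
      · rw [if_neg hj, finrank_bot, add_zero]
        refine ih'.trans (Finset.card_le_card fun s hs => ?_)
        simp only [Finset.mem_filter, Finset.mem_univ, true_and] at hs ⊢
        exact ⟨hs.1.trans (Nat.lt_succ_self _), hs.2⟩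
  have hr : ∀ j, Nat.card (D.CostdPath j) ≤
      (Finset.univ.filter fun s : Fin m => idx s = j).card := by
    intro j
    have h1 := hcount j m le_rfl
    have h2 : ((F m).restrictScalars k).map (D.costdCoord j) = ⊤ := by
      rw [hFm, Submodule.restrictScalars_top, Submodule.map_top]
      exact LinearMap.range_eq_top.2 (D.costdCoord_surjective j)
    rw [h2, finrank_top, Module.finrank_fintype_fun_eq_card, ← Nat.card_eq_fintype_card] at h1
    simpa using h1
  calc ∑ j, Nat.card (D.CostdPath j) * Nat.card (D.StdPath j)
      ≤ ∑ j, (Finset.univ.filter fun s : Fin m => idx s = j).card *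
          Module.finrank k (Standard e j) :=
        Finset.sum_le_sum fun j _ => Nat.mul_le_mul (hr j) (D.finrank_standard_ge j)
    _ = ∑ j, ∑ s : Fin m with idx s = j, Module.finrank k (Standard e (idx s)) := by
        refine Finset.sum_congr rfl fun j _ => ?_
        rw [Finset.sum_congr rfl (g := fun _ => Module.finrank k (Standard e j)), Finset.sum_const,
          smul_eq_mul]
        intro s hs
        rw [(Finset.mem_filter.1 hs).2]
    _ = ∑ s : Fin m, Module.finrank k (Standard e (idx s)) :=
        Finset.sum_fiberwise _ _ _
    _ ≤ Module.finrank k (F m) := by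
        have := hsum m le_rfl
        simpa using this
    _ = Nat.card β := by
        rw [hFm, Nat.card_eq_fintype_card, ← Module.finrank_eq_card_basis D.basis]
        exact LinearEquiv.finrank_eq ((Submodule.topEquiv (R := R) (M := R)).restrictScalars k)

/-- Cutting at the largest vertex is injective because the product recovers the path. By the count
it is also surjective, so every admissible pair `(q, r)` has a path as its product. Unique
factorization (`IsMonomial`) plays no role here. -/
theorem isQuasiHereditaryBasis (h : IsQuasiHereditary k e) : D.IsQuasiHereditaryBasis := by
  classical
  have hloop : ∀ p, D.src p = D.tgt p → D.Low p (D.src p) → D.len p = 0 := fun p hp hl =>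
    D.len_eq_zero_of_end (h.endomorphisms (D.src p)) rfl hp.symm hl
  refine ⟨hloop, fun q r hqr hq hr => ?_⟩
  choose hd tl hmul hhd htl _ using D.exists_decomposition
  let φ : β → Σ j, D.CostdPath j × D.StdPath j := fun p =>
    ⟨D.src (hd p), ⟨tl p, D.tgt_eq_src_of_mul_eq (hmul p), htl p⟩, ⟨hd p, rfl, hhd p⟩⟩
  let ψ : (Σ j, D.CostdPath j × D.StdPath j) → R := fun s => D.basis s.2.2.1 * D.basis s.2.1.1
  have hψφ : ∀ p, ψ (φ p) = D.basis p := hmul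
  have hφ : Function.Injective φ := fun p p' hpp => D.basis_injective (by
    rw [← hψφ, hpp, hψφ])
  have hcard : Fintype.card β = Fintype.card (Σ j, D.CostdPath j × D.StdPath j) := by
    refine le_antisymm (Fintype.card_le_of_injective φ hφ) ?_
    have := D.sum_card_le_card hloop h.filtration
    simpa only [Fintype.card_sigma, Fintype.card_prod, Nat.card_eq_fintype_card] using this
  obtain ⟨p, hp⟩ := ((Fintype.bijective_iff_injective_and_card φ).2 ⟨hφ, hcard⟩).2
    ⟨D.src q, ⟨r, hqr, hr⟩, ⟨q, rfl, hq⟩⟩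
  have := hψφ p
  rw [hp] at this
  change D.basis q * D.basis r = D.basis p at this
  rw [this]
  exact D.basis_ne_zero p

end Counting

end PathBasis

/-! ### The path condition implies quasi-heredity -/

namespace PathBasis

variable {k : Type*} [Field k] {R : Type*} [Ring R] [Algebra k R] {ι : Type*} [Fintype ι]
  {e : ι → R} {β : Type*} {D : PathBasis k e β}

theorem eq_of_len_eq_zero_of_mul_eq' {p q r : β} (h : D.basis p * D.basis q = D.basis r)
    (hq : D.len q = 0) : p = r := by
  have h1 := D.tgt_eq_src_of_mul_eq h
  rw [D.eq_triv_tgt hq, h1, D.mul_triv] at h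
  exact D.basis_injective h

/-- Nonzero products of paths can be cancelled on the right, so `q` is the only path whose product
with `r` is `p`. -/
theorem IsMonomial.repr_mul_basis [Fintype β] (hM : D.IsMonomial) {p q r : β}
    (h : D.basis q * D.basis r = D.basis p) (x : R) :
    D.basis.repr (x * D.basis r) p = D.basis.repr x q := by
  classical
  set y := x - D.basis.repr x q • D.basis q with hy
  have h1 : D.basis.repr (y * D.basis r) p = 0 := by
    by_contra hne
    obtain ⟨s, t, hs, ht, hst⟩ := D.exists_of_repr_mul_ne_zero hne
    rw [D.basis.repr_self, Finsupp.single_apply] at ht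
    obtain rfl : r = t := of_not_not fun h' => ht (if_neg h')
    obtain ⟨c, hc1, hc2⟩ := hM q r s r (h.trans hst.symm) (h ▸ D.basis_ne_zero p) le_rfl
    have hl := D.len_eq_of_mul_eq hc1
    obtain rfl := eq_of_len_eq_zero_of_mul_eq' hc2 (by omega)
    apply hs
    rw [hy, map_sub, map_smul, Finsupp.sub_apply, Finsupp.smul_apply, D.basis.repr_self]
    simp
  have hx : x = y + D.basis.repr x q • D.basis q := by rw [hy, sub_add_cancel]
  conv_lhs => rw [hx]
  rw [add_mul, smul_mul_assoc, h, map_add, map_smul, Finsupp.add_apply, h1, Finsupp.smul_apply,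
    D.basis.repr_self]
  simp

variable [LinearOrder ι]

/-- Both cuts are made at the largest vertex on the path. Two such cuts differ by a loop at that
vertex which is low for it, hence trivial. -/
theorem decomposition_unique [Fintype β] (hM : D.IsMonomial) (hQ : D.IsQuasiHereditaryBasis)
    {q r q' r' : β} (h : D.basis q * D.basis r = D.basis q' * D.basis r')
    (hne : D.basis q * D.basis r ≠ 0) (hq : D.Low q (D.src q)) (hr : D.Low r (D.src q))
    (hq' : D.Low q' (D.src q')) (hr' : D.Low r' (D.src q')) : q = q' ∧ r = r' := by
  obtain ⟨p, hp⟩ := D.exists_mul_eq hne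
  have hp' := h.symm.trans hp
  have h1 : D.src q' = D.src q := le_antisymm
    (hM.low_mul hq hr hp _ ((D.visits_src q').of_left hp'))
    (hM.low_mul hq' hr' hp' _ ((D.visits_src q).of_left hp))
  have key : ∀ {q r q' r' : β}, D.basis q * D.basis r = D.basis q' * D.basis r' →
      D.basis q * D.basis r ≠ 0 → D.src q' = D.src q → D.Low r' (D.src q') →
      D.len r ≤ D.len r' → q = q' ∧ r = r' := by
    intro q r q' r' h hne hs hr' hl
    obtain ⟨c, hc1, hc2⟩ := hM q r q' r' h hne hl
    have hs1 := D.tgt_eq_src_of_mul_eq hc2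
    have hs2 := D.src_eq_of_mul_eq hc2
    have hlow := hr'.of_mul_left hc1
    have h0 := hQ.len_eq_zero c (by rw [← hs2, hs1, hs]) (by rwa [← hs2, ← hs])
    exact ⟨(eq_of_len_eq_zero_of_mul_eq' hc2 h0).symm, D.eq_of_len_eq_zero_of_mul_eq hc1 h0⟩
  rcases le_total (D.len r) (D.len r') with hl | hl
  · exact key h hne h1 hr' hl
  · obtain ⟨h2, h3⟩ := key h.symm (h ▸ hne) h1.symm hr hl
    exact ⟨h2.symm, h3.symm⟩

variable [Fintype β]

theorem nonempty_end_standard (hQ : D.IsQuasiHereditaryBasis) (i : ι) :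
    Nonempty (Module.End R (Standard e i) ≃ₐ[k] k) := by
  refine nonempty_end_algEquiv (D.standardGen i) (D.standardGen_ne_zero i) (fun m => ?_)
    fun f => ?_
  · obtain ⟨x, -, hx⟩ := D.exists_smul_standardGen m
    exact ⟨x, hx⟩
  · obtain ⟨x, hx, hxf⟩ := D.exists_smul_standardGen (f (D.standardGen i))
    obtain ⟨c, h1, h2⟩ := D.exists_sub_smul_idem_mem
      (fun p hs ht hp => hQ.len_eq_zero p (hs.trans ht.symm) (hs ▸ hp)) hx
    refine ⟨c, ?_⟩
    rw [← D.smul_standardGen_eq_zero_iff h1, sub_smul, mul_smul, hxf, ← map_smul,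
      D.idem_smul_standardGen, smul_assoc, D.idem_smul_standardGen] at h2
    exact sub_eq_zero.1 h2

theorem exists_of_mem_span {s : Set β} {x : R} (hx : x ∈ Submodule.span R (D.basis '' s)) {p : β}
    (hp : D.basis.repr x p ≠ 0) : ∃ a, ∃ r ∈ s, D.basis a * D.basis r = D.basis p := by
  induction hx using Submodule.span_induction generalizing p with
  | mem x hx =>
    classical
    obtain ⟨r, hr, rfl⟩ := hx
    rw [D.basis.repr_self, Finsupp.single_apply] at hp
    obtain rfl : r = p := of_not_not fun h => hp (if_neg h)
    exact ⟨_, r, hr, D.triv_mul r⟩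
  | zero => simp at hp
  | add x y _ _ hx hy =>
    by_cases h : D.basis.repr x p = 0
    · refine hy ?_
      rwa [map_add, Finsupp.add_apply, h, zero_add] at hp
    · exact hx h
  | smul c x _ hx =>
    obtain ⟨a, b, -, hb, hab⟩ := D.exists_of_repr_mul_ne_zero hp
    obtain ⟨a', r, hr, har⟩ := hx hb
    rw [← har, ← mul_assoc] at hab
    obtain ⟨d, hd⟩ := D.exists_mul_eq (p := a) (q := a') fun h0 => D.basis_ne_zero p (by
      rw [← hab, h0, zero_mul])
    exact ⟨d, r, hr, by rw [← hd, hab]⟩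

/-- List the paths `r` that are low for their target by decreasing target, and let `F t` be the left
ideal generated by the first `t` of them. The factor generated by the next `r`, ending at `i`, is `R
e_i` modulo the `x` with `x r ∈ F t`; the path condition and uniqueness of decompositions show that
this is `Δ_i`. -/
theorem hasStandardFiltration (hM : D.IsMonomial) (hQ : D.IsQuasiHereditaryBasis) :
    HasStandardFiltration e R := by
  classical
  let γ := {r : β // D.Low r (D.tgt r)}
  let f₀ := (Fintype.equivFin γ).symm
  -- The order dual makes the ascending sort run through the targets in decreasing order.
  let τ : Fin (Fintype.card γ) → ιᵒᵈ := fun t => OrderDual.toDual (D.tgt (f₀ t).1)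
  let f := (Tuple.sort τ).trans f₀
  have hanti : ∀ s t, s ≤ t → D.tgt (f t).1 ≤ D.tgt (f s).1 := fun s t hst =>
    Tuple.monotone_sort τ hst
  let G : ℕ → Set β := fun t => {r | ∃ s : Fin (Fintype.card γ), s.1 < t ∧ (f s).1 = r}
  have hG : ∀ t (ht : t < Fintype.card γ), G (t + 1) = insert (f ⟨t, ht⟩).1 (G t) := by
    intro t ht
    ext r
    constructor
    · rintro ⟨s, hs, rfl⟩
      rcases Nat.lt_succ_iff_lt_or_eq.1 hs with h | h
      · exact Or.inr ⟨s, h, rfl⟩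
      · left
        congr 2
        exact Fin.ext h
    · rintro (rfl | ⟨s, hs, rfl⟩)
      · exact ⟨_, Nat.lt_succ_self t, rfl⟩
      · exact ⟨s, hs.trans (Nat.lt_succ_self t), rfl⟩
  refine ⟨Fintype.card γ, fun t => Submodule.span R (D.basis '' G t), ?_, ?_, fun t ht => ⟨?_, ?_⟩⟩
  · have : G 0 = ∅ := Set.eq_empty_of_forall_notMem fun r ⟨s, hs, _⟩ => Nat.not_lt_zero _ hs
    simp [this]
  · rw [Submodule.eq_top_iff']
    intro x
    refine D.mem_of_repr' fun p _ => ?_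
    obtain ⟨q, r, hqr, -, hr, -⟩ := D.exists_decomposition p
    rw [← hqr]
    have hr' : D.Low r (D.tgt r) := by rwa [D.tgt_eq_src_of_mul_eq hqr]
    refine Submodule.smul_mem _ _ (Submodule.subset_span ⟨r, ⟨f.symm ⟨r, hr'⟩, Fin.is_lt _, ?_⟩, rfl⟩)
    rw [Equiv.apply_symm_apply]
  · refine Submodule.span_mono (Set.image_mono ?_)
    rw [hG t ht]
    exact Set.subset_insert _ _
  · set r := (f ⟨t, ht⟩).1 with hr
    have hrlow : D.Low r (D.tgt r) := (f ⟨t, ht⟩).2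
    set i := D.tgt r with hi
    set F := Submodule.span R (D.basis '' G t) with hF
    set F' := Submodule.span R (D.basis '' G (t + 1)) with hF'
    have hrF' : D.basis r ∈ F' := Submodule.subset_span ⟨r, ⟨_, Nat.lt_succ_self t, rfl⟩, rfl⟩
    let g : Proj (e i) →ₗ[R] (F' ⧸ F.submoduleOf F') :=
      (LinearMap.toSpanSingleton R _
        ((F.submoduleOf F').mkQ ⟨D.basis r, hrF'⟩)).comp (Proj (e i)).subtype
    have hg : ∀ x, g x = Submodule.Quotient.mk ((x : R) • ⟨D.basis r, hrF'⟩) := fun x => rfl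
    refine ⟨i, ⟨((Submodule.quotEquivOfEq _ _ ?_).trans (g.quotKerEquivOfSurjective ?_)).symm⟩⟩
    · ext x
      rw [D.mem_standardKernel, LinearMap.mem_ker, hg, Submodule.Quotient.mk_eq_zero]
      change _ ↔ (x : R) * D.basis r ∈ F
      constructor
      · intro hx
        -- Membership in a submodule is checked path by path. If `p` is not low for `i` and `p r ≠
        -- 0`, the largest vertex of `p r` exceeds `i`, so its tail is an earlier generator.
        have : (x : R) ∈ F.comap (LinearMap.toSpanSingleton R R (D.basis r)) := by
          refine D.mem_of_repr' fun p hp => ?_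
          rw [Submodule.mem_comap, LinearMap.toSpanSingleton_apply, smul_eq_mul]
          by_cases h0 : D.basis p * D.basis r = 0
          · rw [h0]; exact F.zero_mem
          obtain ⟨p', hp'⟩ := D.exists_mul_eq h0
          obtain ⟨q', r', hqr', hq', hr', -⟩ := D.exists_decomposition p'
          have hlow : ¬ D.Low p' i := fun h => hp (hx p (h.of_mul_left hp'))
          have hlt : i < D.src q' := by
            by_contra hle
            exact hlow fun l hl => (hM.low_mul hq' hr' hqr' l hl).trans (not_lt.1 hle)
          have htgt := D.tgt_eq_src_of_mul_eq hqr'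
          have hrr : D.Low r' (D.tgt r') := by rwa [htgt]
          rw [hp', ← hqr']
          refine F.smul_mem _ (Submodule.subset_span
            ⟨r', ⟨f.symm ⟨r', hrr⟩, ?_, by rw [Equiv.apply_symm_apply]⟩, rfl⟩)
          by_contra hge
          have := hanti ⟨t, ht⟩ (f.symm ⟨r', hrr⟩) (not_lt.1 hge)
          rw [Equiv.apply_symm_apply] at this
          exact absurd (htgt ▸ this) (not_le_of_gt hlt)
        exact this
      · intro hx q hq
        by_contra hne
        have hsrc := D.mem_proj_iff.1 x.2 q hne
        -- A low `q` in the support of `x` would give a nonzero path `q r` lying above an earlier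
        -- generator as well; both factorizations cut at the vertex `i`, so that generator would be
        -- `r` itself.
        have hne0 := hQ.mul_ne_zero q r hsrc.symm (hsrc ▸ hq) (hsrc ▸ hrlow)
        obtain ⟨p, hp⟩ := D.exists_mul_eq hne0
        rw [← hM.repr_mul_basis hp] at hne
        obtain ⟨a, r', ⟨s, hs, rfl⟩, har⟩ := exists_of_mem_span hx hne
        have hplow : D.Low p i := hM.low_mul hq hrlow hp
        have hsrca := D.tgt_eq_src_of_mul_eq har
        have hai : D.src a = i := by
          rw [← hsrca]
          refine le_antisymm (hplow _ ((D.visits_tgt _).of_right har)) ?_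
          exact hanti s ⟨t, ht⟩ hs.le
        have := (decomposition_unique hM hQ (hp.trans har.symm) hne0 (hsrc ▸ hq) (hsrc ▸ hrlow)
          (hai ▸ hplow.of_mul_left har) (hai ▸ hplow.of_mul_right har)).2
        have hst := f.injective (Subtype.ext this)
        rw [← hst] at hs
        exact lt_irrefl _ hs
    · intro y
      obtain ⟨⟨z, hz⟩, rfl⟩ := Submodule.Quotient.mk_surjective _ y
      have hz' := hz
      rw [hF', hG t ht, Set.image_insert_eq, Submodule.mem_span_insert] at hz'
      obtain ⟨a, w, hw, hzw⟩ := hz'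
      refine ⟨⟨a * e i, Submodule.smul_mem _ a (D.idem_mem_proj i)⟩, ?_⟩
      rw [hg, Submodule.Quotient.eq]
      change a * e i * D.basis r - z ∈ F
      rw [mul_assoc, hi, D.idem_tgt_mul, hzw, smul_eq_mul, sub_add_cancel_left]
      exact F.neg_mem hw

theorem isQuasiHereditary (hM : D.IsMonomial) (hQ : D.IsQuasiHereditaryBasis) :
    IsQuasiHereditary k e :=
  ⟨hasStandardFiltration hM hQ, nonempty_end_standard hQ⟩

end PathBasis

namespace PathBasis

variable {k : Type*} [Field k] {R : Type*} [Ring R] [Algebra k R] {ι : Type*} [Fintype ι]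
  {e : ι → R} {β : Type*} (D : PathBasis k e β)

/-! ### Path bases of subalgebras and corners -/

section Restriction

variable {R' : Type*} [Ring R'] [Algebra k R'] {ι' : Type*} [Fintype ι']

/-- An embedding, possibly not unital, of an algebra with idempotents `e'` into `R`, whose image is
spanned by the set of paths `T`. -/
structure Restriction (e' : ι' → R') (T : Set β) where
  map : R' →ₗ[k] R
  injective : Function.Injective map
  map_mul : ∀ x y, map (x * y) = map x * map y
  ind : ι' → ι
  ind_injective : Function.Injective ind
  map_idem : ∀ i, map (e' i) = e (ind i)
  sum_idem : ∑ i, e' i = 1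
  exists_src : ∀ p ∈ T, ∃ i, ind i = D.src p
  exists_tgt : ∀ p ∈ T, ∃ i, ind i = D.tgt p
  triv_mem : ∀ i, D.triv (ind i) ∈ T
  mem_range : ∀ x, x ∈ LinearMap.range map ↔ ∀ p ∉ T, D.basis.repr x p = 0

namespace Restriction

variable {D} {e' : ι' → R'} {T : Set β} (ρ : D.Restriction e' T)

theorem exists_map_eq_basis (p : T) : ∃ x, ρ.map x = D.basis p := by
  classical
  refine (ρ.mem_range (D.basis p)).2 fun q hq => ?_
  rw [D.basis.repr_self, Finsupp.single_apply, if_neg]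
  rintro rfl
  exact hq p.2

/-- The preimage of a path. -/
noncomputable def path (p : T) : R' := (ρ.exists_map_eq_basis p).choose

theorem map_path (p : T) : ρ.map (ρ.path p) = D.basis p := (ρ.exists_map_eq_basis p).choose_spec

theorem linearIndependent_path : LinearIndependent k ρ.path := by
  refine LinearIndependent.of_comp ρ.map ?_
  have : ρ.map ∘ ρ.path = D.basis ∘ ((↑) : T → β) := funext ρ.map_path
  rw [this]
  exact D.basis.linearIndependent.comp _ Subtype.val_injective

theorem top_le_span_path [Fintype β] : ⊤ ≤ Submodule.span k (Set.range ρ.path) := by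
  classical
  intro x _
  have hx : ρ.map x ∈ (Submodule.span k (Set.range ρ.path)).map ρ.map := by
    refine D.mem_of_repr fun p hp => ?_
    have hpT : p ∈ T := by
      by_contra hpT
      exact hp ((ρ.mem_range _).1 ⟨x, rfl⟩ p hpT)
    exact ⟨_, Submodule.subset_span ⟨⟨p, hpT⟩, rfl⟩, ρ.map_path _⟩
  obtain ⟨y, hy, hxy⟩ := hx
  rwa [← ρ.injective hxy]

/-- The source of a path, as an index of the subalgebra. -/
noncomputable def source (p : T) : ι' := (ρ.exists_src p p.2).choose

/-- The target of a path, as an index of the subalgebra. -/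
noncomputable def target (p : T) : ι' := (ρ.exists_tgt p p.2).choose

theorem ind_source (p : T) : ρ.ind (ρ.source p) = D.src p := (ρ.exists_src p p.2).choose_spec

theorem ind_target (p : T) : ρ.ind (ρ.target p) = D.tgt p := (ρ.exists_tgt p p.2).choose_spec

/-- The induced basis of the subalgebra. -/
noncomputable def pathBasis [Fintype β] : PathBasis k e' T where
  basis := Module.Basis.mk ρ.linearIndependent_path ρ.top_le_span_path
  src := ρ.source
  tgt := ρ.target
  len p := D.len p
  triv i := ⟨D.triv (ρ.ind i), ρ.triv_mem i⟩
  basis_triv i := ρ.injective (by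
    rw [Module.Basis.mk_apply, ρ.map_path, ρ.map_idem, D.basis_triv])
  src_triv i := ρ.ind_injective (by rw [ρ.ind_source, D.src_triv])
  tgt_triv i := ρ.ind_injective (by rw [ρ.ind_target, D.tgt_triv])
  eq_triv p hp := by
    refine ⟨ρ.source p, Subtype.ext ?_⟩
    change (p : β) = D.triv (ρ.ind (ρ.source p))
    rw [ρ.ind_source]
    exact D.eq_triv_src hp
  mul_idem_src p := ρ.injective (by
    rw [ρ.map_mul, ρ.map_idem, ρ.ind_source, Module.Basis.mk_apply, ρ.map_path,
      D.mul_idem_src])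
  idem_tgt_mul p := ρ.injective (by
    rw [ρ.map_mul, ρ.map_idem, ρ.ind_target, Module.Basis.mk_apply, ρ.map_path,
      D.idem_tgt_mul])
  mul_idem_of_ne p i h := ρ.injective (by
    rw [ρ.map_mul, ρ.map_idem, Module.Basis.mk_apply, ρ.map_path, map_zero, D.mul_idem_of_ne]
    exact fun h' => h (ρ.ind_injective (by rw [h', ρ.ind_source])))
  idem_mul_of_ne p i h := ρ.injective (by
    rw [ρ.map_mul, ρ.map_idem, Module.Basis.mk_apply, ρ.map_path, map_zero, D.idem_mul_of_ne]
    exact fun h' => h (ρ.ind_injective (by rw [h', ρ.ind_target])))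
  sum_idem := ρ.sum_idem
  mul_mem p q := by
    classical
    simp only [Module.Basis.mk_apply]
    have hmap : ρ.map (ρ.path p * ρ.path q) = D.basis p * D.basis q := by
      rw [ρ.map_mul, ρ.map_path, ρ.map_path]
    obtain h0 | ⟨r, hr, hl⟩ := D.mul_mem p q
    · exact Or.inl (ρ.injective (by rw [hmap, h0, map_zero]))
    · have hrT : r ∈ T := by
        by_contra hrT
        have := (ρ.mem_range _).1 ⟨_, hmap⟩ r hrT
        rw [hr, D.basis.repr_self, Finsupp.single_eq_same] at this
        exact one_ne_zero this
      exact Or.inr ⟨⟨r, hrT⟩, ρ.injective (by rw [hmap, hr, ρ.map_path]), hl⟩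

variable [Fintype β]

theorem map_basis (p : T) : ρ.map (ρ.pathBasis.basis p) = D.basis p := by
  rw [pathBasis, Module.Basis.mk_apply, ρ.map_path]

theorem ind_src (p : T) : ρ.ind (ρ.pathBasis.src p) = D.src p := ρ.ind_source p

theorem ind_tgt (p : T) : ρ.ind (ρ.pathBasis.tgt p) = D.tgt p := ρ.ind_target p

theorem repr_map (x : R') (p : T) : D.basis.repr (ρ.map x) p = ρ.pathBasis.basis.repr x p := by
  classical
  have h : (D.basis.coord p).comp ρ.map = ρ.pathBasis.basis.coord p := by
    refine ρ.pathBasis.basis.ext fun q => ?_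
    rw [LinearMap.comp_apply, ρ.map_basis, Module.Basis.coord_apply, Module.Basis.coord_apply,
      Module.Basis.repr_self, Module.Basis.repr_self, Finsupp.single_apply, Finsupp.single_apply]
    simp only [Subtype.ext_iff]
  exact LinearMap.congr_fun h x

theorem repr_map_of_notMem (x : R') {p : β} (hp : p ∉ T) : D.basis.repr (ρ.map x) p = 0 :=
  (ρ.mem_range _).1 ⟨x, rfl⟩ p hp

theorem mul_basis_eq_iff {p q r : T} :
    ρ.pathBasis.basis p * ρ.pathBasis.basis q = ρ.pathBasis.basis r ↔
      D.basis p * D.basis q = D.basis r := by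
  rw [← ρ.injective.eq_iff, ρ.map_mul]
  simp only [ρ.map_basis]

theorem mul_basis_eq_zero_iff {p q : T} :
    ρ.pathBasis.basis p * ρ.pathBasis.basis q = 0 ↔ D.basis p * D.basis q = 0 := by
  rw [← ρ.injective.eq_iff, ρ.map_mul, map_zero]
  simp only [ρ.map_basis]

end Restriction

/-- A subalgebra spanned by paths. -/
def Restriction.ofSubalgebra [Fintype β] {T : Set β} (B : Subalgebra k R)
    (hB : ∀ x, x ∈ B ↔ ∀ p ∉ T, D.basis.repr x p = 0) (he : ∀ i, e i ∈ B) :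
    D.Restriction (fun i => (⟨e i, he i⟩ : B)) T where
  map := B.val.toLinearMap
  injective := Subtype.val_injective
  map_mul _ _ := rfl
  ind := id
  ind_injective := Function.injective_id
  map_idem _ := rfl
  sum_idem := Subtype.ext (by
    rw [AddSubmonoidClass.coe_finsetSum]
    exact D.sum_idem)
  exists_src p _ := ⟨_, rfl⟩
  exists_tgt p _ := ⟨_, rfl⟩
  triv_mem i := by
    by_contra h
    have := (hB _).1 (he i) _ h
    rw [id, D.repr_idem_triv] at this
    exact one_ne_zero this
  mem_range x := by
    rw [← hB]
    exact ⟨fun ⟨y, hy⟩ => hy ▸ y.2, fun hx => ⟨⟨x, hx⟩, rfl⟩⟩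

/-- The subalgebra has its own path basis, with the same trivial paths, so the criterion
`mem_jacobson` applies to it. -/
theorem mem_jacobson_subalgebra [Fintype β] {T : Set β} (B : Subalgebra k R)
    (hB : ∀ x, x ∈ B ↔ ∀ p ∉ T, D.basis.repr x p = 0) (he : ∀ i, e i ∈ B) {b : B} :
    b ∈ Ring.jacobson B ↔ ∀ i, D.basis.repr (b : R) (D.triv i) = 0 := by
  classical
  let ρ := Restriction.ofSubalgebra D B hB he
  rw [ρ.pathBasis.mem_jacobson]
  refine forall_congr' fun i => ?_
  rw [← ρ.repr_map]
  rfl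

end Restriction

/-! ### Path descriptions of `B_max`, `rad(R) rad(B_max)` and `B_min` -/

section BorelPaths

variable [LinearOrder ι] [Fintype β]

/-- The subalgebra spanned by a multiplicatively closed set of paths. -/
def spanSubalgebra (T : Set β) (htriv : ∀ i, D.triv i ∈ T)
    (hmul : ∀ p ∈ T, ∀ q ∈ T, ∀ r, D.basis p * D.basis q = D.basis r → r ∈ T) :
    Subalgebra k R where
  carrier := {x | ∀ p ∉ T, D.basis.repr x p = 0}
  add_mem' {x y} hx hy p hp := by rw [map_add, Finsupp.add_apply, hx p hp, hy p hp, add_zero]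
  mul_mem' {x y} hx hy p hp := by
    by_contra hne
    obtain ⟨s, t, hs, ht, hst⟩ := D.exists_of_repr_mul_ne_zero hne
    exact hp (hmul s (of_not_not fun h => hs (hx s h)) t (of_not_not fun h => ht (hy t h)) p hst)
  algebraMap_mem' c p hp := by
    rw [Algebra.algebraMap_eq_smul_one, ← D.sum_idem, map_smul, map_sum, Finsupp.smul_apply,
      Finsupp.coe_finsetSum, Finset.sum_apply, Finset.sum_eq_zero, smul_zero]
    intro i _
    classical
    rw [← D.basis_triv, D.basis.repr_self, Finsupp.single_apply, if_neg]
    rintro rfl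
    exact hp (htriv i)

variable {D} in
theorem mem_spanSubalgebra {T : Set β} {htriv : ∀ i, D.triv i ∈ T}
    {hmul : ∀ p ∈ T, ∀ q ∈ T, ∀ r, D.basis p * D.basis q = D.basis r → r ∈ T} {x : R} :
    x ∈ D.spanSubalgebra T htriv hmul ↔ ∀ p ∉ T, D.basis.repr x p = 0 := Iff.rfl

theorem basis_mem_iff {T : Set β} {B : Subalgebra k R}
    (hB : ∀ x, x ∈ B ↔ ∀ p ∉ T, D.basis.repr x p = 0) {p : β} : D.basis p ∈ B ↔ p ∈ T := by
  classical
  rw [hB]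
  constructor
  · intro h
    by_contra hp
    have := h p hp
    rw [D.basis.repr_self, Finsupp.single_eq_same] at this
    exact one_ne_zero this
  · intro hp q hq
    rw [D.basis.repr_self, Finsupp.single_apply, if_neg]
    rintro rfl
    exact hq hp

/-- The trivial and the direction-preserving paths. -/
def bMaxPaths : Set β := {p | D.len p = 0 ∨ D.src p < D.tgt p}

theorem mem_directionPreserving {x : R} :
    x ∈ directionPreserving e (Set.range D.basis) ↔ ∃ p, x = D.basis p ∧ D.src p < D.tgt p := by
  constructor
  · rintro ⟨⟨p, rfl⟩, i, j, hij, hp⟩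
    refine ⟨p, rfl, ?_⟩
    have h1 : i = D.src p := by
      by_contra hne
      rw [mul_assoc, D.mul_idem_of_ne _ _ hne, mul_zero] at hp
      exact D.basis_ne_zero p hp.symm
    have h2 : j = D.tgt p := by
      by_contra hne
      rw [D.idem_mul_of_ne _ _ hne, zero_mul] at hp
      exact D.basis_ne_zero p hp.symm
    rwa [← h1, ← h2]
  · rintro ⟨p, rfl, hp⟩
    exact ⟨⟨p, rfl⟩, _, _, hp, by rw [D.idem_tgt_mul, D.mul_idem_src]⟩

theorem mem_bMax {x : R} :
    x ∈ bMax k e (Set.range D.basis) ↔ ∀ p ∉ D.bMaxPaths, D.basis.repr x p = 0 := by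
  constructor
  · have hmul : ∀ p ∈ D.bMaxPaths, ∀ q ∈ D.bMaxPaths, ∀ r, D.basis p * D.basis q = D.basis r →
        r ∈ D.bMaxPaths := by
      rintro p hp q hq r hr
      have hs := D.src_eq_of_mul_eq hr
      have ht := D.tgt_eq_of_mul_eq hr
      have hm := D.tgt_eq_src_of_mul_eq hr
      rcases hp with hp | hp
      · rwa [← D.eq_of_len_eq_zero_of_mul_eq hr hp]
      · rcases hq with hq | hq
        · rw [← eq_of_len_eq_zero_of_mul_eq' hr hq]
          exact Or.inr hp
        · right
          rw [hs, ht]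
          exact hq.trans (hm ▸ hp)
    have hle : bMax k e (Set.range D.basis) ≤ D.spanSubalgebra D.bMaxPaths
        (fun i => Or.inl (D.len_triv i)) hmul := by
      refine Algebra.adjoin_le ?_
      rintro y (⟨i, rfl⟩ | hy)
      · rw [← D.basis_triv]
        exact (D.basis_mem_iff fun _ => mem_spanSubalgebra).2 (Or.inl (D.len_triv i))
      · obtain ⟨p, rfl, hp⟩ := D.mem_directionPreserving.1 hy
        exact (D.basis_mem_iff fun _ => mem_spanSubalgebra).2 (Or.inr hp)
    exact fun hx => hle hx
  · intro h
    refine D.mem_of_repr (N := Subalgebra.toSubmodule (bMax k e (Set.range D.basis)))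
      fun p hp => ?_
    have hpT : p ∈ D.bMaxPaths := of_not_not fun hpT => hp (h p hpT)
    rcases hpT with h0 | hlt
    · rw [D.eq_triv_src h0, D.basis_triv]
      exact Algebra.subset_adjoin (Or.inl ⟨_, rfl⟩)
    · exact Algebra.subset_adjoin (Or.inr (D.mem_directionPreserving.2 ⟨p, rfl, hlt⟩))

include D in
omit [Fintype β] in
theorem idem_mem_bMax (P : Set R) (i : ι) : e i ∈ bMax k e P :=
  Algebra.subset_adjoin (Or.inl ⟨i, rfl⟩)

theorem repr_basis_triv {p : β} (hp : D.len p ≠ 0) (i : ι) :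
    D.basis.repr (D.basis p) (D.triv i) = 0 := by
  classical
  rw [D.basis.repr_self, Finsupp.single_apply, if_neg]
  rintro rfl
  exact hp (D.len_triv i)

/-- Both radicals are spanned by the nontrivial paths they contain, and a nontrivial path in `B_max`
is direction-preserving. So right-minimality forbids a direction-preserving proper right factor. -/
theorem basis_mem_radMulRad {p : β} : D.basis p ∈ radMulRad k e (Set.range D.basis) ↔
    ∃ a b, D.basis a * D.basis b = D.basis p ∧ D.len a ≠ 0 ∧ D.src b < D.tgt b := by
  classical
  have hjac := fun b => D.mem_jacobson_subalgebra (bMax k e (Set.range D.basis))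
    (fun _ => D.mem_bMax) (D.idem_mem_bMax _) (b := b)
  constructor
  · intro h
    by_contra hno
    have hle : radMulRad k e (Set.range D.basis) ≤ LinearMap.ker (D.basis.coord p) := by
      refine Submodule.span_le.2 ?_
      rintro _ ⟨a, ha, b, hb, rfl⟩
      rw [SetLike.mem_coe, LinearMap.mem_ker, Module.Basis.coord_apply]
      by_contra hne
      obtain ⟨s, t, hs, ht, hst⟩ := D.exists_of_repr_mul_ne_zero hne
      have hs0 : D.len s ≠ 0 := fun h0 => hs (by
        rw [D.eq_triv_src h0]; exact D.mem_jacobson.1 ha _)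
      have ht0 : D.len t ≠ 0 := fun h0 => ht (by
        rw [D.eq_triv_src h0]; exact (hjac b).1 hb _)
      have htT : t ∈ D.bMaxPaths := of_not_not fun htT => ht (D.mem_bMax.1 b.2 t htT)
      exact hno ⟨s, t, hst, hs0, htT.resolve_left ht0⟩
    have := hle h
    rw [LinearMap.mem_ker, Module.Basis.coord_apply, D.basis.repr_self,
      Finsupp.single_eq_same] at this
    exact one_ne_zero this
  · rintro ⟨a, b, hab, ha, hb⟩
    have hb0 : D.len b ≠ 0 := fun h0 => by
      rw [D.eq_triv_src h0, D.src_triv, D.tgt_triv] at hb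
      exact lt_irrefl _ hb
    have hbB : D.basis b ∈ bMax k e (Set.range D.basis) :=
      (D.basis_mem_iff fun _ => D.mem_bMax).2 (Or.inr hb)
    exact Submodule.subset_span ⟨D.basis a, D.mem_jacobson.2 (D.repr_basis_triv ha),
      ⟨D.basis b, hbB⟩, (hjac _).2 (D.repr_basis_triv hb0), hab.symm⟩

/-- The paths all of whose vertices are bounded by their target. -/
def bMinPaths : Set β := {p | D.Low p (D.tgt p)}

theorem triv_mem_bMinPaths (i : ι) : D.triv i ∈ D.bMinPaths := by
  rw [bMinPaths, Set.mem_ofPred_eq, D.tgt_triv]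
  exact D.low_triv i

variable {D}

/-- The vertices of the product are those of the factors, and those of `q` are at most `t(q) = s(p)
≤ t(p)`. -/
theorem mul_mem_bMinPaths (hM : D.IsMonomial) {p q r : β} (hp : p ∈ D.bMinPaths)
    (hq : q ∈ D.bMinPaths) (hr : D.basis p * D.basis q = D.basis r) : r ∈ D.bMinPaths := by
  have ht := D.tgt_eq_of_mul_eq hr
  have hm := D.tgt_eq_src_of_mul_eq hr
  rw [bMinPaths, Set.mem_ofPred_eq] at *
  rw [ht]
  exact hM.low_mul hp (fun l hl => (hq l hl).trans (hm ▸ hp.src_le)) hr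

/-- If a right-minimal nontrivial `p` is cut at a vertex before its end, the right factor is not
direction-preserving, so this vertex is at most `s(p) < t(p)`. Conversely, a path low for its target
is right-minimal or splits into two shorter paths of the same kind. -/
theorem mem_bMin (hM : D.IsMonomial)
    (hloop : ∀ p, D.src p = D.tgt p → D.Low p (D.src p) → D.len p = 0) {x : R} :
    x ∈ bMin k e (Set.range D.basis) ↔ ∀ p ∉ D.bMinPaths, D.basis.repr x p = 0 := by
  constructor
  · have hle : bMin k e (Set.range D.basis) ≤ D.spanSubalgebra D.bMinPaths
        D.triv_mem_bMinPaths (fun p hp q hq r hr => mul_mem_bMinPaths hM hp hq hr) := by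
      refine Algebra.adjoin_le ?_
      rintro _ ⟨⟨p, rfl⟩, hp, hp'⟩
      refine (D.basis_mem_iff fun _ => mem_spanSubalgebra).2 ?_
      rcases (D.basis_mem_iff fun _ => D.mem_bMax).1 hp with h0 | hlt
      · rw [D.eq_triv_src h0]
        exact D.triv_mem_bMinPaths _
      · rintro l ⟨a, b, hab, rfl⟩
        by_cases ha : D.len a = 0
        · rw [D.eq_of_len_eq_zero_of_mul_eq hab ha]
        · have hb : ¬ D.src b < D.tgt b := fun hb =>
            hp' (D.basis_mem_radMulRad.2 ⟨a, b, hab, ha, hb⟩)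
          rw [← D.src_eq_of_mul_eq hab] at hb
          exact (not_lt.1 hb).trans hlt.le
    exact fun hx => hle hx
  · intro h
    refine D.mem_of_repr (N := Subalgebra.toSubmodule (bMin k e (Set.range D.basis)))
      fun p hp => ?_
    have hpT : p ∈ D.bMinPaths := of_not_not fun hpT => hp (h p hpT)
    clear h hp
    induction hl : D.len p using Nat.strong_induction_on generalizing p with
    | _ n ih =>
      by_cases hrad : D.basis p ∈ radMulRad k e (Set.range D.basis)
      · obtain ⟨a, b, hab, ha, hb⟩ := D.basis_mem_radMulRad.1 hrad
        -- The right factor `b` need not be low for its target; cutting it at its largest vertex and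
        -- moving `q` to the left factor repairs this.
        obtain ⟨q, r, hqr, hq, hr, -⟩ := D.exists_decomposition b
        rw [← hqr, ← mul_assoc] at hab
        obtain ⟨c, hc⟩ := D.exists_mul_eq (p := a) (q := q) fun h0 => D.basis_ne_zero p (by
          rw [← hab, h0, zero_mul])
        have hlc := D.len_eq_of_mul_eq hc
        rw [hc] at hab
        have hlp := D.len_eq_of_mul_eq hab
        have hsrc := D.tgt_eq_src_of_mul_eq hqr
        -- Were `r` trivial, the largest vertex of `b` would be its source, although `s(b) < t(b)`.
        -- This makes `c` shorter than `p`.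
        have hr0 : D.len r ≠ 0 := fun h0 => by
          have h1 := D.src_eq_of_mul_eq hqr
          have h2 : D.tgt b ≤ D.tgt r := by
            rw [D.tgt_eq_of_mul_eq hqr, hsrc]
            exact hq.tgt_le
          rw [D.eq_triv_src h0, D.tgt_triv, ← h1] at h2
          exact absurd hb (not_lt_of_ge h2)
        have hcT : c ∈ D.bMinPaths := by
          rw [bMinPaths, Set.mem_ofPred_eq, ← D.tgt_eq_of_mul_eq hab]
          exact hpT.of_mul_left hab
        have hrT : r ∈ D.bMinPaths := by
          rw [bMinPaths, Set.mem_ofPred_eq, hsrc]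
          exact hr
        rw [← hab]
        exact Subalgebra.mul_mem _ (ih _ (by omega) c hcT rfl) (ih _ (by omega) r hrT rfl)
      · refine Algebra.subset_adjoin ⟨⟨p, rfl⟩,
          (D.basis_mem_iff fun _ => D.mem_bMax).2 ?_, hrad⟩
        by_cases h0 : D.len p = 0
        · exact Or.inl h0
        · refine Or.inr (lt_of_le_of_ne hpT.src_le fun heq => h0 (hloop p heq ?_))
          rw [heq]
          exact hpT

end BorelPaths

end PathBasis

/-! ### Induction along a subalgebra with a dual basis -/

section DualBasis

variable {k : Type*} [Field k] {R : Type*} [Ring R] [Algebra k R] {B : Subalgebra k R}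

theorem inducedMap_mk {M N : Type z} [AddCommGroup M] [Module B M] [AddCommGroup N] [Module B N]
    (f : M →ₗ[B] N) (y : R ⊗[ℤ] M) :
    inducedMap f (Submodule.Quotient.mk y : Induced B M) = (Submodule.Quotient.mk
      (TensorProduct.AlgebraTensorModule.lTensor R R f.toAddMonoidHom.toIntLinearMap y) :
      Induced B N) := rfl

theorem mk_tmul_smul {M : Type*} [AddCommGroup M] [Module B M] (a : R) (b : B) (m : M) :
    (Submodule.Quotient.mk (a ⊗ₜ[ℤ] (b • m)) : Induced B M) =
      Submodule.Quotient.mk ((a * (b : R)) ⊗ₜ[ℤ] m) := by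
  rw [eq_comm, Submodule.Quotient.eq]
  exact Submodule.subset_span ⟨a, b, m, rfl⟩

/-- The map `R ⊗ M → M` given by a coordinate function `R → B`. -/
noncomputable def coordMap (φ : R →ₗ[k] B) (M : Type*) [AddCommGroup M]
    [Module B M] : R ⊗[ℤ] M →ₗ[ℤ] M :=
  TensorProduct.lift (LinearMap.mk₂ ℤ (fun a m => φ a • m)
    (fun a b m => by rw [map_add, add_smul]) (fun c a m => by rw [map_zsmul, smul_assoc])
    (fun a m m' => smul_add _ _ _) (fun c a m => smul_comm _ _ _))

theorem coordMap_tmul (φ : R →ₗ[k] B) (M : Type*) [AddCommGroup M]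
    [Module B M] (a : R) (m : M) : coordMap φ M (a ⊗ₜ m) = φ a • m := rfl

/-- Right `B`-linearity of `φ` is exactly what makes the coordinate map descend to `R ⊗_B M`. -/
theorem coordMap_eq_zero {φ : R →ₗ[k] B} (hφ : ∀ a (b : B), φ (a * b) = φ a * b) {M : Type*}
    [AddCommGroup M] [Module B M] {y : R ⊗[ℤ] M} (hy : y ∈ balancedRel B M) :
    coordMap φ M y = 0 := by
  -- The relations are closed under left multiplication by `R`, whereas the coordinate map is only
  -- additive; the induction therefore carries all multiples `r • y`.
  suffices h : ∀ r : R, coordMap φ M (r • y) = 0 by simpa using h 1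
  induction hy using Submodule.span_induction with
  | mem x hx =>
    obtain ⟨a, b, m, rfl⟩ := hx
    intro r
    rw [smul_sub, map_sub, TensorProduct.smul_tmul', TensorProduct.smul_tmul', coordMap_tmul,
      coordMap_tmul, smul_eq_mul, smul_eq_mul, ← mul_assoc, hφ, mul_smul, sub_self]
  | zero => simp
  | add x y _ _ hx hy => intro r; rw [smul_add, map_add, hx, hy, add_zero]
  | smul c x _ hx => intro r; rw [smul_smul, hx]

theorem coordMap_lTensor (φ : R →ₗ[k] B) {M N : Type*} [AddCommGroup M] [AddCommGroup N]
    [Module B M] [Module B N] (f : M →ₗ[B] N) (y : R ⊗[ℤ] M) :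
    coordMap φ N (TensorProduct.AlgebraTensorModule.lTensor R R f.toAddMonoidHom.toIntLinearMap y)
      = f (coordMap φ M y) := by
  induction y using TensorProduct.induction_on with
  | zero => simp
  | tmul a m =>
    rw [TensorProduct.AlgebraTensorModule.lTensor_tmul, coordMap_tmul, coordMap_tmul, map_smul]
    rfl
  | add x y hx hy => simp only [map_add, hx, hy]

/-- On pure tensors, `a ⊗ m = ∑ u_s φ_s(a) ⊗ m = ∑ u_s ⊗ φ_s(a) m`. Induced modules are thereby
controlled by coordinates in `M`, where exactness can be tested. -/
theorem mk_eq_sum_coordMap {σ : Type*} [Fintype σ] {u : σ → R} {φ : σ → R →ₗ[k] B}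
    (hsum : ∀ a, ∑ s, u s * (φ s a : R) = a) {M : Type*} [AddCommGroup M] [Module B M]
    (y : R ⊗[ℤ] M) :
    (Submodule.Quotient.mk y : Induced B M) =
      ∑ s, Submodule.Quotient.mk (u s ⊗ₜ[ℤ] coordMap (φ s) M y) := by
  induction y using TensorProduct.induction_on with
  | zero => simp
  | tmul a m =>
    simp only [coordMap_tmul, mk_tmul_smul]
    conv_lhs => rw [← hsum a, TensorProduct.sum_tmul]
    exact map_sum (balancedRel B M).mkQ _ _
  | add x y hx hy =>
    rw [Submodule.Quotient.mk_add, hx, hy, ← Finset.sum_add_distrib]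
    refine Finset.sum_congr rfl fun s _ => ?_
    rw [map_add, TensorProduct.tmul_add, Submodule.Quotient.mk_add]

/-- Induction along a subalgebra is exact if the algebra has a finite dual basis as a right module
over the subalgebra. -/
theorem exact_inducedMap {σ : Type*} [Fintype σ] {u : σ → R} {φ : σ → R →ₗ[k] B}
    (hφ : ∀ s a (b : B), φ s (a * b) = φ s a * b) (hsum : ∀ a, ∑ s, u s * (φ s a : R) = a)
    {M N K : Type z} [AddCommGroup M] [AddCommGroup N] [AddCommGroup K] [Module B M] [Module B N]
    [Module B K] {f : M →ₗ[B] N} {g : N →ₗ[B] K} (h : Function.Exact f g) :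
    Function.Exact (inducedMap f) (inducedMap g) := by
  intro y
  obtain ⟨y, rfl⟩ := Submodule.Quotient.mk_surjective _ y
  constructor
  · intro hy
    rw [inducedMap_mk, Submodule.Quotient.mk_eq_zero] at hy
    -- Each coordinate of a kernel element lies in the kernel of `g`, hence in the image of `f`; the
    -- preimages are reassembled with the `u s`.
    have h1 : ∀ s, ∃ m, f m = coordMap (φ s) N y := fun s => by
      refine (h _).1 ?_
      rw [← coordMap_lTensor, coordMap_eq_zero (hφ s) hy]
    choose m hm using h1
    refine ⟨∑ s, Submodule.Quotient.mk (u s ⊗ₜ[ℤ] m s), ?_⟩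
    rw [mk_eq_sum_coordMap hsum, map_sum]
    refine Finset.sum_congr rfl fun s _ => ?_
    rw [inducedMap_mk, TensorProduct.AlgebraTensorModule.lTensor_tmul, ← hm]
    rfl
  · rintro ⟨x, hx⟩
    obtain ⟨x, rfl⟩ := Submodule.Quotient.mk_surjective _ x
    rw [← hx, inducedMap_mk, inducedMap_mk, mk_eq_sum_coordMap hsum]
    refine Finset.sum_eq_zero fun s _ => ?_
    rw [coordMap_lTensor, coordMap_lTensor, (h _).2 ⟨_, rfl⟩, TensorProduct.tmul_zero,
      Submodule.Quotient.mk_zero]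

end DualBasis

/-! ### A vanishing criterion for `Ext¹` -/

section Ext

open CategoryTheory

/-- `Ext¹(A / I, L)` vanishes if every homomorphism `I → L` is given by right multiplication with
an element of `L`. -/
theorem subsingleton_ext_one {A : Type w} [Ring A] (I : Submodule A A) (L : Type w)
    [AddCommGroup L] [Module A L] (h : ∀ f : I →ₗ[A] L, ∃ m : L, ∀ x, f x = (x : A) • m) :
    Subsingleton (Abelian.Ext.{w} (ModuleCat.of A (A ⧸ I)) (ModuleCat.of A L) 1) := by
  let S : ShortComplex (ModuleCat.{w} A) :=
    ShortComplex.mk (ModuleCat.ofHom I.subtype) (ModuleCat.ofHom I.mkQ) (by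
      ext x
      exact (Submodule.Quotient.mk_eq_zero I).2 x.2)
  have hS : S.ShortExact :=
    { exact := (ShortComplex.ShortExact.moduleCat_exact_iff_function_exact _).2
        (LinearMap.exact_subtype_mkQ I)
      mono_f := (ModuleCat.mono_iff_injective _).2 I.subtype_injective
      epi_g := (ModuleCat.epi_iff_surjective _).2 I.mkQ_surjective }
  have : Projective S.X₂ := inferInstanceAs (Projective (ModuleCat.of A A))
  refine subsingleton_of_forall_eq 0 fun x => ?_
  -- As `A` is projective, every class comes from a homomorphism `I → L` through the connecting map.
  -- Homomorphisms that extend to `A` give the zero class.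
  obtain ⟨y, rfl⟩ := Abelian.Ext.contravariant_sequence_exact₃ hS (ModuleCat.of A L) x
    (Abelian.Ext.eq_zero_of_projective _) (n₀ := 0) rfl
  obtain ⟨f, rfl⟩ : ∃ f, Abelian.Ext.mk₀ f = y := ⟨_, Abelian.Ext.mk₀_homEquiv₀_apply y⟩
  obtain ⟨m, hm⟩ := h f.hom
  have hf : f = S.f ≫ ModuleCat.ofHom (LinearMap.toSpanSingleton A L m) := by
    ext x
    exact hm x
  rw [hf, ← Abelian.Ext.mk₀_comp_mk₀, ← Abelian.Ext.comp_assoc_of_second_deg_zero,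
    hS.extClass_comp, Abelian.Ext.zero_comp]

end Ext

namespace PathBasis

/-! ### Simple modules, especially over directed algebras -/

section Simple

variable {k : Type*} [Field k] {R : Type w} [Ring R] [Algebra k R] {ι : Type*} [Fintype ι]
  {e : ι → R} {β : Type*} [Fintype β] (D : PathBasis k e β)

/-- The simple module at the vertex `i`. -/
abbrev Simple (i : ι) : Type w := R ⧸ D.trivIdeal i

/-- The generator of the simple module at `i`. -/
def simpleGen (i : ι) : D.Simple i := Submodule.Quotient.mk 1

theorem smul_simpleGen {i : ι} (x : R) : x • D.simpleGen i = Submodule.Quotient.mk x := by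
  rw [simpleGen, ← Submodule.Quotient.mk_smul, smul_eq_mul, mul_one]

theorem smul_simpleGen_eq_zero {i : ι} {x : R} :
    x • D.simpleGen i = 0 ↔ D.basis.repr x (D.triv i) = 0 := by
  rw [smul_simpleGen, Submodule.Quotient.mk_eq_zero, mem_trivIdeal]

theorem exists_smul_simpleGen {i : ι} (m : D.Simple i) : ∃ x : R, x • D.simpleGen i = m := by
  obtain ⟨x, rfl⟩ := Submodule.Quotient.mk_surjective _ m
  exact ⟨x, D.smul_simpleGen x⟩

theorem simpleGen_ne_zero (i : ι) : D.simpleGen i ≠ 0 := by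
  rw [← one_smul R (D.simpleGen i), Ne, smul_simpleGen_eq_zero, D.repr_one_triv]
  exact one_ne_zero

theorem exists_smul_simpleGen_field {i : ι} (m : D.Simple i) :
    ∃ c : k, m = c • D.simpleGen i := by
  obtain ⟨x, rfl⟩ := D.exists_smul_simpleGen m
  refine ⟨D.basis.repr x (D.triv i), ?_⟩
  have h : (x - D.basis.repr x (D.triv i) • (1 : R)) • D.simpleGen i = 0 := by
    rw [smul_simpleGen_eq_zero, map_sub, map_smul, Finsupp.sub_apply, Finsupp.smul_apply,
      D.repr_one_triv, smul_eq_mul, mul_one, sub_self]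
  rwa [sub_smul, smul_assoc, one_smul, sub_eq_zero] at h

theorem idem_smul_simple_of_ne {i j : ι} (h : j ≠ i) (m : D.Simple i) : e j • m = 0 := by
  obtain ⟨x, rfl⟩ := D.exists_smul_simpleGen m
  rw [smul_smul, smul_simpleGen_eq_zero, D.repr_mul_triv, D.repr_idem_triv_of_ne h, zero_mul]

theorem idem_smul_simpleGen (i : ι) : e i • D.simpleGen i = D.simpleGen i := by
  rw [← sub_eq_zero]
  conv_lhs => rw [← one_smul R (D.simpleGen i), smul_smul, ← sub_smul]
  rw [smul_simpleGen_eq_zero, map_sub, Finsupp.sub_apply, mul_one, D.repr_idem_triv,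
    D.repr_one_triv, sub_self]

theorem isSimpleModule_simple (i : ι) : IsSimpleModule R (D.Simple i) :=
  isSimpleModule_iff_isCoatom.2 (D.isCoatom_trivIdeal i)

theorem eq_of_simple_equiv {i j : ι} (h : Nonempty (D.Simple i ≃ₗ[R] D.Simple j)) : i = j := by
  obtain ⟨θ⟩ := h
  by_contra hne
  apply D.simpleGen_ne_zero i
  rw [← θ.map_eq_zero_iff, ← D.idem_smul_simpleGen, map_smul, D.idem_smul_simple_of_ne hne]

theorem nonempty_end_simple (i : ι) : Nonempty (Module.End R (D.Simple i) ≃ₐ[k] k) :=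
  nonempty_end_algEquiv (D.simpleGen i) (D.simpleGen_ne_zero i) D.exists_smul_simpleGen
    fun _ => D.exists_smul_simpleGen_field _

include D in
theorem nonempty_end_top (i : ι) : Nonempty (Module.End R (Top (e i)) ≃ₐ[k] k) := by
  let v : Top (e i) := Submodule.Quotient.mk ⟨e i, D.idem_mem_proj i⟩
  have hv : ∀ x : Proj (e i), (x : R) • v = Submodule.Quotient.mk x := fun x => by
    rw [← Submodule.Quotient.mk_smul]
    exact congrArg _ (Subtype.ext (D.mem_proj.1 x.2))
  refine nonempty_end_algEquiv v (fun h => ?_) (fun m => ?_) (fun f => ?_)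
  · rw [Submodule.Quotient.mk_eq_zero, D.mem_jacobson_proj, D.repr_idem_triv] at h
    exact one_ne_zero h
  · obtain ⟨x, rfl⟩ := Submodule.Quotient.mk_surjective _ m
    exact ⟨x, hv x⟩
  · obtain ⟨x, hx⟩ := Submodule.Quotient.mk_surjective _ (f v)
    refine ⟨D.basis.repr (x : R) (D.triv i), ?_⟩
    rw [← hx, ← Submodule.Quotient.mk_smul, Submodule.Quotient.eq, D.mem_jacobson_proj]
    change D.basis.repr ((x : R) - D.basis.repr (x : R) (D.triv i) • e i) (D.triv i) = 0
    rw [map_sub, map_smul, Finsupp.sub_apply, Finsupp.smul_apply, D.repr_idem_triv, smul_eq_mul,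
      mul_one, sub_self]

variable [LinearOrder ι]

/-- Take the largest `i` with `e i M ≠ 0`. Nontrivial paths starting at `i` end higher and hence
kill `e i M`, so a nonzero `e i • m` is annihilated by the maximal left ideal `trivIdeal i`. -/
theorem exists_simple_equiv (hdir : ∀ p, D.len p ≠ 0 → D.src p < D.tgt p) (M : Type*)
    [AddCommGroup M] [Module R M] [IsSimpleModule R M] :
    ∃ i, Nonempty (M ≃ₗ[R] D.Simple i) := by
  classical
  have : Nontrivial M := IsSimpleModule.nontrivial R M
  obtain ⟨m₀, hm₀⟩ := exists_ne (0 : M)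
  obtain ⟨i₀, hi₀⟩ : ∃ i, e i • m₀ ≠ 0 := by
    by_contra! h
    apply hm₀
    rw [← one_smul R m₀, ← D.sum_idem, Finset.sum_smul]
    exact Finset.sum_eq_zero fun i _ => h i
  obtain ⟨i, hi, hmax⟩ := Finset.exists_max_image
    (Finset.univ.filter fun i => ∃ m : M, e i • m ≠ 0) id
    ⟨i₀, Finset.mem_filter.2 ⟨Finset.mem_univ _, _, hi₀⟩⟩
  obtain ⟨m, hm⟩ := (Finset.mem_filter.1 hi).2
  have hkill : ∀ j, i < j → ∀ y : M, e j • y = 0 := by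
    intro j hj y
    by_contra hne
    exact absurd (hmax j (Finset.mem_filter.2 ⟨Finset.mem_univ _, y, hne⟩)) (not_le_of_gt hj)
  have hle : D.trivIdeal i ≤ LinearMap.ker (LinearMap.toSpanSingleton R M (e i • m)) := by
    intro x hx
    refine D.mem_of_repr' fun p hp => ?_
    rw [LinearMap.mem_ker, LinearMap.toSpanSingleton_apply, smul_smul]
    by_cases hs : i = D.src p
    · have h0 : D.len p ≠ 0 := fun h0 => hp (by rw [D.eq_triv_src h0, ← hs]; exact hx)
      rw [← D.idem_tgt_mul, mul_smul, mul_smul]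
      exact hkill _ (hs ▸ hdir p h0) _
    · rw [D.mul_idem_of_ne p i hs, zero_smul]
  have hker : D.trivIdeal i = LinearMap.ker (LinearMap.toSpanSingleton R M (e i • m)) := by
    refine (((D.isCoatom_trivIdeal i).le_iff_eq fun h => hm ?_).1 hle).symm
    have : (1 : R) ∈ LinearMap.ker (LinearMap.toSpanSingleton R M (e i • m)) :=
      h ▸ Submodule.mem_top
    simpa using this
  exact ⟨i, ⟨((Submodule.quotEquivOfEq _ _ hker).trans (LinearMap.quotKerEquivOfSurjective _
    (IsSimpleModule.toSpanSingleton_surjective R hm))).symm⟩⟩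

/-- For `x` in `trivIdeal i`, the part `x e_i` involves only paths ending above `i > j`. A
homomorphism to the simple module at `j` kills it, so it is determined by its value at `1 - e i`, as
`subsingleton_ext_one` requires. -/
theorem subsingleton_ext_simple (hdir : ∀ p, D.len p ≠ 0 → D.src p < D.tgt p) {i j : ι}
    (hij : j < i) : Subsingleton (CategoryTheory.Abelian.Ext.{w} (ModuleCat.of R (D.Simple i))
      (ModuleCat.of R (D.Simple j)) 1) := by
  refine subsingleton_ext_one _ _ fun f => ?_
  have h1 : (1 - e i) ∈ D.trivIdeal i := by
    rw [mem_trivIdeal, map_sub, Finsupp.sub_apply, D.repr_one_triv, D.repr_idem_triv, sub_self]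
  refine ⟨f ⟨1 - e i, h1⟩, fun x => ?_⟩
  have h2 : (x : R) * e i ∈ D.trivIdeal i := by
    rw [mem_trivIdeal, D.repr_mul_triv, D.mem_trivIdeal.1 x.2, zero_mul]
  have h3 : f ⟨(x : R) * e i, h2⟩ = 0 := by
    obtain ⟨c, hc⟩ := D.exists_smul_simpleGen_field (f ⟨(x : R) * e i, h2⟩)
    have h4 : e j • (⟨(x : R) * e i, h2⟩ : D.trivIdeal i) = 0 := by
      refine Subtype.ext (D.basis.ext_elem fun p => ?_)
      change D.basis.repr (e j * (x * e i)) p = D.basis.repr 0 p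
      rw [map_zero, Finsupp.zero_apply]
      by_contra hne
      obtain ⟨ht, hne⟩ := D.tgt_of_repr_idem_mul hne
      obtain ⟨hs, hne⟩ := D.src_of_repr_mul_idem hne
      have h0 : D.len p ≠ 0 := fun h0 => hne (by rw [D.eq_triv_src h0, hs]; exact x.2)
      have := hdir p h0
      rw [hs, ht] at this
      exact lt_asymm this hij
    have h5 : e j • f ⟨(x : R) * e i, h2⟩ = f ⟨(x : R) * e i, h2⟩ := by
      rw [hc, smul_comm, D.idem_smul_simpleGen]
    rw [← h5, ← map_smul, h4, map_zero]
  have hx : x = (x : R) • (⟨1 - e i, h1⟩ : D.trivIdeal i) + ⟨(x : R) * e i, h2⟩ := Subtype.ext (by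
    change (x : R) = x * (1 - e i) + x * e i
    rw [← mul_add, sub_add_cancel, mul_one])
  conv_lhs => rw [hx, map_add, h3, add_zero, map_smul]

end Simple

/-! ### `B_min` is an exact Borel subalgebra -/

section ExactBorel

variable {k : Type*} [Field k] {R : Type w} [Ring R] [Algebra k R] {ι : Type z} [Fintype ι]
  {e : ι → R} {β : Type*} [Fintype β] {D : PathBasis k e β} [LinearOrder ι]

/-- With `p = hd p · tl p` the cut at the largest vertex, `φ s` sends `p` to `tl p` if `hd p = s`
and to zero otherwise. Indices that are not heads contribute zero. -/
theorem exists_dualBasis (hM : D.IsMonomial) (hQ : D.IsQuasiHereditaryBasis) (B : Subalgebra k R)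
    (hB : ∀ x, x ∈ B ↔ ∀ p ∉ D.bMinPaths, D.basis.repr x p = 0) :
    ∃ φ : β → R →ₗ[k] B, (∀ s a (b : B), φ s (a * b) = φ s a * b) ∧
      ∀ a, ∑ s, D.basis s * (φ s a : R) = a := by
  classical
  choose hd tl hmul hhd htl _ using D.exists_decomposition
  have htl' : ∀ p, tl p ∈ D.bMinPaths := fun p => by
    rw [bMinPaths, Set.mem_ofPred_eq, D.tgt_eq_src_of_mul_eq (hmul p)]
    exact htl p
  have htlB : ∀ p, D.basis (tl p) ∈ B := fun p => (D.basis_mem_iff hB).2 (htl' p)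
  let φ : β → R →ₗ[k] B := fun s =>
    D.basis.constr k fun p => if hd p = s then (⟨D.basis (tl p), htlB p⟩ : B) else 0
  have hφ : ∀ s p, φ s (D.basis p) = if hd p = s then (⟨D.basis (tl p), htlB p⟩ : B) else 0 :=
    fun s p => D.basis.constr_basis k _ p
  refine ⟨φ, fun s a b => ?_, fun a => ?_⟩
  · have hpath : ∀ p, ∀ r ∈ D.bMinPaths, ((φ s (D.basis p * D.basis r) : B) : R) =
        φ s (D.basis p) * D.basis r := by
      intro p r hr
      -- If `tl p · r` is a nonzero path `t`, the path condition gives `hd p · t ≠ 0`, and by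
      -- uniqueness this is the decomposition of `p r`: right multiplication by `B` changes only
      -- tails.
      by_cases h0 : D.basis (tl p) * D.basis r = 0
      · rw [← hmul p, mul_assoc, h0, mul_zero, map_zero, hmul p, hφ]
        split_ifs
        · exact h0.symm
        · simp
      · obtain ⟨t, ht⟩ := D.exists_mul_eq h0
        have htB : t ∈ D.bMinPaths := mul_mem_bMinPaths hM (htl' p) hr ht
        have hsrc : D.tgt t = D.src (hd p) := by
          rw [D.tgt_eq_of_mul_eq ht, D.tgt_eq_src_of_mul_eq (hmul p)]
        have htlow : D.Low t (D.src (hd p)) := hsrc ▸ htB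
        have hne := hQ.mul_ne_zero (hd p) t hsrc (hhd p) htlow
        obtain ⟨u, hu⟩ := D.exists_mul_eq hne
        have hpu : D.basis p * D.basis r = D.basis u := by rw [← hmul p, mul_assoc, ht, hu]
        obtain ⟨h1, h2⟩ := decomposition_unique hM hQ (hu.trans (hmul u).symm) hne (hhd p) htlow
          (hhd u) (htl u)
        rw [hpu, hφ, hφ, ← h1]
        split_ifs
        · change D.basis (tl u) = D.basis (tl p) * D.basis r
          rw [ht, h2]
        · simp
    have hb : (b : R) ∈ Submodule.span k (D.basis '' D.bMinPaths) :=
      D.mem_of_repr fun r hr => Submodule.subset_span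
        ⟨r, of_not_not fun h => hr ((hB b).1 b.2 r h), rfl⟩
    apply Subtype.ext
    change ((φ s (a * b) : B) : R) = φ s a * b
    generalize (b : R) = b at hb
    induction hb using Submodule.span_induction with
    | mem x hx =>
      obtain ⟨r, hr, rfl⟩ := hx
      rw [← D.sum_repr a, Finset.sum_mul]
      simp only [map_sum, AddSubmonoidClass.coe_finsetSum, Finset.sum_mul, smul_mul_assoc, map_smul,
        Subalgebra.coe_smul]
      refine Finset.sum_congr rfl fun p _ => ?_
      rw [hpath p r hr]
    | zero => simp
    | add x y _ _ hx hy => rw [mul_add, map_add, Subalgebra.coe_add, hx, hy, mul_add]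
    | smul c x _ hx => rw [mul_smul_comm, map_smul, Subalgebra.coe_smul, hx, mul_smul_comm]
  · have hlin : ∑ s, (LinearMap.mulLeft k (D.basis s)).comp (B.val.toLinearMap.comp (φ s)) =
        LinearMap.id := by
      refine D.basis.ext fun p => ?_
      rw [LinearMap.sum_apply, Finset.sum_eq_single (hd p)]
      · change D.basis (hd p) * (φ (hd p) (D.basis p) : B) = D.basis p
        rw [hφ, if_pos rfl]
        exact hmul p
      · intro s _ hs
        change D.basis s * (φ s (D.basis p) : B) = 0
        rw [hφ, if_neg (Ne.symm hs)]
        simp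
      · exact fun h => absurd (Finset.mem_univ _) h
    have := LinearMap.congr_fun hlin a
    rwa [LinearMap.sum_apply] at this

/-- Both modules are cyclic, with generators `1 ⊗ v` and `standardGen i`; the two maps exchange
them. -/
theorem nonempty_induced_simple_equiv [Fintype D.bMinPaths] (hQ : D.IsQuasiHereditaryBasis)
    (B : Subalgebra k R)
    (hB : ∀ x, x ∈ B ↔ ∀ p ∉ D.bMinPaths, D.basis.repr x p = 0) (he : ∀ i, e i ∈ B) (i : ι) :
    Nonempty (Induced B ((Restriction.ofSubalgebra D B hB he).pathBasis.Simple i) ≃ₗ[R]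
      Standard e i) := by
  classical
  set ρ := Restriction.ofSubalgebra D B hB he with hρ
  have hrepr : ∀ b : B, ρ.pathBasis.basis.repr b (ρ.pathBasis.triv i) =
      D.basis.repr (b : R) (D.triv i) := fun b => (ρ.repr_map b (ρ.pathBasis.triv i)).symm
  set v := ρ.pathBasis.simpleGen i with hv
  -- Well defined because a nontrivial path of `B` from `i` ends strictly above `i`, and so vanishes
  -- in `Δ_i`.
  let h₀ : ρ.pathBasis.Simple i →ₗ[B] Standard e i :=
    (ρ.pathBasis.trivIdeal i).liftQ (LinearMap.toSpanSingleton B _ (D.standardGen i)) (by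
      intro b hb
      rw [mem_trivIdeal, hrepr] at hb
      rw [LinearMap.mem_ker, LinearMap.toSpanSingleton_apply]
      change (b : R) • D.standardGen i = 0
      have hbe : (b : R) * e i ∈ Proj (e i) := Submodule.smul_mem _ (b : R) (D.idem_mem_proj i)
      rw [← D.idem_smul_standardGen, smul_smul, D.smul_standardGen_eq_zero_iff hbe]
      intro p hp
      by_contra hne
      obtain ⟨hs, hne⟩ := D.src_of_repr_mul_idem hne
      have hpT : p ∈ D.bMinPaths := of_not_not fun h => hne ((hB b).1 b.2 p h)
      have hpT' : D.Low p (D.tgt p) := hpT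
      have heq : D.src p = D.tgt p := le_antisymm hpT'.src_le (hs ▸ hp.tgt_le)
      have h0 := hQ.len_eq_zero p heq (hs ▸ hp)
      exact hne (by rw [D.eq_triv_src h0, hs, hb]))
  have hh₀ : ∀ b : B, h₀ (b • v) = (b : R) • D.standardGen i := fun b => by
    rw [map_smul]
    change b • ((1 : B) • D.standardGen i) = _
    rw [one_smul]; rfl
  let G : Induced B (ρ.pathBasis.Simple i) →ₗ[R] Standard e i :=
    (balancedRel B _).liftQ (TensorProduct.AlgebraTensorModule.lift
      (LinearMap.toSpanSingleton R (ρ.pathBasis.Simple i →ₗ[ℤ] Standard e i)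
        h₀.toAddMonoidHom.toIntLinearMap)) (by
      rw [balancedRel, Submodule.span_le]
      rintro _ ⟨a, b, m, rfl⟩
      rw [SetLike.mem_coe, LinearMap.mem_ker, map_sub, sub_eq_zero]
      change (a * (b : R)) • h₀ m = a • h₀ (b • m)
      rw [map_smul, mul_smul]
      rfl)
  have hG : ∀ a m, G (Submodule.Quotient.mk (a ⊗ₜ m)) = a • h₀ m := fun a m => rfl
  -- Well defined because a path from `i` that is not low for `i` has a nontrivial tail `r` in `B`;
  -- then `q r ⊗ v = q ⊗ r v = 0`.
  let H : Standard e i →ₗ[R] Induced B (ρ.pathBasis.Simple i) :=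
    (standardKernel e i).liftQ ((LinearMap.toSpanSingleton R _
      (Submodule.Quotient.mk ((1 : R) ⊗ₜ[ℤ] v))).comp (Proj (e i)).subtype) (by
      intro x hx
      rw [D.mem_standardKernel] at hx
      rw [LinearMap.mem_ker]
      change (x : R) ∈ LinearMap.ker (LinearMap.toSpanSingleton R
        (Induced B (ρ.pathBasis.Simple i)) (Submodule.Quotient.mk ((1 : R) ⊗ₜ[ℤ] v)))
      refine D.mem_of_repr' fun p hp => ?_
      have hsrc := D.mem_proj_iff.1 x.2 p hp
      obtain ⟨q, r, hqr, hq, hr, -⟩ := D.exists_decomposition p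
      have hrs := D.tgt_eq_src_of_mul_eq hqr
      have hrT : r ∈ D.bMinPaths := by
        rw [bMinPaths, Set.mem_ofPred_eq, hrs]; exact hr
      have hr0 : D.len r ≠ 0 := fun h0 => by
        rw [D.eq_of_len_eq_zero_of_mul_eq' hqr h0] at hq
        exact hp (hx p (hsrc ▸ hq))
      have hrv : (⟨D.basis r, (D.basis_mem_iff hB).2 hrT⟩ : B) • v = 0 := by
        rw [smul_simpleGen_eq_zero, hrepr]
        exact D.repr_basis_triv hr0 i
      rw [LinearMap.mem_ker, LinearMap.toSpanSingleton_apply, ← Submodule.Quotient.mk_smul,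
        TensorProduct.smul_tmul', smul_eq_mul, mul_one, ← hqr]
      have := mk_tmul_smul (D.basis q) (⟨D.basis r, (D.basis_mem_iff hB).2 hrT⟩ : B) v
      rw [hrv, TensorProduct.tmul_zero, Submodule.Quotient.mk_zero] at this
      exact this.symm)
  have hH : H (D.standardGen i) = Submodule.Quotient.mk ((1 : R) ⊗ₜ[ℤ] v) := by
    change e i • (Submodule.Quotient.mk ((1 : R) ⊗ₜ[ℤ] v) : Induced B _) = _
    rw [← Submodule.Quotient.mk_smul, TensorProduct.smul_tmul', smul_eq_mul, mul_one]
    have := mk_tmul_smul (1 : R) (⟨e i, he i⟩ : B) v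
    rw [one_mul, ρ.pathBasis.idem_smul_simpleGen] at this
    exact this.symm
  refine ⟨LinearEquiv.ofLinearMap G H ?_ ?_⟩
  · refine LinearMap.ext fun m => ?_
    obtain ⟨x, -, rfl⟩ := D.exists_smul_standardGen m
    rw [map_smul, map_smul, LinearMap.comp_apply, hH, hG, ← one_smul B v, hh₀]
    simp
  · refine LinearMap.ext fun y => ?_
    obtain ⟨y, rfl⟩ := Submodule.Quotient.mk_surjective _ y
    rw [LinearMap.comp_apply, LinearMap.id_apply]
    induction y using TensorProduct.induction_on with
    | zero => simp
    | tmul a m =>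
      obtain ⟨b, rfl⟩ := ρ.pathBasis.exists_smul_simpleGen m
      rw [hG, hh₀, map_smul, map_smul, hH, mk_tmul_smul, smul_smul, ← Submodule.Quotient.mk_smul,
        TensorProduct.smul_tmul', smul_eq_mul, mul_one]
    | add x y hx hy => rw [Submodule.Quotient.mk_add, map_add, map_add, hx, hy]

theorem isExactBorel (hM : D.IsMonomial) (hQ : D.IsQuasiHereditaryBasis) (B : Subalgebra k R)
    (hB : ∀ x, x ∈ B ↔ ∀ p ∉ D.bMinPaths, D.basis.repr x p = 0) : IsExactBorel B e := by
  classical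
  have he : ∀ i, e i ∈ B := fun i => by
    rw [← D.basis_triv, D.basis_mem_iff hB]
    exact D.triv_mem_bMinPaths i
  obtain ⟨φ, hφ, hsum⟩ := exists_dualBasis hM hQ B hB
  set ρ := Restriction.ofSubalgebra D B hB he with hρ
  have hdir : ∀ p, ρ.pathBasis.len p ≠ 0 → ρ.pathBasis.src p < ρ.pathBasis.tgt p := by
    intro p hp
    have h1 : ρ.pathBasis.src p = D.src p := ρ.ind_src p
    have h2 : ρ.pathBasis.tgt p = D.tgt p := ρ.ind_tgt p
    rw [h1, h2]
    have hlow : D.Low p (D.tgt p) := p.2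
    refine lt_of_le_of_ne hlow.src_le fun heq => hp (hQ.len_eq_zero p heq (heq ▸ hlow))
  refine ⟨fun M N K _ _ _ _ _ _ _ _ _ f g h => exact_inducedMap hφ hsum h, ?_⟩
  refine ⟨ρ.pathBasis.Simple, inferInstance, inferInstance, inferInstance, inferInstance,
    ρ.pathBasis.isSimpleModule_simple, fun i j => ρ.pathBasis.eq_of_simple_equiv,
    fun M _ _ _ => ρ.pathBasis.exists_simple_equiv hdir M,
    nonempty_induced_simple_equiv hQ B hB he, fun i => ?_, fun i j h => ?_⟩
  · obtain ⟨f⟩ := ρ.pathBasis.nonempty_end_simple i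
    obtain ⟨g⟩ := D.nonempty_end_top i
    exact ⟨f.trans g.symm⟩
  · by_contra hij
    have := ρ.pathBasis.subsingleton_ext_simple hdir (not_le.1 hij)
    exact not_subsingleton _ this

end ExactBorel

end PathBasis

namespace PathBasis

/-! ### Restriction to an upper set of vertices -/

section Upper

variable {k : Type*} [Field k] {R : Type*} [Ring R] [Algebra k R] {ι : Type*} [Fintype ι]
  {e : ι → R} {β : Type*} [Fintype β] {D : PathBasis k e β}
  {R' : Type*} [Ring R'] [Algebra k R'] {ι' : Type*} [Fintype ι'] {e' : ι' → R'} {T : Set β}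
  {ρ : D.Restriction e' T}

/-- The image of the restriction contains all paths between vertices of its index set. -/
def Restriction.IsFull (ρ : D.Restriction e' T) : Prop :=
  ∀ p, (∃ i, ρ.ind i = D.src p) → (∃ i, ρ.ind i = D.tgt p) → p ∈ T

/-- The connecting path `c` runs between the targets of `q` and `q'`, which are retained vertices,
so fullness retains `c`. -/
theorem Restriction.IsFull.isMonomial (hρ : ρ.IsFull) (hM : D.IsMonomial) :
    ρ.pathBasis.IsMonomial := by
  intro p q p' q' h hne hl
  rw [Ne, ρ.mul_basis_eq_zero_iff] at hne
  have h' : D.basis p * D.basis q = D.basis p' * D.basis q' := by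
    have := congrArg ρ.map h
    simpa only [ρ.map_mul, ρ.map_basis] using this
  obtain ⟨c, hc1, hc2⟩ := hM p q p' q' h' hne hl
  have hcT : c ∈ T := hρ c
    ((D.tgt_eq_src_of_mul_eq hc1) ▸ ρ.exists_tgt q q.2)
    ((D.tgt_eq_of_mul_eq hc1) ▸ ρ.exists_tgt q' q'.2)
  exact ⟨⟨c, hcT⟩, ρ.mul_basis_eq_iff.2 hc1, ρ.mul_basis_eq_iff.2 hc2⟩

theorem Restriction.IsFull.visits_iff (hρ : ρ.IsFull) {p : T} {l : ι'} :
    ρ.pathBasis.Visits p l ↔ D.Visits p (ρ.ind l) := by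
  constructor
  · rintro ⟨a, b, hab, rfl⟩
    exact ⟨a, b, ρ.mul_basis_eq_iff.1 hab, (ρ.ind_tgt b).symm⟩
  · rintro ⟨a, b, hab, hb⟩
    have hbT : b ∈ T := hρ b ((D.src_eq_of_mul_eq hab) ▸ ρ.exists_src p p.2) ⟨l, hb.symm⟩
    have haT : a ∈ T := hρ a ⟨l, by rw [← hb, D.tgt_eq_src_of_mul_eq hab]⟩
      ((D.tgt_eq_of_mul_eq hab) ▸ ρ.exists_tgt p p.2)
    exact ⟨⟨a, haT⟩, ⟨b, hbT⟩, ρ.mul_basis_eq_iff.2 hab,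
      ρ.ind_injective ((ρ.ind_tgt ⟨b, hbT⟩).trans hb)⟩

variable [LinearOrder ι] [LinearOrder ι']

/-- A vertex violating the bound `ind j` lies above it and so belongs to the upper set. The
discarded vertices can never be obstructions, although paths may pass through them. -/
theorem Restriction.IsFull.low_iff (hρ : ρ.IsFull) (hmono : StrictMono ρ.ind)
    (hupper : IsUpperSet (Set.range ρ.ind)) {p : T} {j : ι'} :
    ρ.pathBasis.Low p j ↔ D.Low p (ρ.ind j) := by
  constructor
  · intro h l hl
    by_contra hlt
    obtain ⟨l, rfl⟩ := hupper (not_le.1 hlt).le ⟨j, rfl⟩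
    exact hlt (hmono.monotone (h l (hρ.visits_iff.2 hl)))
  · exact fun h l hl => hmono.le_iff_le.1 (h _ (hρ.visits_iff.1 hl))

theorem Restriction.IsFull.mem_bMinPaths_iff (hρ : ρ.IsFull) (hmono : StrictMono ρ.ind)
    (hupper : IsUpperSet (Set.range ρ.ind)) {p : T} :
    p ∈ ρ.pathBasis.bMinPaths ↔ (p : β) ∈ D.bMinPaths := by
  rw [bMinPaths, bMinPaths, Set.mem_ofPred_eq, Set.mem_ofPred_eq, hρ.low_iff hmono hupper,
    ρ.ind_tgt]

theorem Restriction.IsFull.isQuasiHereditaryBasis (hρ : ρ.IsFull) (hmono : StrictMono ρ.ind)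
    (hupper : IsUpperSet (Set.range ρ.ind)) (hQ : D.IsQuasiHereditaryBasis) :
    ρ.pathBasis.IsQuasiHereditaryBasis := by
  refine ⟨fun p h hl => ?_, fun q r h hq hr => ?_⟩
  · rw [hρ.low_iff hmono hupper, ρ.ind_src] at hl
    exact hQ.len_eq_zero p (by rw [← ρ.ind_src, h, ρ.ind_tgt]) hl
  · rw [hρ.low_iff hmono hupper, ρ.ind_src] at hq hr
    rw [Ne, ρ.mul_basis_eq_zero_iff]
    exact hQ.mul_ne_zero q r (by rw [← ρ.ind_src, ← h, ρ.ind_tgt]) hq hr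

end Upper

/-! ### The corner algebra `e R e` -/

section Corner

variable {k : Type*} [Field k] {R : Type w} [Ring R] [Algebra k R] {ι : Type z} [Fintype ι]
  [LinearOrder ι] [LocallyFiniteOrderTop ι] {e : ι → R} {β : Type*} [Fintype β]
  (D : PathBasis k e β) (he : OrthogonalIdempotents e) (i₀ : ι)

theorem exists_of_repr_mul_upperSum_ne_zero {x : R} {p : β}
    (h : D.basis.repr (x * upperSum e i₀) p ≠ 0) : i₀ ≤ D.src p ∧ D.basis.repr x p ≠ 0 := by
  rw [upperSum, Finset.mul_sum, map_sum, Finsupp.coe_finsetSum, Finset.sum_apply] at h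
  obtain ⟨i, hi, hne⟩ := Finset.exists_ne_zero_of_sum_ne_zero h
  obtain ⟨hs, hx⟩ := D.src_of_repr_mul_idem hne
  exact ⟨hs ▸ Finset.mem_Ici.1 hi, hx⟩

theorem exists_of_repr_upperSum_mul_ne_zero {x : R} {p : β}
    (h : D.basis.repr (upperSum e i₀ * x) p ≠ 0) : i₀ ≤ D.tgt p ∧ D.basis.repr x p ≠ 0 := by
  rw [upperSum, Finset.sum_mul, map_sum, Finsupp.coe_finsetSum, Finset.sum_apply] at h
  obtain ⟨i, hi, hne⟩ := Finset.exists_ne_zero_of_sum_ne_zero h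
  obtain ⟨hs, hx⟩ := D.tgt_of_repr_idem_mul hne
  exact ⟨hs ▸ Finset.mem_Ici.1 hi, hx⟩

theorem basis_mul_upperSum {p : β} (h : i₀ ≤ D.src p) :
    D.basis p * upperSum e i₀ = D.basis p := by
  rw [upperSum, Finset.mul_sum, Finset.sum_eq_single (D.src p), D.mul_idem_src]
  · exact fun i _ hi => D.mul_idem_of_ne p i hi
  · exact fun h' => absurd (Finset.mem_Ici.2 h) h'

theorem upperSum_mul_basis {p : β} (h : i₀ ≤ D.tgt p) :
    upperSum e i₀ * D.basis p = D.basis p := by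
  rw [upperSum, Finset.sum_mul, Finset.sum_eq_single (D.tgt p), D.idem_tgt_mul]
  · exact fun i _ hi => D.idem_mul_of_ne p i hi
  · exact fun h' => absurd (Finset.mem_Ici.2 h) h'

/-- The paths between vertices that are at least `i₀`. -/
def upperPaths : Set β := {p | i₀ ≤ D.src p ∧ i₀ ≤ D.tgt p}

include he in
theorem mem_corner_iff_repr {x : R} :
    x ∈ Subsemigroup.corner (upperSum e i₀) ↔ ∀ p ∉ D.upperPaths i₀, D.basis.repr x p = 0 := by
  rw [Subsemigroup.mem_corner_iff (isIdempotentElem_upperSum he i₀)]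
  constructor
  · rintro ⟨h1, h2⟩ p hp
    by_contra hne
    refine hp ⟨(D.exists_of_repr_mul_upperSum_ne_zero i₀ (h2.symm ▸ hne)).1,
      (D.exists_of_repr_upperSum_mul_ne_zero i₀ (h1.symm ▸ hne)).1⟩
  · intro h
    -- Being fixed by `e` on either side is written as a kernel, so that it can be verified on
    -- single paths.
    have hx : x ∈ LinearMap.ker (LinearMap.mulLeft k (upperSum e i₀) - LinearMap.id) ⊓
        LinearMap.ker (LinearMap.mulRight k (upperSum e i₀) - LinearMap.id) := by
      refine D.mem_of_repr fun p hp => ?_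
      have hpT : p ∈ D.upperPaths i₀ := of_not_not fun hpT => hp (h p hpT)
      refine ⟨?_, ?_⟩
      · simp [D.upperSum_mul_basis i₀ hpT.2]
      · simp [D.basis_mul_upperSum i₀ hpT.1]
    exact ⟨sub_eq_zero.1 hx.1, sub_eq_zero.1 hx.2⟩

/-- The corner algebra of an upper set of vertices, as spanned by paths. -/
def cornerRestriction [Fintype (Set.Ici i₀)] :
    D.Restriction (cornerIdem he i₀) (D.upperPaths i₀) where
  map :=
    { toFun := Subtype.val
      map_add' := fun _ _ => rfl
      map_smul' := fun _ _ => rfl }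
  injective := Subtype.val_injective
  map_mul _ _ := rfl
  ind := Subtype.val
  ind_injective := Subtype.val_injective
  map_idem _ := rfl
  sum_idem := by
    let φ : (isIdempotentElem_upperSum he i₀).Corner →ₗ[k] R :=
      { toFun := Subtype.val
        map_add' := fun _ _ => rfl
        map_smul' := fun _ _ => rfl }
    apply Subtype.val_injective
    change φ (∑ i, cornerIdem he i₀ i) = upperSum e i₀
    rw [map_sum]
    exact (Finset.sum_subtype (Finset.Ici i₀) (fun _ => Finset.mem_Ici) e).symm
  exists_src p hp := ⟨⟨_, hp.1⟩, rfl⟩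
  exists_tgt p hp := ⟨⟨_, hp.2⟩, rfl⟩
  triv_mem i := ⟨by rw [D.src_triv]; exact i.2, by rw [D.tgt_triv]; exact i.2⟩
  mem_range x := by
    rw [← D.mem_corner_iff_repr he i₀]
    exact ⟨fun ⟨y, hy⟩ => hy ▸ y.2, fun hx => ⟨⟨x, hx⟩, rfl⟩⟩

/-- The corner inherits the path basis, the monomial property and the path condition, so everything
proved for `R` holds for it. For the equality with `e B_min e`, multiplying by `e` on both sides can
only remove paths from the support, and an element of the corner is its own image. -/
theorem corner_of_isQuasiHereditaryBasis (hM : D.IsMonomial) (hQ : D.IsQuasiHereditaryBasis) :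
    IsQuasiHereditary k (cornerIdem he i₀) ∧
    cornerSet (isIdempotentElem_upperSum he i₀) (bMin k e (Set.range D.basis) : Set R) =
      (bMin k (cornerIdem he i₀)
        (cornerPaths (isIdempotentElem_upperSum he i₀) (Set.range D.basis)) : Set _) ∧
    IsExactBorel (bMin k (cornerIdem he i₀)
      (cornerPaths (isIdempotentElem_upperSum he i₀) (Set.range D.basis))) (cornerIdem he i₀) := by
  classical
  let ρ := D.cornerRestriction he i₀
  have hmap : ∀ x, ρ.map x = x.1 := fun x => rfl
  have hfull : ρ.IsFull := by
    rintro p ⟨i, hi⟩ ⟨j, hj⟩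
    exact ⟨hi ▸ i.2, hj ▸ j.2⟩
  have hmono : StrictMono ρ.ind := fun _ _ h => h
  have hupper : IsUpperSet (Set.range ρ.ind) := by
    rintro a b hab ⟨i, rfl⟩
    exact ⟨⟨b, le_trans i.2 hab⟩, rfl⟩
  have hM' := hfull.isMonomial hM
  have hQ' := hfull.isQuasiHereditaryBasis hmono hupper hQ
  have hpaths : cornerPaths (isIdempotentElem_upperSum he i₀) (Set.range D.basis) =
      Set.range ρ.pathBasis.basis := by
    ext x
    constructor
    · rintro ⟨p, hp⟩
      have hpT : p ∈ D.upperPaths i₀ := by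
        by_contra hpT
        have := (D.mem_corner_iff_repr he i₀).1 x.2 p hpT
        rw [← hp, D.basis.repr_self, Finsupp.single_eq_same] at this
        exact one_ne_zero this
      exact ⟨⟨p, hpT⟩, ρ.injective ((ρ.map_basis _).trans hp)⟩
    · rintro ⟨p, rfl⟩
      exact ⟨p, (ρ.map_basis p).symm⟩
  rw [hpaths]
  have hB : ∀ x, x ∈ bMin k (cornerIdem he i₀) (Set.range ρ.pathBasis.basis) ↔
      ∀ p ∉ ρ.pathBasis.bMinPaths, ρ.pathBasis.basis.repr x p = 0 := fun x =>
    mem_bMin hM' hQ'.len_eq_zero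
  refine ⟨isQuasiHereditary hM' hQ', ?_, isExactBorel hM' hQ' _ hB⟩
  ext x
  rw [SetLike.mem_coe, hB]
  have hx := (Subsemigroup.mem_corner_iff (isIdempotentElem_upperSum he i₀)).1 x.2
  constructor
  · rintro ⟨b, hb, hxb⟩ p hp
    by_contra hne
    rw [← ρ.repr_map, hmap, hxb] at hne
    have h1 := (D.exists_of_repr_mul_upperSum_ne_zero i₀ hne).2
    have h2 := (D.exists_of_repr_upperSum_mul_ne_zero i₀ h1).2
    refine h2 ((mem_bMin hM hQ.len_eq_zero).1 hb p fun hp' => hp ?_)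
    exact (hfull.mem_bMinPaths_iff hmono hupper).2 hp'
  · intro h
    refine ⟨x.1, (mem_bMin hM hQ.len_eq_zero).2 fun p hp => ?_, by rw [hx.1, hx.2]⟩
    by_cases hpT : p ∈ D.upperPaths i₀
    · have := h ⟨p, hpT⟩ fun hp' => hp ((hfull.mem_bMinPaths_iff hmono hupper).1 hp')
      rwa [← ρ.repr_map, hmap] at this
    · exact ρ.repr_map_of_notMem x hpT

end Corner

end PathBasis

/-! ### Monomial algebras have monomial path bases -/

/-- Strip common last arrows until `p'` is exhausted; what remains of `p` is `c`. The length
hypothesis prevents `p` from running out first. -/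
theorem Quiver.Path.exists_comp_of_comp_eq_comp {V : Type v} [Quiver.{w} V] {i j j' l : V}
    (q : Quiver.Path i j) (p : Quiver.Path j l) (q' : Quiver.Path i j') (p' : Quiver.Path j' l)
    (h : q.comp p = q'.comp p') (hl : q.length ≤ q'.length) :
    ∃ c : Quiver.Path j j', q' = q.comp c ∧ p = c.comp p' := by
  induction p' with
  | nil => exact ⟨p, h.symm, rfl⟩
  | cons p' a ih =>
    cases p with
    | nil =>
      have := congrArg Quiver.Path.length h
      simp only [Quiver.Path.comp_nil, Quiver.Path.length_comp, Quiver.Path.length_cons] at this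
      omega
    | cons p a' =>
      simp only [Quiver.Path.comp_cons] at h
      obtain rfl := Quiver.Path.obj_eq_of_cons_eq_cons h
      obtain rfl := eq_of_heq (Quiver.Path.hom_heq_of_cons_eq_cons h)
      obtain ⟨c, hc1, hc2⟩ := ih p (eq_of_heq (Quiver.Path.heq_of_cons_eq_cons h))
      exact ⟨c, hc1, by rw [hc2, Quiver.Path.comp_cons]⟩

namespace MonomialBorel

section

variable {V : Type v} [Quiver.{w} V]

namespace AnyPath

theorem mul?_eq_some {p q r : AnyPath V} (h : mul? p q = some r) :
    ∃ (i j l : V) (a : Quiver.Path j l) (b : Quiver.Path i j),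
      p = ⟨j, l, a⟩ ∧ q = ⟨i, j, b⟩ ∧ r = ⟨i, l, b.comp a⟩ := by
  obtain ⟨j, l, a⟩ := p
  obtain ⟨i, j', b⟩ := q
  by_cases hj : j' = j
  · subst hj
    rw [mul?_mk, Option.some_inj] at h
    exact ⟨i, j', l, a, b, rfl, rfl, h.symm⟩
  · rw [mul?_of_ne (by exact hj)] at h
    cases h

theorem length_of_mul?_eq_some {p q r : AnyPath V} (h : mul? p q = some r) :
    r.length = p.length + q.length := by
  obtain ⟨i, j, l, a, b, rfl, rfl, rfl⟩ := mul?_eq_some h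
  exact (Quiver.Path.length_comp _ _).trans (Nat.add_comm _ _)

theorem exists_of_mul?_eq {p q p' q' r : AnyPath V} (h : mul? p q = some r)
    (h' : mul? p' q' = some r) (hl : q.length ≤ q'.length) :
    ∃ c, mul? c q = some q' ∧ mul? p' c = some p := by
  obtain ⟨i, j, l, a, b, rfl, rfl, rfl⟩ := mul?_eq_some h
  obtain ⟨i', j', l', a', b', rfl, rfl, hr⟩ := mul?_eq_some h'
  simp only [Sigma.mk.injEq] at hr
  obtain ⟨rfl, hr⟩ := hr
  rw [heq_eq_eq, Sigma.mk.injEq] at hr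
  obtain ⟨rfl, hr⟩ := hr
  obtain ⟨c, rfl, rfl⟩ := Quiver.Path.exists_comp_of_comp_eq_comp b a b' a' (eq_of_heq hr) hl
  exact ⟨⟨j, j', c⟩, mul?_mk _ _, mul?_mk _ _⟩

theorem finite_length_eq [Finite V] [∀ a b : V, Finite (a ⟶ b)] (n : ℕ) :
    {p : AnyPath V | p.length = n}.Finite := by
  induction n with
  | zero =>
    refine (Set.finite_range (trivial : V → AnyPath V)).subset ?_
    rintro ⟨i, j, p⟩ hp
    cases p with
    | nil => exact ⟨i, rfl⟩
    | cons p a => exact absurd hp (Nat.succ_ne_zero _)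
  | succ n ih =>
    have hfin : (⋃ p ∈ {p : AnyPath V | p.length = n}, ⋃ c : V,
        Set.range fun a : p.2.1 ⟶ c => (⟨p.1, c, p.2.2.cons a⟩ : AnyPath V)).Finite :=
      ih.biUnion fun p _ => Set.finite_iUnion fun c => Set.finite_range _
    refine hfin.subset ?_
    rintro ⟨i, j, p⟩ hp
    cases p with
    | nil => exact absurd hp (Nat.succ_ne_zero _).symm
    | cons p a =>
      simp only [Set.mem_iUnion]
      exact ⟨⟨i, _, p⟩, Nat.succ_injective hp, j, a, rfl⟩

end AnyPath

variable (k : Type u) [Field k]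

theorem linearIndependent_ofPath :
    LinearIndependent k (PathAlgebra.ofPath k : AnyPath V → PathAlgebra k V) :=
  Finsupp.basisSingleOne.linearIndependent

variable [Fintype V] {k} {S : Set (AnyPath V)}

theorem mul_mem_span_ofPath {T : Set (AnyPath V)}
    (hmul : ∀ p q r, AnyPath.mul? p q = some r → p ∈ T ∨ q ∈ T → r ∈ T) {x y : PathAlgebra k V}
    (h : x ∈ Submodule.span k (PathAlgebra.ofPath k '' T) ∨
      y ∈ Submodule.span k (PathAlgebra.ofPath k '' T)) :
    x * y ∈ Submodule.span k (PathAlgebra.ofPath k '' T) := by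
  have hpath : ∀ p q, p ∈ T ∨ q ∈ T → PathAlgebra.ofPath k p * PathAlgebra.ofPath k q ∈
      Submodule.span k (PathAlgebra.ofPath k '' T) := by
    intro p q hpq
    rw [PathAlgebra.ofPath_mul]
    cases hr : AnyPath.mul? p q with
    | none => exact Submodule.zero_mem _
    | some r => exact Submodule.subset_span ⟨r, hmul p q r hr hpq, rfl⟩
  rcases h with h | h
  · induction h using Submodule.span_induction with
    | mem x hx =>
      obtain ⟨p, hp, rfl⟩ := hx
      induction y using PathAlgebra.induction_on with
      | h0 => rw [mul_zero]; exact Submodule.zero_mem _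
      | hadd a b ha hb => rw [mul_add]; exact Submodule.add_mem _ ha hb
      | hsmul c a ha => rw [mul_smul_comm]; exact Submodule.smul_mem _ _ ha
      | hp q => exact hpath p q (Or.inl hp)
    | zero => rw [zero_mul]; exact Submodule.zero_mem _
    | add a b _ _ ha hb => rw [add_mul]; exact Submodule.add_mem _ ha hb
    | smul c a _ ha => rw [smul_mul_assoc]; exact Submodule.smul_mem _ _ ha
  · induction h using Submodule.span_induction with
    | mem x hx =>
      obtain ⟨p, hp, rfl⟩ := hx
      induction x using PathAlgebra.induction_on with
      | h0 => rw [zero_mul]; exact Submodule.zero_mem _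
      | hadd a b ha hb => rw [add_mul]; exact Submodule.add_mem _ ha hb
      | hsmul c a ha => rw [smul_mul_assoc]; exact Submodule.smul_mem _ _ ha
      | hp q => exact hpath q p (Or.inr hp)
    | zero => rw [mul_zero]; exact Submodule.zero_mem _
    | add a b _ _ ha hb => rw [mul_add]; exact Submodule.add_mem _ ha hb
    | smul c a _ ha => rw [mul_smul_comm]; exact Submodule.smul_mem _ _ ha

/-- The span of a set of paths closed under multiplication by arbitrary paths is a two-sided ideal.
It is applied to the paths lying in `I` and to the paths of length at least two. -/
theorem mem_span_of_mem_pathIdeal {T : Set (AnyPath V)} (hS : S ⊆ T)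
    (hmul : ∀ p q r, AnyPath.mul? p q = some r → p ∈ T ∨ q ∈ T → r ∈ T) {x : PathAlgebra k V}
    (hx : x ∈ pathIdeal k S) : x ∈ Submodule.span k (PathAlgebra.ofPath k '' T) := by
  rw [pathIdeal, TwoSidedIdeal.mem_asIdeal] at hx
  induction hx using TwoSidedIdeal.span_induction with
  | mem x h =>
    obtain ⟨p, hp, rfl⟩ := h
    exact Submodule.subset_span ⟨p, hS hp, rfl⟩
  | zero => exact Submodule.zero_mem _
  | add x y _ _ hx hy => exact Submodule.add_mem _ hx hy
  | neg x _ hx => exact Submodule.neg_mem _ hx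
  | left_absorb a x _ hx => exact mul_mem_span_ofPath hmul (Or.inr hx)
  | right_absorb b x _ hx => exact mul_mem_span_ofPath hmul (Or.inl hx)

theorem ofPath_mem_pathIdeal_of_mul {p q r : AnyPath V} (h : AnyPath.mul? p q = some r)
    (hpq : PathAlgebra.ofPath k p ∈ pathIdeal k S ∨ PathAlgebra.ofPath k q ∈ pathIdeal k S) :
    PathAlgebra.ofPath k r ∈ pathIdeal k S := by
  have hr : PathAlgebra.ofPath k r = PathAlgebra.ofPath k p * PathAlgebra.ofPath k q := by
    rw [PathAlgebra.ofPath_mul, h]; rfl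
  rw [hr]
  rcases hpq with hp | hq
  · exact Ideal.mul_mem_right _ _ hp
  · exact Ideal.mul_mem_left _ _ hq

theorem mem_pathIdeal_iff {x : PathAlgebra k V} : x ∈ pathIdeal k S ↔
    x ∈ Submodule.span k (PathAlgebra.ofPath k '' {p | PathAlgebra.ofPath k p ∈ pathIdeal k S}) := by
  constructor
  · refine mem_span_of_mem_pathIdeal (fun p hp => ?_)
      fun p q r h hpq => ofPath_mem_pathIdeal_of_mul h hpq
    exact TwoSidedIdeal.mem_asIdeal.2 (TwoSidedIdeal.subset_span ⟨p, hp, rfl⟩)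
  · have : Submodule.span k (PathAlgebra.ofPath k '' {p | PathAlgebra.ofPath k p ∈ pathIdeal k S}) ≤
        (pathIdeal k S).restrictScalars k := by
      rw [Submodule.span_le]
      rintro _ ⟨p, hp, rfl⟩
      exact hp
    exact fun hx => this hx

theorem IsAdmissible.two_le_length_of_mem (hS : IsAdmissible k S) {p : AnyPath V}
    (hp : PathAlgebra.ofPath k p ∈ pathIdeal k S) : 2 ≤ p.length := by
  by_contra hlt
  let T : Set (AnyPath V) := {p | 2 ≤ p.length}
  have hmul : ∀ p q r, AnyPath.mul? p q = some r → p ∈ T ∨ q ∈ T → r ∈ T := by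
    intro p q r h hpq
    have := AnyPath.length_of_mul?_eq_some h
    change 2 ≤ r.length
    change 2 ≤ p.length ∨ 2 ≤ q.length at hpq
    omega
  exact (linearIndependent_ofPath (V := V) k).notMem_span_image (s := T) hlt
    (mem_span_of_mem_pathIdeal hS.two_le_length hmul hp)

variable (k S) in
/-- The paths of `Q` that are nonzero in the monomial algebra. -/
abbrev NonzeroPath : Type _ := {p : AnyPath V // PathAlgebra.ofPath k p ∉ pathIdeal k S}

theorem IsAdmissible.finite_nonzeroPath [∀ a b : V, Finite (a ⟶ b)] (hS : IsAdmissible k S) :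
    Finite (NonzeroPath k S) := by
  obtain ⟨N, hN⟩ := hS.exists_long_mem
  have hfin : (⋃ m ∈ Set.Iio N, {p : AnyPath V | p.length = m}).Finite :=
    (Set.finite_Iio N).biUnion fun m _ => AnyPath.finite_length_eq m
  have hsub : {p : AnyPath V | PathAlgebra.ofPath k p ∉ pathIdeal k S} ⊆
      ⋃ m ∈ Set.Iio N, {p : AnyPath V | p.length = m} := fun p hp => by
    simp only [Set.mem_iUnion]
    exact ⟨p.length, not_le.1 fun h => hp (hN p h), rfl⟩
  exact (hfin.subset hsub).to_subtype

variable (k S) in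
/-- The class of a nonzero path in the monomial algebra. -/
noncomputable def NonzeroPath.toAlgebra (p : NonzeroPath k S) : MonomialAlgebra k S :=
  Ideal.Quotient.mk (pathIdeal k S) (PathAlgebra.ofPath k p.1)

/-- A monomial ideal is spanned by the paths it contains, so its intersection with the span of the
remaining paths is zero. -/
theorem linearIndependent_toAlgebra : LinearIndependent k (NonzeroPath.toAlgebra k S) := by
  have hli := linearIndependent_ofPath (V := V) k
  refine (hli.comp (Subtype.val : NonzeroPath k S → AnyPath V) Subtype.val_injective).map
    (f := (Ideal.Quotient.mkₐ k (pathIdeal k S)).toLinearMap) ?_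
  have hker : LinearMap.ker (Ideal.Quotient.mkₐ k (pathIdeal k S)).toLinearMap =
      Submodule.span k (PathAlgebra.ofPath k '' {p | PathAlgebra.ofPath k p ∈ pathIdeal k S}) := by
    ext x
    rw [← mem_pathIdeal_iff, LinearMap.mem_ker]
    exact Ideal.Quotient.eq_zero_iff_mem
  rw [hker, Set.range_comp, Subtype.range_coe_subtype]
  exact hli.disjoint_span_image (Set.disjoint_left.2 fun p hp hp' => hp hp')

theorem top_le_span_toAlgebra : ⊤ ≤ Submodule.span k (Set.range (NonzeroPath.toAlgebra k S)) := by
  intro x _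
  obtain ⟨x, rfl⟩ := Ideal.Quotient.mk_surjective x
  induction x using PathAlgebra.induction_on with
  | h0 => rw [map_zero]; exact Submodule.zero_mem _
  | hadd a b ha hb => rw [map_add]; exact Submodule.add_mem _ (ha trivial) (hb trivial)
  | hsmul c a ha =>
    have : Ideal.Quotient.mk (pathIdeal k S) (c • a) = c • Ideal.Quotient.mk (pathIdeal k S) a :=
      map_smul (Ideal.Quotient.mkₐ k (pathIdeal k S)) c a
    rw [this]
    exact Submodule.smul_mem _ _ (ha trivial)
  | hp p =>
    by_cases hp : PathAlgebra.ofPath k p ∈ pathIdeal k S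
    · rw [Ideal.Quotient.eq_zero_iff_mem.2 hp]
      exact Submodule.zero_mem _
    · exact Submodule.subset_span ⟨⟨p, hp⟩, rfl⟩

theorem numberedIdem_symm {n : ℕ} (ν : Fin n ≃ V) (i : V) :
    MonomialAlgebra.numberedIdem k S ν (ν.symm i) =
      Ideal.Quotient.mk (pathIdeal k S) (PathAlgebra.vertex k i) := by
  rw [MonomialAlgebra.numberedIdem, Equiv.apply_symm_apply]; rfl

theorem toAlgebra_mul_of_some {p q : NonzeroPath k S} {r : AnyPath V}
    (h : AnyPath.mul? p.1 q.1 = some r) : NonzeroPath.toAlgebra k S p * NonzeroPath.toAlgebra k S q =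
      Ideal.Quotient.mk (pathIdeal k S) (PathAlgebra.ofPath k r) := by
  rw [NonzeroPath.toAlgebra, NonzeroPath.toAlgebra, ← map_mul, PathAlgebra.ofPath_mul, h]; rfl

theorem toAlgebra_mul_of_none {p q : NonzeroPath k S}
    (h : AnyPath.mul? p.1 q.1 = none) :
    NonzeroPath.toAlgebra k S p * NonzeroPath.toAlgebra k S q = 0 := by
  rw [NonzeroPath.toAlgebra, NonzeroPath.toAlgebra, ← map_mul, PathAlgebra.ofPath_mul, h]
  exact map_zero _

/-- The basis of a monomial algebra consisting of its paths. -/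
noncomputable def IsAdmissible.pathBasis (hS : IsAdmissible k S) {n : ℕ} (ν : Fin n ≃ V) :
    PathBasis k (MonomialAlgebra.numberedIdem k S ν) (NonzeroPath k S) where
  basis := Module.Basis.mk linearIndependent_toAlgebra top_le_span_toAlgebra
  src p := ν.symm p.1.1
  tgt p := ν.symm p.1.2.1
  len p := p.1.length
  -- Admissibility keeps trivial paths out of `I`, since every path in `I` has length at least two.
  triv i := ⟨AnyPath.trivial (ν i), fun h =>
    absurd (hS.two_le_length_of_mem h) (by simp [AnyPath.trivial, AnyPath.length])⟩
  basis_triv i := by rw [Module.Basis.mk_apply]; rfl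
  src_triv i := ν.symm_apply_apply i
  tgt_triv i := ν.symm_apply_apply i
  eq_triv := by
    rintro ⟨⟨i, j, p⟩, hp⟩ h
    refine ⟨ν.symm i, Subtype.ext ?_⟩
    change (⟨i, j, p⟩ : AnyPath V) = AnyPath.trivial (ν (ν.symm i))
    rw [Equiv.apply_symm_apply]
    cases p with
    | nil => rfl
    | cons p a => exact absurd h (Nat.succ_ne_zero _)
  mul_idem_src p := by
    rw [Module.Basis.mk_apply, numberedIdem_symm, NonzeroPath.toAlgebra, ← map_mul,
      (PathAlgebra.ofPath_mul_vertex p.1.1 p.1).1]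
  idem_tgt_mul p := by
    rw [Module.Basis.mk_apply, numberedIdem_symm, NonzeroPath.toAlgebra, ← map_mul,
      (PathAlgebra.vertex_mul_ofPath p.1.1 p.1).1]
  mul_idem_of_ne p i h := by
    rw [← ν.symm_apply_apply i, Module.Basis.mk_apply, numberedIdem_symm, NonzeroPath.toAlgebra,
      ← map_mul, (PathAlgebra.ofPath_mul_vertex (ν i) p.1).2, map_zero]
    exact fun h' => h (by rw [← h', Equiv.symm_apply_apply])
  idem_mul_of_ne p i h := by
    rw [← ν.symm_apply_apply i, Module.Basis.mk_apply, numberedIdem_symm, NonzeroPath.toAlgebra,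
      ← map_mul, (PathAlgebra.vertex_mul_ofPath (ν i) p.1).2, map_zero]
    exact fun h' => h (by rw [← h', Equiv.symm_apply_apply])
  sum_idem := by
    rw [← map_one (Ideal.Quotient.mk (pathIdeal k S)), PathAlgebra.one_def, map_sum]
    exact Equiv.sum_comp ν fun i => Ideal.Quotient.mk (pathIdeal k S) (PathAlgebra.vertex k i)
  mul_mem p q := by
    simp only [Module.Basis.mk_apply]
    cases h : AnyPath.mul? p.1 q.1 with
    | none => exact Or.inl (toAlgebra_mul_of_none h)
    | some r =>
      rw [toAlgebra_mul_of_some h]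
      by_cases hr : PathAlgebra.ofPath k r ∈ pathIdeal k S
      · exact Or.inl (Ideal.Quotient.eq_zero_iff_mem.2 hr)
      · exact Or.inr ⟨⟨r, hr⟩, rfl, AnyPath.length_of_mul?_eq_some h⟩

theorem IsAdmissible.pathBasis_basis (hS : IsAdmissible k S) {n : ℕ} (ν : Fin n ≃ V)
    (p : NonzeroPath k S) : (hS.pathBasis ν).basis p = NonzeroPath.toAlgebra k S p :=
  Module.Basis.mk_apply linearIndependent_toAlgebra top_le_span_toAlgebra p

/-- By linear independence, equal nonzero products in `A` come from the same path of `Q`, where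
factorizations refine. The connecting path is nonzero in `A` because it is a factor of the nonzero
path `q'`. -/
theorem IsAdmissible.isMonomial_pathBasis (hS : IsAdmissible k S) {n : ℕ} (ν : Fin n ≃ V) :
    (hS.pathBasis ν).IsMonomial := by
  have hmul : ∀ p q : NonzeroPath k S,
      NonzeroPath.toAlgebra k S p * NonzeroPath.toAlgebra k S q ≠ 0 →
      ∃ r : NonzeroPath k S, AnyPath.mul? p.1 q.1 = some r.1 := by
    intro p q hne
    cases h : AnyPath.mul? p.1 q.1 with
    | none => exact absurd (toAlgebra_mul_of_none h) hne
    | some r =>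
      rw [toAlgebra_mul_of_some h] at hne
      exact ⟨⟨r, fun hr => hne (Ideal.Quotient.eq_zero_iff_mem.2 hr)⟩, rfl⟩
  intro p q p' q' h hne hl
  simp only [hS.pathBasis_basis] at h hne ⊢
  obtain ⟨r, hr⟩ := hmul p q hne
  obtain ⟨r', hr'⟩ := hmul p' q' (h ▸ hne)
  rw [toAlgebra_mul_of_some hr, toAlgebra_mul_of_some hr'] at h
  obtain rfl : r = r' := (linearIndependent_toAlgebra (k := k) (S := S)).injective h
  obtain ⟨c, hc1, hc2⟩ := AnyPath.exists_of_mul?_eq hr hr' hl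
  have hc : PathAlgebra.ofPath k c ∉ pathIdeal k S := fun hc =>
    q'.2 (ofPath_mem_pathIdeal_of_mul hc1 (Or.inl hc))
  exact ⟨⟨c, hc⟩, toAlgebra_mul_of_some (p := ⟨c, hc⟩) hc1,
    toAlgebra_mul_of_some (q := ⟨c, hc⟩) hc2⟩

theorem IsAdmissible.range_pathBasis (hS : IsAdmissible k S) {n : ℕ} (ν : Fin n ≃ V) :
    Set.range (hS.pathBasis ν).basis = MonomialAlgebra.paths k S := by
  ext x
  constructor
  · rintro ⟨p, rfl⟩
    exact ⟨p.1, p.2, hS.pathBasis_basis ν p⟩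
  · rintro ⟨p, hp, rfl⟩
    exact ⟨⟨p, hp⟩, hS.pathBasis_basis ν ⟨p, hp⟩⟩

end

end MonomialBorel

/-! ### The theorem for `e A e` -/

theorem proposition6p1 {k : Type u} [Field k] {V : Type v} [Fintype V] [Quiver.{w} V]
    [∀ a b : V, Finite (a ⟶ b)] (S : Set (AnyPath V)) (hS : IsAdmissible k S)
    {n : ℕ} (ν : Fin n ≃ V) (hA : IsQuasiHereditary k (MonomialAlgebra.numberedIdem k S ν))
    (i₀ : Fin n) :
    IsQuasiHereditary k (MonomialAlgebra.upperCornerIdem k S ν i₀) ∧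
    -- `e B e` is the subalgebra generated by the right-minimal direction-preserving paths of `e A e`
    cornerSet (MonomialAlgebra.isIdempotentElem_e k S ν i₀)
        (MonomialAlgebra.minSubalgebra k S ν : Set (MonomialAlgebra k S)) =
      (MonomialAlgebra.upperCornerMinSubalgebra k S ν i₀ : Set (MonomialAlgebra.UpperCorner k S ν i₀)) ∧
    -- and it is an exact Borel subalgebra of `e A e`
    IsExactBorel (MonomialAlgebra.upperCornerMinSubalgebra k S ν i₀)
      (MonomialAlgebra.upperCornerIdem k S ν i₀) := by
  have := hS.finite_nonzeroPath
  have := Fintype.ofFinite (NonzeroPath k S)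
  have h := (hS.pathBasis ν).corner_of_isQuasiHereditaryBasis
    (MonomialAlgebra.orthogonalIdempotents_numberedIdem k S ν) i₀ (hS.isMonomial_pathBasis ν)
    ((hS.pathBasis ν).isQuasiHereditaryBasis hA)
  rw [hS.range_pathBasis ν] at h
  exact h
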